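/- **Setting.** Let $\psi\in C_0^\infty(\mathbf R^3)$ be real-valued, radially decreasing, supported in $|x|\le 2$, with $\psi=1$ on $|x|\le 1$. For $j\in\mathbf Z$ let $P_j$ be the Fourier multiplier with symbol $\psi(2^{-j}\xi)-\psi(2^{1-j}\xi)$, $P_{\le j}=\sum_{l\le j}P_l$ the multiplier with symbol $\psi(2^{-j}\xi)$, and $P_{\ge j}=1-P_{\le j-1}$. Fix $0<\epsilon<\frac12$, put $s=\frac12+\epsilon$, and for an integer $k_0\ge 1$ let $$I=P_{\le k_0}+\sum_{j>0}2^{-j(\frac12-\epsilon)}P_{j+k_0}.$$ Let $J\subset\mathbf R$ be an interval, let $B_l=\{|x|\le 2^l\}$, and $$\|F\|_{l^\infty_jL^2_{t,x}(J\times\mathbf R^3)}=\sup_{l\in\mathbf Z,\ l\ge -j}2^{-l/2}\|F\|_{L^2_{t,x}(J\times B_l)},$$ $$\mathcal S(j,f)=\|P_jf\|_{L^2_tL^\infty_x}+2^{j/2}\|P_jf\|_{L^4_{t,x}}+2^j\|P_jf\|_{L^\infty_tL^2_x}+\|P_j\partial_tf\|_{L^\infty_tL^2_x}+2^j\|P_jf\|_{l^\infty_jL^2_{t,x}},$$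 where all norms are over $J\times\mathbf R^3$, $P_j\partial_t f=\partial_tP_jf$ in the weak sense, and norms may be $+\infty$ (with $0\cdot\infty=0$). $\dot H^\sigma$ is the space of tempered distributions whose Fourier transform is a locally integrable function, with norm $\||\xi|^\sigma\hat f\|_{L^2}$ (set equal to $+\infty$ for all other functions). **Theorem.** For every $\psi$, every $\epsilon\in(0,\frac12)$, and all $c>0$, $K$, there is a constant $C=C(\psi,\epsilon,c,K)$ such that the following holds for every integer $k_0\ge1$, every interval $J$, every measurable $M:\mathbf R^3\to\mathbf R$ with $|M(x)|\le Ke^{-c|x|}$, and all real-valued measurable functions $f,g,h$ on $J\times\mathbf R^3$. Norms without an indicated domain are over $J\times\mathbf R^3$. 1. If $f,g,h$ are radial in $x$, then $$\|I(Mfg)(P_{\le k_0}h)\|_{L^1_{t,x}}+\|Mfg(P_{\le k_0}h)\|_{L^1_{t,x}}\le C\,2^{k_0/2}|k_0|\,\|f\|_{l^\infty_{k_0}L^2_{t,x}}\|g\|_{l^\infty_{k_0}L^2_{t,x}}\|h\|_{L^\infty_tL^2_x}.$$ 2. If $f,g$ are radial in $x$, then, with $\Omega=\{x:|x|>2^{1-k_0}\}$,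 $$\Big\|I(Mfg)\tfrac1{|x|}\Big\|_{L^1_{t,x}(J\times\Omega)}+\Big\|Mfg\tfrac1{|x|}\Big\|_{L^1_{t,x}(J\times\Omega)}\le C\,|k_0|\,\|f\|_{l^\infty_{k_0}L^2_{t,x}}\|g\|_{l^\infty_{k_0}L^2_{t,x}}.$$ 3. $$\|I(Mgh)f\|_{L^1_{t,x}}\le C\,|k_0|\,\|g\|_{L^2_{t,x}}\|f\|_{l^\infty_{k_0}L^2_{t,x}}\Big(2^{-k_0/2}\|h\|_{L^\infty_{t,x}}+\||x|^{1/2}h\|_{L^\infty_{t,x}}\Big).$$ 4. If $f$ is radial in $x$ and, for every $t\in J$, $f(t)$ is a tempered distribution whose Fourier transform is a locally integrable function, then $$\|I(M(P_{\ge k_0-7}f)^3)\|_{L^1_tL^2_x}\le C\,2^{k_0(1-s-\epsilon)}\Big(\sup_{j\ge k_0-7}2^{-j(1-s)}\mathcal S(j,f)\Big)^3+C\,2^{k_0(1-s-\epsilon)}\Big(\sup_{j\ge k_0-7}2^{-j(1-s)}\mathcal S(j,f)\Big)^2\|f\|_{L^\infty_t\dot H^s}.$$ 5. If $f,g$ are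 radial in $x$ (and $f(t)$ is tempered, so that $P_jf$ is defined), then for every $j\in\mathbf Z$ $$\|M(P_jf)g\|_{L^2_{t,x}}\le C\,|k_0|\,2^{-j}\mathcal S(j,f)\Big(2^{-k_0/2}\|g\|_{L^\infty_{t,x}}+\|g\|_{L^\infty_t\dot H^1}\Big).$$ 6. If, for every $t\in J$, $f(t)$ is a tempered distribution whose Fourier transform is a locally integrable function, then $$\Big\|I(Mfgh)\,\psi(2^{k_0}x)\tfrac1{|x|^{3/4}}\Big\|_{L^{4/3}_{t,x}}\le C\,2^{-k_0s}\Big(\sup_{j\in\mathbf Z}2^{-j(1-s)}\mathcal S(j,f)\Big)\|g^2\|_{l^\infty_{k_0}L^2_{t,x}}^{1/2}\|h\|_{L^\infty_{t,x}}.$$ -/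

import Mathlib

open MeasureTheory Set
open scoped ENNReal NNReal ContDiff FourierTransform SchwartzMap

noncomputable section

/-- Physical and frequency space `ℝ³` with the Euclidean norm. -/
abbrev E3 : Type := EuclideanSpace ℝ (Fin 3)

/-- The cutoff that generates the Littlewood-Paley decomposition: a smooth function on `ℝ³`, radially
decreasing (in particular radial), supported in `|x| ≤ 2` and equal to `1` on `|x| ≤ 1`. -/
structure IsLPCutoff (ψ : E3 → ℝ) : Prop where
  smooth : ContDiff ℝ ∞ ψ
  radial_decreasing : ∀ x y : E3, ‖x‖ ≤ ‖y‖ → ψ y ≤ ψ x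
  eq_one : ∀ x : E3, ‖x‖ ≤ 1 → ψ x = 1
  eq_zero : ∀ x : E3, 2 ≤ ‖x‖ → ψ x = 0

/-! ### Fourier multipliers -/

/-- The convolution kernel `(2π)⁻³ ∫ e^{i x·ξ} m(ξ) dξ` of the Fourier multiplier with real radial symbol `m`
(`ξ` being the angular frequency, so that `m` is rescaled by `2π` to match the convention
`𝓕⁻ F x = ∫ e^{2πi x·η} F(η) dη`). The kernel of a radial real symbol is real. -/
def multKernel (m : E3 → ℝ) (x : E3) : ℝ :=
  (𝓕⁻ (fun η : E3 => ((m ((2 * Real.pi) • η) : ℝ) : ℂ)) x).re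

/-- The Fourier multiplier with symbol `m`, as convolution with its kernel. -/
def multOp (m : E3 → ℝ) (f : E3 → ℝ) (x : E3) : ℝ :=
  ∫ y, multKernel m (x - y) * f y

/-- `P_j`: the multiplier with symbol `ψ(ξ / 2^j) - ψ(2 ξ / 2^j)`. -/
def lpProj (ψ : E3 → ℝ) (j : ℤ) : (E3 → ℝ) → E3 → ℝ :=
  multOp fun ξ => ψ (((2 : ℝ) ^ j)⁻¹ • ξ) - ψ ((2 * ((2 : ℝ) ^ j)⁻¹) • ξ)

/-- `P_{≤ j} = ∑_{l ≤ j} P_l`. The symbols telescope to `ψ(ξ / 2^j)` at every `ξ ≠ 0`. -/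
def lpProjLe (ψ : E3 → ℝ) (j : ℤ) : (E3 → ℝ) → E3 → ℝ :=
  multOp fun ξ => ψ (((2 : ℝ) ^ j)⁻¹ • ξ)

/-- `P_{≥ j} = P_{> j - 1} = 1 - P_{≤ j - 1}`. -/
def lpProjGe (ψ : E3 → ℝ) (j : ℤ) (f : E3 → ℝ) (x : E3) : ℝ :=
  f x - lpProjLe ψ (j - 1) f x

/-- The smoothing operator `I = P_{≤ k₀} + ∑_{j > 0} 2^{-j (1/2 - ε)} P_{j + k₀}`
(the summation index below is `n = j - 1`). -/
def opI (ψ : E3 → ℝ) (ε : ℝ) (k₀ : ℤ) (f : E3 → ℝ) (x : E3) : ℝ :=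
  lpProjLe ψ k₀ f x +
    ∑' n : ℕ, (2 : ℝ) ^ (-((n : ℝ) + 1) * (1 / 2 - ε)) * lpProj ψ ((n : ℤ) + 1 + k₀) f x

/-! ### Homogeneous Sobolev norms -/

/-- The real function `f` is a tempered distribution and its distributional Fourier transform
(in the convention `∫ e^{-2πi x·η} f(x) dx`) is the function `w`; that `w φ` is integrable for every
Schwartz `φ` forces `w` to be locally integrable. -/
def IsFourierTransform (f : E3 → ℝ) (w : E3 → ℂ) : Prop :=
  ∀ φ : 𝓢(E3, ℂ),
    Integrable (fun x => (f x : ℂ) * φ x) ∧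
    Integrable (fun x => w x * φ x) ∧
    ∫ x, (f x : ℂ) * (𝓕 φ) x = ∫ x, w x * φ x

/-- `f` is a tempered distribution whose Fourier transform is a (locally integrable) function. This is the
class in which the homogeneous Sobolev spaces are defined; it excludes nonzero polynomials, which the
operators `P_j` do not see. -/
def HasFourierFun (f : E3 → ℝ) : Prop := ∃ w, IsFourierTransform f w

/-- The norm of `f` in the homogeneous Sobolev space `Ḣ^σ(ℝ³)`, i.e. `‖ |ξ|^σ f̂ ‖_{L²}` in the angular
frequency `ξ = 2πη`; it is `∞` if the Fourier transform of `f` is not a function. (The Fourier transform is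
unique up to null sets, so the infimum is over one value or none.) -/
def hDotNorm (σ : ℝ) (f : E3 → ℝ) : ℝ≥0∞ :=
  ⨅ (w : E3 → ℂ) (_ : IsFourierTransform f w),
    eLpNorm (fun η : E3 => ((2 * Real.pi * ‖η‖) ^ σ) • w η) 2 volume

/-! ### Space-time norms -/

/-- Measurability of a function of `(t, x) ∈ J × ℝ³`. -/
def MeasurableOnST (J : Set ℝ) (f : ℝ → E3 → ℝ) : Prop :=
  AEStronglyMeasurable (Function.uncurry f) ((volume.restrict J).prod volume)

/-- `f(t, ·)` is radial for every `t ∈ J`. -/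
def RadialOn (J : Set ℝ) (f : ℝ → E3 → ℝ) : Prop :=
  ∀ t ∈ J, ∀ x y : E3, ‖x‖ = ‖y‖ → f t x = f t y

/-- The norm `‖F‖_{L^p_t L^q_x(J × A)}`; the norm of `L^p_{t,x}(J × A)` is the case `q = p`. -/
def stNorm (p q : ℝ≥0∞) (J : Set ℝ) (A : Set E3) (F : ℝ → E3 → ℝ) : ℝ≥0∞ :=
  eLpNorm (fun t => eLpNorm (F t) q (volume.restrict A)) p (volume.restrict J)

/-- The norm `‖F‖_{L^∞_t Ḣ^σ_x(J × ℝ³)}`. -/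
def supHDotNorm (σ : ℝ) (J : Set ℝ) (F : ℝ → E3 → ℝ) : ℝ≥0∞ :=
  eLpNorm (fun t => hDotNorm σ (F t)) ∞ (volume.restrict J)

/-- The local energy norm `‖F‖_{l^∞_j L²_{t,x}(J × ℝ³)} = sup_{l ≥ -j} 2^{-l/2} ‖F‖_{L²_{t,x}(J × B_l)}`,
`B_l = {|x| ≤ 2^l}`. -/
def localEnergyNorm (j : ℤ) (J : Set ℝ) (F : ℝ → E3 → ℝ) : ℝ≥0∞ :=
  ⨆ (l : ℤ) (_ : -j ≤ l),
    (2 : ℝ≥0∞) ^ (-(l : ℝ) / 2) * stNorm 2 2 J (Metric.closedBall 0 ((2 : ℝ) ^ l)) F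

/-- `V` is the weak (distributional) time derivative of `F` in the interior of `J × ℝ³`. -/
structure IsWeakTimeDeriv (J : Set ℝ) (F V : ℝ → E3 → ℝ) : Prop where
  measurable : MeasurableOnST J V
  locInt : LocallyIntegrableOn (Function.uncurry F) (interior J ×ˢ univ)
  locInt' : LocallyIntegrableOn (Function.uncurry V) (interior J ×ˢ univ)
  integral_eq : ∀ η : ℝ × E3 → ℝ, ContDiff ℝ ∞ η → HasCompactSupport η →
    tsupport η ⊆ interior J ×ˢ univ →
    ∫ p : ℝ × E3, F p.1 p.2 * deriv (fun τ => η (τ, p.2)) p.1 = - ∫ p : ℝ × E3, V p.1 p.2 * η p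

/-- `‖∂_t F‖_{L^∞_t L²_x(J × ℝ³)}`, equal to `∞` if `F` has no weak time derivative. (The weak time derivative
is unique up to null sets, so the infimum is over one value or none.) -/
def timeDerivNorm (J : Set ℝ) (F : ℝ → E3 → ℝ) : ℝ≥0∞ :=
  ⨅ (V : ℝ → E3 → ℝ) (_ : IsWeakTimeDeriv J F V), stNorm ∞ 2 J univ V

/-- The frequency-localized Strichartz norm
`S(j, f) = ‖P_j f‖_{L²_t L^∞_x} + 2^{j/2} ‖P_j f‖_{L⁴_{t,x}} + 2^j ‖P_j f‖_{L^∞_t L²_x}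
  + ‖P_j ∂_t f‖_{L^∞_t L²_x} + 2^j ‖P_j f‖_{l^∞_j L²_{t,x}}` on `J × ℝ³`, where `P_j ∂_t f = ∂_t P_j f`. -/
def strichartzS (ψ : E3 → ℝ) (J : Set ℝ) (j : ℤ) (f : ℝ → E3 → ℝ) : ℝ≥0∞ :=
  stNorm 2 ∞ J univ (fun t => lpProj ψ j (f t)) +
  (2 : ℝ≥0∞) ^ ((j : ℝ) / 2) * stNorm 4 4 J univ (fun t => lpProj ψ j (f t)) +
  (2 : ℝ≥0∞) ^ (j : ℝ) * stNorm ∞ 2 J univ (fun t => lpProj ψ j (f t)) +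
  timeDerivNorm J (fun t => lpProj ψ j (f t)) +
  (2 : ℝ≥0∞) ^ (j : ℝ) * localEnergyNorm j J (fun t => lpProj ψ j (f t))

end

noncomputable section

/-! ### Powers of two and dyadic balls -/

/-! Apart from Plancherel and the reconstruction of a function from its pieces, frequency
localization enters only through positive kernels. A Littlewood-Paley kernel at frequency 2^m is at
most a constant times 2^(3m) (1 + 2^m|z|)^(-8). Hence |I F| is bounded by the convolution of |F|
with `smoothingKernel`, a sum of such kernels at frequencies 2^(k₀+n), n ≥ 0, with coefficients
2^(-(1/2-ε)n).

The central weight is `weight k₀`, comparable to min(2^k₀, 1/|x|). It varies slowly at scale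
2^(-k₀), so it passes through the kernel of I up to a constant. The local energy norm bounds the
squared mass in a ball of radius r ≥ 2^(-k₀) by a multiple of r, so each dyadic shell contributes
O(1) to the weighted L² norm. About k₀ shells lie between radii 2^(-k₀) and 1, and the decay of M
makes the outer ones summable. This is `lintegral_weight_sq_le`, the source of the factor |k₀|.

Radial symmetry gives pointwise decay: a ball of radius r about x sees only a fraction (r/|x|)² of
the directions, so it carries at most that fraction of a radial mass. Convolution then gives
|P_{≤m}h| ≲ 2^(m/2) `weight m` ‖h‖₂, and summing the pieces gives |x|^(1/2)|g| ≲ ‖g‖ in Ḣ¹.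
Estimates 1 and 2 follow because P_{≤k₀}h and 1/|x| (outside the small ball) are bounded by the
weight. In 3 and 5 one factor has its square bounded by the weight, and Cauchy-Schwarz finishes.

For estimate 6, |x|^(-1)(1 + 2^k₀|x|)^(-2) is stable under the kernel of I, so I can be dropped in
L^(4/3). Hölder with exponents 3/2 and 3 separates f from g; the weighted L² norm of f is summed
over frequency pieces, which decay geometrically away from 2^k₀.

For estimate 4, write H for the sum of the |P_j f| with j ≥ k₀-7. Radial Sobolev gives H ≤ D/|x|,
hence H³ ≤ D |x|^(-θ) (|x|^(θ-1) H²). A Stein-Weiss inequality for the kernel of I removes |x|^(-θ)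
at cost 2^(k₀θ). The remaining quartic integral is handled by ordering the frequencies: the lower
ones go in L²_t L^∞_x, the top one in a weighted L² norm. In 4 and 6, f is recovered from its pieces
almost everywhere, which uses that its Fourier transform is a function. -/

lemma two_rpow_add (x y : ℝ) : (2 : ℝ≥0∞) ^ (x + y) = 2 ^ x * 2 ^ y :=
  ENNReal.rpow_add _ _ two_ne_zero ENNReal.ofNat_ne_top

lemma two_rpow_ne_zero (x : ℝ) : (2 : ℝ≥0∞) ^ x ≠ 0 :=
  (ENNReal.rpow_pos two_pos ENNReal.ofNat_ne_top).ne'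

lemma two_rpow_ne_top (x : ℝ) : (2 : ℝ≥0∞) ^ x ≠ ⊤ :=
  ENNReal.rpow_ne_top_of_ne_zero two_ne_zero ENNReal.ofNat_ne_top

lemma two_rpow_le {x y : ℝ} (h : x ≤ y) : (2 : ℝ≥0∞) ^ x ≤ 2 ^ y :=
  ENNReal.rpow_le_rpow_of_exponent_le (by norm_num) h

lemma two_rpow_rpow (x y : ℝ) : ((2 : ℝ≥0∞) ^ x) ^ y = 2 ^ (x * y) := (ENNReal.rpow_mul _ _ _).symm

lemma two_rpow_sq (x : ℝ) : ((2 : ℝ≥0∞) ^ x) ^ 2 = 2 ^ (2 * x) := by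
  rw [sq, ← two_rpow_add]; ring_nf

lemma ofReal_two_zpow (k : ℤ) : ENNReal.ofReal ((2 : ℝ) ^ k) = (2 : ℝ≥0∞) ^ (k : ℝ) := by
  rw [← Real.rpow_intCast, ← ENNReal.ofReal_rpow_of_pos two_pos, ENNReal.ofReal_ofNat]

lemma norm_le_two_zpow_iff {x : E3} {l : ℤ} : ‖x‖ ≤ (2 : ℝ) ^ l ↔ ‖x‖ₑ ≤ (2 : ℝ≥0∞) ^ (l : ℝ) := by
  rw [← ofReal_two_zpow, ← ofReal_norm, ENNReal.ofReal_le_ofReal_iff (by positivity)]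

lemma tsum_two_rpow {a : ℝ} (ha : 0 < a) :
    ∃ C : ℝ≥0, ∑' n : ℕ, (2 : ℝ≥0∞) ^ (-(a * n)) = C := by
  have h : ∀ n : ℕ, (2 : ℝ≥0∞) ^ (-(a * n)) = (2 ^ (-a)) ^ n := fun n => by
    rw [← ENNReal.rpow_natCast, two_rpow_rpow]; ring_nf
  have h1 : (2 : ℝ≥0∞) ^ (-a) < 1 := ENNReal.rpow_lt_one_of_one_lt_of_neg (by norm_num) (by linarith)
  simp_rw [h, ENNReal.tsum_geometric]
  refine ⟨((1 - (2 : ℝ≥0∞) ^ (-a))⁻¹).toNNReal, (ENNReal.coe_toNNReal ?_).symm⟩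
  simpa [tsub_eq_zero_iff_le] using h1

/-- The closed ball of radius `2 ^ l`. -/
def dball (l : ℤ) : Set E3 := Metric.closedBall 0 ((2 : ℝ) ^ l)

lemma mem_dball {l : ℤ} {x : E3} : x ∈ dball l ↔ ‖x‖ₑ ≤ (2 : ℝ≥0∞) ^ (l : ℝ) := by
  rw [dball, mem_closedBall_zero_iff, norm_le_two_zpow_iff]

lemma measurableSet_dball (l : ℤ) : MeasurableSet (dball l) := measurableSet_closedBall

/-- The volume of the unit ball. -/
def unitVol : ℝ≥0 := (volume (Metric.ball (0 : E3) 1)).toNNReal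

lemma volume_closedBall_zpow (x : E3) (l : ℤ) :
    volume (Metric.closedBall x ((2 : ℝ) ^ l)) = 2 ^ (3 * (l : ℝ)) * unitVol := by
  rw [Measure.addHaar_closedBall _ _ (by positivity), finrank_euclideanSpace_fin, unitVol,
    ENNReal.coe_toNNReal measure_ball_lt_top.ne, ENNReal.ofReal_pow (by positivity), ofReal_two_zpow,
    ← ENNReal.rpow_natCast, two_rpow_rpow]
  congr 2; push_cast; ring

lemma volume_dball (l : ℤ) : volume (dball l) = 2 ^ (3 * (l : ℝ)) * unitVol := volume_closedBall_zpow 0 l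

/-- Take the first ball of the chain that contains x. If it is the initial one, `c 0` applies;
otherwise x misses the previous ball and `c (n + 1)` applies. A single term of the sum already
dominates. -/
lemma le_tsum_layers (l : ℤ) (x : E3) {v : ℝ≥0∞} {c : ℕ → ℝ≥0∞} (h0 : x ∈ dball l → v ≤ c 0)
    (h1 : ∀ n : ℕ, x ∉ dball (n + l) → v ≤ c (n + 1)) :
    v ≤ ∑' n : ℕ, (dball (n + l)).indicator (fun _ => c n) x := by
  have hex : ∃ n : ℕ, x ∈ dball (n + l) := by
    obtain ⟨n, hn⟩ := pow_unbounded_of_one_lt (‖x‖ / 2 ^ l) (one_lt_two (α := ℝ))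
    refine ⟨n, ?_⟩
    rw [dball, mem_closedBall_zero_iff, zpow_add₀ two_ne_zero, zpow_natCast]
    exact ((div_lt_iff₀ (by positivity)).1 hn).le
  classical
  have hm := Nat.find_spec hex
  refine le_trans ?_ (ENNReal.le_tsum (Nat.find hex))
  rw [indicator_of_mem hm]
  rcases h : Nat.find hex with _ | n
  · rw [h] at hm; exact h0 (by simpa using hm)
  · exact h1 n (Nat.find_min hex (m := n) (by omega))

/-- Replaces a decaying weight by a combination of indicators of concentric balls, so that only
masses of balls have to be known. Kernels around a point and space-time weights around the origin
are both treated this way. -/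
lemma lintegral_layers (l : ℤ) (a : E3) {φ G : E3 → ℝ≥0∞} {c : ℕ → ℝ≥0∞} (hG : AEMeasurable G)
    (h0 : ∀ x ∈ dball l, φ x ≤ c 0) (h1 : ∀ x, ∀ n : ℕ, x ∉ dball (n + l) → φ x ≤ c (n + 1)) :
    ∫⁻ y, φ (y - a) * G y ≤
      ∑' n : ℕ, c n * ∫⁻ y in Metric.closedBall a ((2 : ℝ) ^ ((n : ℤ) + l)), G y := by
  have hset : ∀ n : ℕ, (fun y => y - a) ⁻¹' dball (n + l) =
      Metric.closedBall a ((2 : ℝ) ^ ((n : ℤ) + l)) := fun n => by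
    ext y; simp [dball, dist_eq_norm]
  calc ∫⁻ y, φ (y - a) * G y
      ≤ ∫⁻ y, ∑' n : ℕ, c n * (Metric.closedBall a ((2 : ℝ) ^ ((n : ℤ) + l))).indicator G y := by
        refine lintegral_mono fun y => ?_
        refine (mul_le_mul_left (le_tsum_layers l (y - a) (h0 _) (h1 _)) (G y)).trans ?_
        rw [← ENNReal.tsum_mul_right]
        refine ENNReal.tsum_le_tsum fun n => ?_
        rw [← hset n]
        by_cases hy : y - a ∈ dball (n + l)
        · rw [indicator_of_mem hy, indicator_of_mem (by exact hy)]
        · rw [indicator_of_notMem hy]; simp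
    _ = _ := by
        rw [lintegral_tsum fun n => (hG.indicator measurableSet_closedBall).const_mul _]
        congr 1; ext n
        rw [lintegral_const_mul'' _ (hG.indicator measurableSet_closedBall),
          lintegral_indicator measurableSet_closedBall]

/-- A negative power of `|y|` below the dimension is integrable over small balls. -/
lemma lintegral_dball_rpow {a : ℝ} (ha0 : 0 ≤ a) (ha : a < 3) : ∃ C : ℝ≥0, ∀ l : ℤ,
    ∫⁻ y in dball l, ‖y‖ₑ ^ (-a) ≤ C * 2 ^ ((3 - a) * l) := by
  obtain ⟨C, hC⟩ := tsum_two_rpow (show 0 < 3 - a by linarith)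
  refine ⟨(2 : ℝ≥0) ^ a * unitVol * C, fun l => ?_⟩
  -- The last ball of radius 2^(l-n) containing y forces |y| > 2^(l-n-1). The origin lies in all of
  -- them and is discarded as a null set.
  have key : ∀ y ∈ dball l, y ≠ 0 → ‖y‖ₑ ^ (-a) ≤
      ∑' n : ℕ, (dball (l - n)).indicator (fun _ => (2 : ℝ≥0∞) ^ (a * (n + 1 - l))) y := by
    intro y hy hy0
    have hex : ∃ n : ℕ, y ∉ dball (l - n) := by
      obtain ⟨n, hn⟩ := exists_pow_lt_of_lt_one (show 0 < ‖y‖ / 2 ^ l by positivity)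
        (show (1 / 2 : ℝ) < 1 by norm_num)
      refine ⟨n, ?_⟩
      rw [dball, mem_closedBall_zero_iff, not_le, zpow_sub₀ two_ne_zero, zpow_natCast]
      rw [lt_div_iff₀ (by positivity)] at hn
      calc _ = (1 / 2) ^ n * (2 : ℝ) ^ l := by rw [one_div, inv_pow]; ring
        _ < _ := hn
    classical
    rcases h : Nat.find hex with _ | n
    · have := Nat.find_spec hex
      rw [h] at this; exact absurd (by simpa using hy) this
    have h1 := Nat.find_spec hex
    have h2 := Nat.find_min hex (m := n) (by omega)
    rw [h] at h1; rw [not_not] at h2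
    refine le_trans ?_ (ENNReal.le_tsum n)
    rw [indicator_of_mem h2]
    rw [mem_dball, not_le] at h1
    calc ‖y‖ₑ ^ (-a) ≤ (2 ^ (((l - (n + 1 : ℕ) : ℤ)) : ℝ)) ^ (-a) := by
          rw [ENNReal.rpow_neg, ENNReal.rpow_neg]
          exact ENNReal.inv_le_inv.2 (ENNReal.rpow_le_rpow h1.le ha0)
      _ = _ := by rw [two_rpow_rpow]; congr 1; push_cast; ring
  calc ∫⁻ y in dball l, ‖y‖ₑ ^ (-a)
      ≤ ∫⁻ y, ∑' n : ℕ, (dball (l - n)).indicator (fun _ => (2 : ℝ≥0∞) ^ (a * (n + 1 - l))) y := by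
        refine (lintegral_mono_ae ?_).trans (setLIntegral_le_lintegral _ _)
        filter_upwards [ae_restrict_mem (measurableSet_dball l),
          ae_restrict_of_ae (Measure.ae_ne volume (0 : E3))] with y h1 h2 using key y h1 h2
    _ = ∑' n : ℕ, (2 : ℝ≥0∞) ^ a * unitVol * 2 ^ ((3 - a) * l) * 2 ^ (-((3 - a) * n)) := by
        rw [lintegral_tsum fun n => (measurable_const.indicator (measurableSet_dball _)).aemeasurable]
        congr 1; ext n
        rw [lintegral_indicator_const (measurableSet_dball _), volume_dball]
        have : (2 : ℝ≥0∞) ^ (a * (n + 1 - l)) * 2 ^ (3 * ((l - n : ℤ) : ℝ)) =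
            2 ^ a * 2 ^ ((3 - a) * l) * 2 ^ (-((3 - a) * n)) := by
          simp_rw [← two_rpow_add]; congr 1; push_cast; ring
        rw [← mul_assoc, this]; ring
    _ = _ := by
        rw [ENNReal.tsum_mul_left, hC]; push_cast
        rw [ENNReal.coe_rpow_of_nonneg _ ha0]; push_cast; ring

/-! ### Rapidly decreasing kernels and slowly varying weights -/

/-- The Japanese bracket `1 + 2 ^ m |x|`. -/
def bracket (m : ℤ) (x : E3) : ℝ≥0∞ := 1 + 2 ^ (m : ℝ) * ‖x‖ₑ

/-- The model kernel at frequency `2 ^ m`, with decay of order `N`. -/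
def decayKernel (m : ℤ) (N : ℝ) (z : E3) : ℝ≥0∞ := 2 ^ (3 * (m : ℝ)) * bracket m z ^ (-N)

/-- The weight `2 ^ m / (1 + 2 ^ m |x|)`. -/
def weight (m : ℤ) (x : E3) : ℝ≥0∞ := 2 ^ (m : ℝ) * bracket m x ^ (-1 : ℝ)

lemma one_le_bracket (m : ℤ) (x : E3) : 1 ≤ bracket m x := le_self_add

lemma bracket_ne_zero (m : ℤ) (x : E3) : bracket m x ≠ 0 :=
  (zero_lt_one.trans_le (one_le_bracket m x)).ne'

lemma bracket_ne_top (m : ℤ) (x : E3) : bracket m x ≠ ⊤ := by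
  exact ENNReal.add_ne_top.2 ⟨by simp, ENNReal.mul_ne_top (two_rpow_ne_top _) enorm_ne_top⟩

lemma bracket_rpow_add (m : ℤ) (x : E3) (a b : ℝ) :
    bracket m x ^ (a + b) = bracket m x ^ a * bracket m x ^ b :=
  ENNReal.rpow_add _ _ (bracket_ne_zero m x) (bracket_ne_top m x)

lemma bracket_rpow_le (m : ℤ) (x : E3) {a b : ℝ} (h : a ≤ b) : bracket m x ^ a ≤ bracket m x ^ b :=
  ENNReal.rpow_le_rpow_of_exponent_le (one_le_bracket m x) h

@[fun_prop]
lemma measurable_bracket (m : ℤ) : Measurable (bracket m) := by unfold bracket; fun_prop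

@[fun_prop]
lemma measurable_decayKernel (m : ℤ) (N : ℝ) : Measurable (decayKernel m N) := by
  unfold decayKernel; fun_prop

@[fun_prop]
lemma measurable_weight (m : ℤ) : Measurable (weight m) := by unfold weight; fun_prop

lemma bracket_neg (m : ℤ) (x : E3) : bracket m (-x) = bracket m x := by simp [bracket]

lemma decayKernel_sub_comm (m : ℤ) (N : ℝ) (x y : E3) :
    decayKernel m N (x - y) = decayKernel m N (y - x) := by
  rw [decayKernel, ← neg_sub, bracket_neg, ← decayKernel]

lemma bracket_mono {m n : ℤ} (h : m ≤ n) (x : E3) : bracket m x ≤ bracket n x := by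
  unfold bracket; gcongr; · norm_num

/-- Peetre's inequality: the triangle inequality, with the missing product term added to complete
the factorization. -/
lemma bracket_le_mul (m : ℤ) (x y : E3) : bracket m x ≤ bracket m y * bracket m (x - y) := by
  have : ‖x‖ₑ ≤ ‖y‖ₑ + ‖x - y‖ₑ := by simpa using enorm_add_le y (x - y)
  calc bracket m x ≤ 1 + 2 ^ (m : ℝ) * (‖y‖ₑ + ‖x - y‖ₑ) := by unfold bracket; gcongr
    _ ≤ 1 + 2 ^ (m : ℝ) * (‖y‖ₑ + ‖x - y‖ₑ) + 2 ^ (m : ℝ) * ‖y‖ₑ * (2 ^ (m : ℝ) * ‖x - y‖ₑ) :=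
      le_self_add
    _ = _ := by unfold bracket; ring

lemma bracket_neg_rpow_le (m : ℤ) (x y : E3) {a : ℝ} (ha : 0 ≤ a) :
    bracket m x ^ (-a) ≤ bracket m y ^ (-a) * bracket m (x - y) ^ a := by
  have h := ENNReal.rpow_le_rpow (bracket_le_mul m y x) ha
  rw [ENNReal.mul_rpow_of_nonneg _ _ ha, ← neg_sub, bracket_neg] at h
  rw [ENNReal.rpow_neg, ENNReal.rpow_neg, ENNReal.inv_le_iff_inv_le, ENNReal.mul_inv, inv_inv]
  · rw [← div_eq_mul_inv]
    exact ENNReal.div_le_of_le_mul h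
  · exact Or.inl (ENNReal.inv_ne_zero.2 (ENNReal.rpow_ne_top_of_nonneg ha (bracket_ne_top m y)))
  · exact Or.inl (ENNReal.inv_ne_top.2
      (ENNReal.rpow_pos (bracket_ne_zero m y).bot_lt (bracket_ne_top m y)).ne')

/-- Slow variation: moving the weight from x to y costs one power of the bracket, which a rapidly
decreasing kernel absorbs. -/
lemma weight_le_mul (m : ℤ) (x y : E3) : weight m x ≤ weight m y * bracket m (x - y) := by
  unfold weight
  have := bracket_neg_rpow_le m x y zero_le_one
  rw [ENNReal.rpow_one] at this
  rw [mul_assoc]; gcongr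

lemma decayKernel_mul_bracket (m : ℤ) (N a : ℝ) (z : E3) :
    decayKernel m N z * bracket m z ^ a = decayKernel m (N - a) z := by
  rw [decayKernel, mul_assoc, ← bracket_rpow_add, decayKernel]; ring_nf

lemma decayKernel_mono (m : ℤ) {N N' : ℝ} (h : N ≤ N') (z : E3) :
    decayKernel m N' z ≤ decayKernel m N z := by
  unfold decayKernel; exact mul_le_mul_right (bracket_rpow_le _ _ (by linarith)) _

lemma le_bracket_of_notMem {m l : ℤ} {z : E3} (hz : z ∉ dball l) : 2 ^ ((m : ℝ) + l) ≤ bracket m z := by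
  rw [mem_dball, not_le] at hz
  rw [two_rpow_add]
  exact (mul_le_mul_right hz.le _).trans le_add_self

lemma bracket_rpow_le_of_notMem {m : ℤ} {n : ℕ} {z : E3} {N : ℝ} (hN : 0 ≤ N)
    (hz : z ∉ dball (n + -m)) : bracket m z ^ (-N) ≤ 2 ^ (N - N * (n + 1 : ℕ)) := by
  have h := ENNReal.rpow_le_rpow (le_bracket_of_notMem (m := m) hz) hN
  rw [two_rpow_rpow] at h
  calc bracket m z ^ (-N) = (bracket m z ^ N)⁻¹ := ENNReal.rpow_neg _ _
    _ ≤ (2 ^ ((m + (n + -m : ℤ)) * N : ℝ))⁻¹ := ENNReal.inv_le_inv.2 h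
    _ = _ := by rw [← ENNReal.rpow_neg]; congr 1; push_cast; ring

lemma bracket_rpow_le_one (m : ℤ) (z : E3) {N : ℝ} (hN : 0 ≤ N) : bracket m z ^ (-N) ≤ 1 := by
  simpa using bracket_rpow_le m z (show -N ≤ 0 by linarith)

/-- Integration against a power of the bracket, by means of integrals over balls. -/
lemma lintegral_bracket_le (m : ℤ) (a : E3) {N : ℝ} (hN : 0 ≤ N) {G : E3 → ℝ≥0∞} (hG : AEMeasurable G) :
    ∫⁻ y, bracket m (y - a) ^ (-N) * G y ≤
      ∑' n : ℕ, 2 ^ (N - N * n) * ∫⁻ y in Metric.closedBall a ((2 : ℝ) ^ ((n : ℤ) + -m)), G y := by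
  refine lintegral_layers (-m) a hG (φ := fun z => bracket m z ^ (-N))
    (c := fun n : ℕ => 2 ^ (N - N * n)) (fun x _ => ?_) fun x n hx => bracket_rpow_le_of_notMem hN hx
  refine (bracket_rpow_le_one m x hN).trans ?_
  simpa using two_rpow_le (show 0 ≤ N - N * (0 : ℕ) by simpa using hN)

lemma lintegral_decayKernel : ∃ C : ℝ≥0, ∀ (m : ℤ) (N : ℝ) (x : E3), 4 ≤ N →
    ∫⁻ y, decayKernel m N (x - y) ≤ C := by
  obtain ⟨C, hC⟩ := tsum_two_rpow zero_lt_one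
  refine ⟨2 ^ 4 * unitVol * C, fun m N x hN => ?_⟩
  calc ∫⁻ y, decayKernel m N (x - y)
      ≤ ∫⁻ y, 2 ^ (3 * (m : ℝ)) * (bracket m (y - x) ^ (-(4 : ℝ)) * 1) := by
        refine lintegral_mono fun y => ?_
        rw [mul_one]
        rw [decayKernel_sub_comm]
        exact decayKernel_mono m hN _
    _ = 2 ^ (3 * (m : ℝ)) * ∫⁻ y, (bracket m (y - x) ^ (-(4 : ℝ)) * 1) := by
        rw [lintegral_const_mul]; fun_prop
    _ ≤ _ := mul_le_mul_right (lintegral_bracket_le m x (by norm_num) aemeasurable_const) _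
    _ = ∑' n : ℕ, (2 ^ 4 * unitVol) * (2 : ℝ≥0∞) ^ (-(1 * n : ℝ)) := by
        rw [← ENNReal.tsum_mul_left]
        congr 1; ext n
        rw [setLIntegral_const, one_mul, volume_closedBall_zpow, ← mul_assoc, ← mul_assoc,
          ← two_rpow_add, ← two_rpow_add, ← ENNReal.rpow_natCast, mul_right_comm, ← two_rpow_add]
        congr 2; push_cast; ring
    _ = _ := by rw [ENNReal.tsum_mul_left, hC]; push_cast; rfl

lemma weight_le_enorm (m : ℤ) (x : E3) : weight m x ≤ ‖x‖ₑ ^ (-1 : ℝ) := by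
  rw [weight, ENNReal.rpow_neg_one, ENNReal.rpow_neg_one, ← div_eq_mul_inv]
  refine ENNReal.div_le_of_le_mul ?_
  rcases eq_or_ne ‖x‖ₑ 0 with h | h
  · simp [h, bracket]
  rw [bracket, mul_add, mul_one, mul_left_comm, ENNReal.inv_mul_cancel h (by simp)]
  simp

/-- Outside radius 2^(-m) the bracket is at most 2·2^m|x|. Together with the upper bounds by 1/|x|
and by 2^m this identifies the weight with min(2^m, 1/|x|) up to a factor 2. -/
lemma enorm_le_weight {m : ℤ} {x : E3} (hx : x ∉ dball (-m)) : ‖x‖ₑ ^ (-1 : ℝ) ≤ 2 * weight m x := by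
  rw [mem_dball, not_le] at hx
  have h1 : 1 ≤ 2 ^ (m : ℝ) * ‖x‖ₑ := by
    calc (1 : ℝ≥0∞) = 2 ^ (m : ℝ) * 2 ^ (((-m : ℤ) : ℝ)) := by rw [← two_rpow_add]; simp
      _ ≤ _ := by gcongr
  have h0 : ‖x‖ₑ ≠ 0 := by rintro h; simp [h] at h1
  have h2 : bracket m x ≤ 2 * (2 ^ (m : ℝ) * ‖x‖ₑ) := by
    rw [bracket, two_mul]; gcongr
  have h5 : 2 * (2 : ℝ≥0∞) ^ (m : ℝ) ≠ ⊤ := ENNReal.mul_ne_top (by simp) (two_rpow_ne_top _)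
  have h6 : 2 * (2 : ℝ≥0∞) ^ (m : ℝ) ≠ 0 := mul_ne_zero (by simp) (two_rpow_ne_zero _)
  calc ‖x‖ₑ ^ (-1 : ℝ) = 2 * 2 ^ (m : ℝ) * (2 * (2 ^ (m : ℝ) * ‖x‖ₑ))⁻¹ := by
        rw [ENNReal.rpow_neg_one, ← mul_assoc, ENNReal.mul_inv (Or.inl h6) (Or.inl h5), ← mul_assoc,
          ENNReal.mul_inv_cancel h6 h5, one_mul]
    _ ≤ 2 * 2 ^ (m : ℝ) * (bracket m x)⁻¹ := by gcongr
    _ = _ := by rw [weight, ENNReal.rpow_neg_one, mul_assoc]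

/-- `|x|⁻¹` is an `A₁` weight. -/
lemma lintegral_decayKernel_mul_inv : ∃ C : ℝ≥0, ∀ (m : ℤ) (N : ℝ) (x : E3), 5 ≤ N →
    ∫⁻ y, decayKernel m N (x - y) * ‖y‖ₑ ^ (-1 : ℝ) ≤ C * weight m x := by
  obtain ⟨C₁, hC₁⟩ := lintegral_decayKernel
  obtain ⟨C₂, hC₂⟩ := lintegral_dball_rpow (show (0 : ℝ) ≤ 1 by norm_num) (by norm_num)
  refine ⟨2 * C₁ + C₂ * 2, fun m N x hN => ?_⟩
  rw [← lintegral_add_compl _ (measurableSet_dball (-m)), add_comm]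
  push_cast
  rw [add_mul]
  refine add_le_add ?_ ?_
  -- Away from the origin 1/|y| is comparable to the slowly varying weight, at the price of one
  -- order of decay of the kernel.
  · calc ∫⁻ y in (dball (-m))ᶜ, decayKernel m N (x - y) * ‖y‖ₑ ^ (-1 : ℝ)
        ≤ ∫⁻ y in (dball (-m))ᶜ, 2 * weight m x * decayKernel m (N - 1) (x - y) := by
          refine setLIntegral_mono (by fun_prop) fun y hy => ?_
          refine (mul_le_mul_right (enorm_le_weight hy) _).trans ?_
          refine (mul_le_mul_right (mul_le_mul_right (weight_le_mul m y x) _) _).trans ?_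
          rw [← decayKernel_mul_bracket, ENNReal.rpow_one, ← neg_sub x y, bracket_neg]
          exact le_of_eq (by ring)
      _ ≤ ∫⁻ y, 2 * weight m x * decayKernel m (N - 1) (x - y) := setLIntegral_le_lintegral _ _
      _ = 2 * weight m x * ∫⁻ y, decayKernel m (N - 1) (x - y) := by
          rw [lintegral_const_mul]; fun_prop
      _ ≤ 2 * weight m x * C₁ := by gcongr; exact hC₁ m _ x (by linarith)
      _ = _ := by ring
  -- Near the origin the kernel is essentially constant in y; one order of its decay produces the
  -- weight at x, and 1/|y| has integral of order 2^(-2m) over the ball.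
  · have h2 : ∀ y ∈ dball (-m), decayKernel m N (x - y) ≤ 2 * 2 ^ (2 * (m : ℝ)) * weight m x := by
      intro y hy
      rw [mem_dball] at hy
      have hb : bracket m (-y) ≤ 2 := by
        rw [bracket, enorm_neg]
        calc 1 + 2 ^ (m : ℝ) * ‖y‖ₑ ≤ 1 + 2 ^ (m : ℝ) * 2 ^ (((-m : ℤ)) : ℝ) := by gcongr
          _ = 2 := by rw [← two_rpow_add]; simp; norm_num
      calc decayKernel m N (x - y) ≤ decayKernel m 1 (x - y) := decayKernel_mono m (by linarith) _
        _ ≤ 2 ^ (3 * (m : ℝ)) * (bracket m x ^ (-1 : ℝ) * bracket m (-y)) := by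
            rw [decayKernel]
            have := bracket_neg_rpow_le m (x - y) x zero_le_one
            rw [ENNReal.rpow_one, show x - y - x = -y by abel] at this
            gcongr
        _ ≤ 2 ^ (3 * (m : ℝ)) * (bracket m x ^ (-1 : ℝ) * 2) := by gcongr
        _ = _ := by
            rw [show (3 : ℝ) * m = 2 * m + m by ring, two_rpow_add, weight]; ring
    calc ∫⁻ y in dball (-m), decayKernel m N (x - y) * ‖y‖ₑ ^ (-1 : ℝ)
        ≤ ∫⁻ y in dball (-m), 2 * 2 ^ (2 * (m : ℝ)) * weight m x * ‖y‖ₑ ^ (-1 : ℝ) :=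
          setLIntegral_mono (by fun_prop) fun y hy => by gcongr; exact h2 y hy
      _ = 2 * 2 ^ (2 * (m : ℝ)) * weight m x * ∫⁻ y in dball (-m), ‖y‖ₑ ^ (-1 : ℝ) := by
          rw [lintegral_const_mul]; fun_prop
      _ ≤ 2 * 2 ^ (2 * (m : ℝ)) * weight m x * (C₂ * 2 ^ ((3 - 1) * ((-m : ℤ) : ℝ))) := by
          gcongr; exact hC₂ (-m)
      _ = C₂ * 2 * weight m x * (2 ^ (2 * (m : ℝ)) * 2 ^ ((3 - 1) * ((-m : ℤ) : ℝ))) := by ring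
      _ = _ := by
          rw [← two_rpow_add, show 2 * (m : ℝ) + (3 - 1) * ((-m : ℤ) : ℝ) = 0 by push_cast; ring]
          simp

/-! ### Radial functions -/

open scoped Pointwise in
/-- The surface measure of a spherical cap. -/
lemma toSphere_cap_le {e : E3} (he : ‖e‖ = 1) {δ : ℝ} (hδ : 0 < δ) :
    (volume : Measure E3).toSphere {w | ‖(w : E3) - e‖ ≤ δ} ≤
      ENNReal.ofReal (δ ^ 2) * (48 * unitVol) := by
  have hV : volume (Metric.ball (0 : E3) 1) = unitVol := by
    rw [unitVol, ENNReal.coe_toNNReal measure_ball_lt_top.ne]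
  rcases le_or_gt 1 δ with h1 | h1
  · calc (volume : Measure E3).toSphere {w | ‖(w : E3) - e‖ ≤ δ}
        ≤ (volume : Measure E3).toSphere univ := measure_mono (subset_univ _)
      _ = 3 * unitVol := by
          rw [Measure.toSphere_apply_univ, finrank_euclideanSpace_fin, hV]; norm_num
      _ ≤ 1 * (48 * unitVol) := by rw [one_mul]; gcongr; norm_num
      _ ≤ _ := by
          gcongr
          rw [ENNReal.one_le_ofReal]; nlinarith
  have hms : MeasurableSet {w : Metric.sphere (0 : E3) 1 | ‖(w : E3) - e‖ ≤ δ} :=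
    measurableSet_le (by fun_prop) measurable_const
  rw [Measure.toSphere_apply' _ hms, finrank_euclideanSpace_fin]
  -- The surface measure of the cap is three times the volume of the cone over it. That cone lies in
  -- a tube of radius 2δ around the segment from 0 to e, covered by O(1/δ) balls of volume O(δ³).
  have hcov : Ioo (0 : ℝ) 1 • ((↑) '' {w : Metric.sphere (0 : E3) 1 | ‖(w : E3) - e‖ ≤ δ} : Set E3) ⊆
      ⋃ i ∈ Finset.range (⌊1 / δ⌋₊ + 1), Metric.closedBall ((i * δ) • e) (2 * δ) := by
    rintro _ ⟨s, hs, _, ⟨w, hw, rfl⟩, rfl⟩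
    simp only [mem_iUnion, Finset.mem_range, Metric.mem_closedBall, dist_eq_norm]
    refine ⟨⌊s / δ⌋₊, ?_, ?_⟩
    · rw [Nat.lt_succ_iff]
      exact Nat.floor_mono (by gcongr; exact hs.2.le)
    · have h2 : |s - ⌊s / δ⌋₊ * δ| ≤ δ := by
        have h3 := Nat.floor_le (show 0 ≤ s / δ from div_nonneg hs.1.le hδ.le)
        have h4 := Nat.lt_floor_add_one (s / δ)
        rw [le_div_iff₀ hδ] at h3
        rw [div_lt_iff₀ hδ] at h4
        rw [abs_le]; constructor <;> nlinarith
      calc ‖s • (w : E3) - (⌊s / δ⌋₊ * δ) • e‖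
          = ‖s • ((w : E3) - e) + (s - ⌊s / δ⌋₊ * δ) • e‖ := by
            congr 1; rw [smul_sub, sub_smul]; abel
        _ ≤ ‖s • ((w : E3) - e)‖ + ‖(s - ⌊s / δ⌋₊ * δ) • e‖ := norm_add_le _ _
        _ = s * ‖(w : E3) - e‖ + |s - ⌊s / δ⌋₊ * δ| := by
            rw [norm_smul, norm_smul, he, mul_one, Real.norm_of_nonneg hs.1.le, Real.norm_eq_abs]
        _ ≤ 1 * δ + δ := by
            have : ‖(w : E3) - e‖ ≤ δ := hw
            gcongr; exact hs.2.le
        _ = 2 * δ := by ring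
  have hcount : ((⌊1 / δ⌋₊ + 1 : ℕ) : ℝ) ≤ 2 / δ := by
    have h3 := Nat.floor_le (show 0 ≤ 1 / δ by positivity)
    have : 1 ≤ 1 / δ := by rw [le_div_iff₀ hδ]; linarith
    push_cast
    calc _ ≤ 1 / δ + 1 / δ := by linarith
      _ = _ := by ring
  calc ((3 : ℕ) : ℝ≥0∞) * volume (Ioo (0 : ℝ) 1 •
        ((↑) '' {w : Metric.sphere (0 : E3) 1 | ‖(w : E3) - e‖ ≤ δ} : Set E3))
      ≤ 3 * ∑ i ∈ Finset.range (⌊1 / δ⌋₊ + 1), volume (Metric.closedBall (((i : ℝ) * δ) • e) (2 * δ)) := by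
        push_cast
        gcongr
        exact (measure_mono hcov).trans (measure_biUnion_finset_le _ _)
    _ = 3 * (((⌊1 / δ⌋₊ + 1 : ℕ) : ℝ≥0∞) * (ENNReal.ofReal ((2 * δ) ^ 3) * unitVol)) := by
        simp_rw [Measure.addHaar_closedBall _ _ (show 0 ≤ 2 * δ by positivity),
          finrank_euclideanSpace_fin, hV]
        rw [Finset.sum_const, Finset.card_range, nsmul_eq_mul]
    _ ≤ 3 * (ENNReal.ofReal (2 / δ) * (ENNReal.ofReal ((2 * δ) ^ 3) * unitVol)) := by
        gcongr
        rw [← ENNReal.ofReal_natCast]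
        exact ENNReal.ofReal_le_ofReal hcount
    _ = ENNReal.ofReal (3 * (2 / δ) * ((2 * δ) ^ 3)) * unitVol := by
        rw [ENNReal.ofReal_mul (by positivity), ENNReal.ofReal_mul (by positivity), ENNReal.ofReal_ofNat]
        ring
    _ = _ := by
        rw [show 3 * (2 / δ) * ((2 * δ) ^ 3) = δ ^ 2 * 48 by field_simp; norm_num,
          ENNReal.ofReal_mul (by positivity), ENNReal.ofReal_ofNat]
        ring

/-- Integration in polar coordinates. -/
lemma lintegral_polar {G : E3 → ℝ≥0∞} :
    ∫⁻ x, G x = ∫⁻ p, G ((p.2 : ℝ) • (p.1 : E3))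
      ∂((volume : Measure E3).toSphere.prod (Measure.volumeIoiPow 2)) := by
  have hmp := (volume : Measure E3).measurePreserving_homeomorphUnitSphereProd
  rw [finrank_euclideanSpace_fin] at hmp
  have h2 := (MeasurePreserving.symm (homeomorphUnitSphereProd E3).toMeasurableEquiv hmp)
  have h3 := h2.lintegral_comp_emb (homeomorphUnitSphereProd E3).toMeasurableEquiv.symm.measurableEmbedding
    (fun x => G (x : E3))
  have h4 : ∫⁻ x : ({0}ᶜ : Set E3), G x ∂(Measure.comap (↑) (volume : Measure E3)) = ∫⁻ x, G x := by
    rw [lintegral_subtype_comap (measurableSet_singleton (0 : E3)).compl, restrict_compl_singleton]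
  rw [← h4, ← h3]
  rfl

lemma aemeasurable_polar {G : E3 → ℝ≥0∞} (hG : AEMeasurable G) :
    AEMeasurable (fun p : Metric.sphere (0 : E3) 1 × Ioi (0 : ℝ) => G ((p.2 : ℝ) • (p.1 : E3)))
      ((volume : Measure E3).toSphere.prod (Measure.volumeIoiPow 2)) := by
  have hmp := (volume : Measure E3).measurePreserving_homeomorphUnitSphereProd
  rw [finrank_euclideanSpace_fin] at hmp
  have h2 := (MeasurePreserving.symm (homeomorphUnitSphereProd E3).toMeasurableEquiv hmp)
  have h3 : AEMeasurable (fun x : ({0}ᶜ : Set E3) => G x) (Measure.comap (↑) (volume : Measure E3)) := by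
    refine AEMeasurable.comp_measurable ?_ measurable_subtype_coe
    rw [map_comap_subtype_coe (measurableSet_singleton (0 : E3)).compl]
    exact hG.restrict
  exact h3.comp_quasiMeasurePreserving h2.quasiMeasurePreserving

/-- A function on space is radial. -/
def IsRadial {α : Type*} (f : E3 → α) : Prop := ∀ x y, ‖x‖ = ‖y‖ → f x = f y

/-- The mass of a radial function in a ball away from the origin. -/
lemma lintegral_closedBall_radial : ∃ C : ℝ≥0, ∀ H : E3 → ℝ≥0∞, AEMeasurable H → IsRadial H →
    ∀ (x : E3) (l : ℤ), x ≠ 0 → ∫⁻ y in Metric.closedBall x ((2 : ℝ) ^ l), H y ≤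
      C * (2 ^ (2 * (l : ℝ)) * ‖x‖ₑ ^ (-2 : ℝ)) * ∫⁻ y, H y := by
  have hV0 : unitVol ≠ 0 := by
    simp only [unitVol, ne_eq, ENNReal.toNNReal_eq_zero_iff, not_or]
    exact ⟨(Metric.measure_ball_pos volume (0 : E3) one_pos).ne', measure_ball_lt_top.ne⟩
  refine ⟨64, fun H hH hrad x l hx => ?_⟩
  have hxn : 0 < ‖x‖ := norm_pos_iff.2 hx
  set e : E3 := ‖x‖⁻¹ • x
  have he : ‖e‖ = 1 := norm_smul_inv_norm (𝕜 := ℝ) hx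
  -- A point of the ball has norm within 2^l of |x|; rescaling it to the sphere of radius |x| moves
  -- it by at most another 2^l, hence this angular width.
  set δ : ℝ := 2 * 2 ^ l / ‖x‖
  have hδ : 0 < δ := by positivity
  set σ := (volume : Measure E3).toSphere
  have hσ : σ univ = 3 * unitVol := by
    rw [Measure.toSphere_apply_univ, finrank_euclideanSpace_fin, unitVol,
      ENNReal.coe_toNNReal measure_ball_lt_top.ne]; norm_num
  have hcap : ∀ (w : Metric.sphere (0 : E3) 1) (r : Ioi (0 : ℝ)),
      (r : ℝ) • (w : E3) ∈ Metric.closedBall x ((2 : ℝ) ^ l) → ‖(w : E3) - e‖ ≤ δ := by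
    intro w r h
    rw [mem_closedBall_iff_norm] at h
    have hw : ‖(w : E3)‖ = 1 := by simp
    have hr : (0 : ℝ) < r := r.2
    have h1 : |(r : ℝ) - ‖x‖| ≤ 2 ^ l := by
      have := abs_norm_sub_norm_le ((r : ℝ) • (w : E3)) x
      rw [norm_smul, hw, mul_one, Real.norm_of_nonneg hr.le] at this
      exact this.trans h
    have h2 : ‖x‖ • ((w : E3) - e) = ((r : ℝ) • (w : E3) - x) - ((r : ℝ) - ‖x‖) • (w : E3) := by
      simp only [e]
      rw [smul_sub, smul_smul, mul_inv_cancel₀ hxn.ne', one_smul, sub_smul]; abel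
    have h3 : ‖x‖ * ‖(w : E3) - e‖ ≤ 2 ^ l + 2 ^ l := by
      calc ‖x‖ * ‖(w : E3) - e‖ = ‖‖x‖ • ((w : E3) - e)‖ := by rw [norm_smul, norm_norm]
        _ ≤ ‖(r : ℝ) • (w : E3) - x‖ + ‖((r : ℝ) - ‖x‖) • (w : E3)‖ := by rw [h2]; exact norm_sub_le _ _
        _ ≤ _ := by rw [norm_smul, hw, mul_one, Real.norm_eq_abs]; gcongr
    rw [le_div_iff₀ hxn]; linarith
  set h : Ioi (0 : ℝ) → ℝ≥0∞ := fun r => H ((r : ℝ) • e)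
  have hHh : ∀ (w : Metric.sphere (0 : E3) 1) (r : Ioi (0 : ℝ)), H ((r : ℝ) • (w : E3)) = h r := by
    intro w r
    refine hrad _ _ ?_
    have hw : ‖(w : E3)‖ = 1 := by simp
    rw [norm_smul, norm_smul, hw, he]
  have hms : MeasurableSet {w : Metric.sphere (0 : E3) 1 | ‖(w : E3) - e‖ ≤ δ} :=
    measurableSet_le (by fun_prop) measurable_const
  have hfull : ∫⁻ y, H y = ∫⁻ r, h r * σ univ ∂(Measure.volumeIoiPow 2) := by
    rw [lintegral_polar, lintegral_prod_symm _ (aemeasurable_polar hH)]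
    refine lintegral_congr fun r => ?_
    simp_rw [hHh]
    rw [lintegral_const]
  have hball : ∫⁻ y in Metric.closedBall x ((2 : ℝ) ^ l), H y ≤
      ∫⁻ r, h r * (ENNReal.ofReal (δ ^ 2) * (48 * unitVol)) ∂(Measure.volumeIoiPow 2) := by
    rw [← lintegral_indicator measurableSet_closedBall, lintegral_polar,
      lintegral_prod_symm _ (aemeasurable_polar (hH.indicator measurableSet_closedBall))]
    refine lintegral_mono fun r => ?_
    calc ∫⁻ w, (Metric.closedBall x ((2 : ℝ) ^ l)).indicator H ((r : ℝ) • (w : E3)) ∂σ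
        ≤ ∫⁻ w, {w : Metric.sphere (0 : E3) 1 | ‖(w : E3) - e‖ ≤ δ}.indicator (fun _ => h r) w ∂σ := by
          refine lintegral_mono fun w => ?_
          by_cases hm : (r : ℝ) • (w : E3) ∈ Metric.closedBall x ((2 : ℝ) ^ l)
          · rw [indicator_of_mem hm, indicator_of_mem (s := {w : Metric.sphere (0 : E3) 1 | ‖(w : E3) - e‖ ≤ δ}) (hcap w r hm), hHh]
          · rw [indicator_of_notMem hm]; exact zero_le
      _ = h r * σ _ := lintegral_indicator_const hms _
      _ ≤ _ := by gcongr; exact toSphere_cap_le he hδ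
  -- The factor 64 is 4 · 48 / 3: δ² contributes 4, the cap bound 48, and the full sphere has
  -- measure 3 times the volume of the unit ball.
  have hconst : ENNReal.ofReal (δ ^ 2) * (48 * unitVol) =
      (64 * (2 ^ (2 * (l : ℝ)) * ‖x‖ₑ ^ (-2 : ℝ))) * σ univ := by
    have : ENNReal.ofReal (δ ^ 2) = 4 * (2 ^ (2 * (l : ℝ)) * ‖x‖ₑ ^ (-2 : ℝ)) := by
      simp only [δ]
      rw [div_pow, mul_pow, div_eq_mul_inv, ENNReal.ofReal_mul (by positivity),
        ENNReal.ofReal_mul (by positivity), ENNReal.ofReal_pow (by positivity : (0 : ℝ) ≤ 2 ^ l), ofReal_two_zpow,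
        two_rpow_sq, ENNReal.ofReal_inv_of_pos (by positivity), ENNReal.ofReal_pow (norm_nonneg x),
        ofReal_norm, ENNReal.rpow_neg, ENNReal.rpow_ofNat]
      norm_num
      ring
    rw [this, hσ]; ring
  refine hball.trans (le_of_eq ?_)
  have hfin : 64 * (2 ^ (2 * (l : ℝ)) * ‖x‖ₑ ^ (-2 : ℝ)) ≠ ⊤ := by
    refine ENNReal.mul_ne_top (by simp) (ENNReal.mul_ne_top (two_rpow_ne_top _) ?_)
    exact ENNReal.rpow_ne_top_of_ne_zero (by simpa using hx) (by simp)
  rw [hconst, hfull, ENNReal.coe_ofNat, ← lintegral_const_mul' _ _ hfin]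
  congr 1; ext r; ring

/-! ### Cauchy-Schwarz -/

lemma le_sqrt_of_sq_le {a b : ℝ≥0∞} (h : a ^ 2 ≤ b) : a ≤ b ^ (1 / 2 : ℝ) := by
  rw [one_div, ENNReal.le_rpow_inv_iff two_pos, ENNReal.rpow_ofNat]; exact h

lemma sqrt_sq (a : ℝ≥0∞) : (a ^ 2) ^ (1 / 2 : ℝ) = a := by
  rw [← ENNReal.rpow_ofNat, ← ENNReal.rpow_mul]; norm_num

lemma sq_sqrt (a : ℝ≥0∞) : (a ^ (1 / 2 : ℝ)) ^ 2 = a := by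
  rw [← ENNReal.rpow_ofNat, ← ENNReal.rpow_mul]; norm_num

lemma ennreal_le_of_sq_le_sq {a b : ℝ≥0∞} (h : a ^ 2 ≤ b ^ 2) : a ≤ b :=
  (le_sqrt_of_sq_le h).trans_eq (sqrt_sq b)

lemma sq_lintegral_mul_le {α : Type*} [MeasurableSpace α] {μ : Measure α} {a b : α → ℝ≥0∞}
    (ha : AEMeasurable a μ) (hb : AEMeasurable b μ) :
    (∫⁻ x, a x * b x ∂μ) ^ 2 ≤ (∫⁻ x, a x ^ 2 ∂μ) * ∫⁻ x, b x ^ 2 ∂μ := by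
  have h := ENNReal.lintegral_mul_le_Lp_mul_Lq μ Real.HolderConjugate.two_two ha hb
  simp only [ENNReal.rpow_ofNat, Pi.mul_apply] at h
  refine (pow_le_pow_left' h 2).trans (le_of_eq ?_)
  rw [mul_pow, sq_sqrt, sq_sqrt]

/-- The Cauchy-Schwarz inequality with a weight that is the product of two weights. -/
lemma sq_lintegral_weighted_le {α : Type*} [MeasurableSpace α] {μ : Measure α} {k k₁ k₂ a b : α → ℝ≥0∞}
    (hk : ∀ x, k x ^ 2 ≤ k₁ x * k₂ x) (hk₁ : AEMeasurable k₁ μ) (hk₂ : AEMeasurable k₂ μ)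
    (ha : AEMeasurable a μ) (hb : AEMeasurable b μ) :
    (∫⁻ x, k x * (a x * b x) ∂μ) ^ 2 ≤ (∫⁻ x, k₁ x * a x ^ 2 ∂μ) * ∫⁻ x, k₂ x * b x ^ 2 ∂μ := by
  have h := sq_lintegral_mul_le (μ := μ) (a := fun x => k₁ x ^ (1 / 2 : ℝ) * a x)
    (b := fun x => k₂ x ^ (1 / 2 : ℝ) * b x) (by fun_prop) (by fun_prop)
  simp only [mul_pow, sq_sqrt] at h
  refine (pow_le_pow_left' (lintegral_mono fun x => ?_) 2).trans h
  calc k x * (a x * b x) ≤ (k₁ x * k₂ x) ^ (1 / 2 : ℝ) * (a x * b x) := by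
        gcongr; exact le_sqrt_of_sq_le (hk x)
    _ = _ := by rw [ENNReal.mul_rpow_of_nonneg _ _ (by norm_num)]; ring

lemma sq_lintegral_kernel_mul_le {α : Type*} [MeasurableSpace α] {μ : Measure α} {k u : α → ℝ≥0∞}
    (hk : AEMeasurable k μ) (hu : AEMeasurable u μ) :
    (∫⁻ x, k x * u x ∂μ) ^ 2 ≤ (∫⁻ x, k x ∂μ) * ∫⁻ x, k x * u x ^ 2 ∂μ := by
  simpa using sq_lintegral_weighted_le (μ := μ) (k := k) (a := fun _ => 1) (b := u)
    (fun x => (sq (k x)).le) hk hk aemeasurable_const hu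

/-- Convolution of a radial function with a model kernel. -/
lemma lintegral_decayKernel_radial : ∃ C : ℝ≥0, ∀ H : E3 → ℝ≥0∞, AEMeasurable H → IsRadial H →
    ∀ (m : ℤ) (N : ℝ) (x : E3), 4 ≤ N →
    ∫⁻ y, decayKernel m N (x - y) * H y ≤ C * (2 ^ (m : ℝ) * weight m x ^ 2) * ∫⁻ y, H y := by
  obtain ⟨C, hC⟩ := lintegral_closedBall_radial
  obtain ⟨C', hC'⟩ := tsum_two_rpow two_pos
  refine ⟨4 + 64 * C * C', fun H hH hrad m N x hN => ?_⟩
  by_cases hx : x ∈ dball (-m)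
  · have h1 : 2 ^ (m : ℝ) ≤ 2 * weight m x := by
      have hb : bracket m x ≤ 2 := by
        rw [mem_dball] at hx
        calc 1 + 2 ^ (m : ℝ) * ‖x‖ₑ ≤ 1 + 2 ^ (m : ℝ) * 2 ^ (((-m : ℤ)) : ℝ) := by gcongr
          _ = 2 := by rw [← two_rpow_add]; simp; norm_num
      calc (2 : ℝ≥0∞) ^ (m : ℝ) = 2 * (2 ^ (m : ℝ) * 2⁻¹) := by
            rw [mul_left_comm, ENNReal.mul_inv_cancel two_ne_zero ENNReal.ofNat_ne_top, mul_one]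
        _ ≤ 2 * (2 ^ (m : ℝ) * (bracket m x)⁻¹) := by gcongr
        _ = _ := by rw [weight, ENNReal.rpow_neg_one]
    calc ∫⁻ y, decayKernel m N (x - y) * H y ≤ ∫⁻ y, 2 ^ (3 * (m : ℝ)) * H y := by
          refine lintegral_mono fun y => ?_
          have h2 := bracket_rpow_le_one m (x - y) (show 0 ≤ N by linarith)
          calc decayKernel m N (x - y) * H y ≤ 2 ^ (3 * (m : ℝ)) * 1 * H y := by
                unfold decayKernel; gcongr
            _ = _ := by rw [mul_one]
      _ = 2 ^ (m : ℝ) * (2 ^ (m : ℝ)) ^ 2 * ∫⁻ y, H y := by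
          rw [lintegral_const_mul' _ _ (two_rpow_ne_top _), two_rpow_sq, ← two_rpow_add]; ring_nf
      _ ≤ 2 ^ (m : ℝ) * (2 * weight m x) ^ 2 * ∫⁻ y, H y := by gcongr
      _ = 4 * (2 ^ (m : ℝ) * weight m x ^ 2) * ∫⁻ y, H y := by ring
      _ ≤ _ := by push_cast; gcongr; exact le_self_add
  · have hx0 : x ≠ 0 := by
      rintro rfl; exact hx (by simp [mem_dball])
    have h2 : ‖x‖ₑ ^ (-2 : ℝ) ≤ 4 * weight m x ^ 2 := by
      calc ‖x‖ₑ ^ (-2 : ℝ) = (‖x‖ₑ ^ (-1 : ℝ)) ^ 2 := by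
            rw [← ENNReal.rpow_ofNat, ← ENNReal.rpow_mul]; norm_num
        _ ≤ (2 * weight m x) ^ 2 := by gcongr; exact enorm_le_weight hx
        _ = _ := by ring
    -- The mass in the ball of radius 2^(n-m) about x grows like 2^(2n), while decay of order four
    -- gives 2^(-4n), so the layers sum.
    calc ∫⁻ y, decayKernel m N (x - y) * H y
        ≤ ∫⁻ y, 2 ^ (3 * (m : ℝ)) * (bracket m (y - x) ^ (-4 : ℝ) * H y) := by
          refine lintegral_mono fun y => ?_
          rw [← mul_assoc, decayKernel_sub_comm]
          gcongr
          exact decayKernel_mono m hN _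
      _ = 2 ^ (3 * (m : ℝ)) * ∫⁻ y, bracket m (y - x) ^ (-4 : ℝ) * H y :=
          lintegral_const_mul' _ _ (two_rpow_ne_top _)
      _ ≤ 2 ^ (3 * (m : ℝ)) * ∑' n : ℕ, 2 ^ (4 - 4 * n : ℝ) *
            (C * (2 ^ (2 * (((n : ℤ) + -m : ℤ) : ℝ)) * ‖x‖ₑ ^ (-2 : ℝ)) * ∫⁻ y, H y) := by
          gcongr
          refine (lintegral_bracket_le m x (by norm_num) hH).trans ?_
          gcongr
          exact hC H hH hrad x _ hx0
      _ = ∑' n : ℕ, (16 * C * (2 ^ (m : ℝ) * ‖x‖ₑ ^ (-2 : ℝ)) * ∫⁻ y, H y) * 2 ^ (-(2 * n : ℝ)) := by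
          rw [← ENNReal.tsum_mul_left]
          congr 1; ext n
          have : (2 : ℝ≥0∞) ^ (3 * (m : ℝ)) * 2 ^ (4 - 4 * n : ℝ) * 2 ^ (2 * (((n : ℤ) + -m : ℤ) : ℝ)) =
              16 * 2 ^ (m : ℝ) * 2 ^ (-(2 * n : ℝ)) := by
            rw [show (16 : ℝ≥0∞) = 2 ^ (4 : ℝ) by norm_num]
            simp_rw [← two_rpow_add]; congr 1; push_cast; ring
          calc _ = (2 : ℝ≥0∞) ^ (3 * (m : ℝ)) * 2 ^ (4 - 4 * n : ℝ) * 2 ^ (2 * (((n : ℤ) + -m : ℤ) : ℝ)) *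
                (C * ‖x‖ₑ ^ (-2 : ℝ) * ∫⁻ y, H y) := by ring
            _ = _ := by rw [this]; ring
      _ = 16 * C * C' * (2 ^ (m : ℝ) * ‖x‖ₑ ^ (-2 : ℝ)) * ∫⁻ y, H y := by
          rw [ENNReal.tsum_mul_left, hC']; ring
      _ ≤ 16 * C * C' * (2 ^ (m : ℝ) * (4 * weight m x ^ 2)) * ∫⁻ y, H y := by gcongr
      _ = 64 * C * C' * (2 ^ (m : ℝ) * weight m x ^ 2) * ∫⁻ y, H y := by ring
      _ ≤ _ := by push_cast; gcongr; exact le_add_self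

/-- Frequency-localized radial Sobolev embedding, for model kernels. -/
lemma lintegral_decayKernel_radial_sq : ∃ C : ℝ≥0, ∀ h : E3 → ℝ≥0∞, AEMeasurable h → IsRadial h →
    ∀ (m : ℤ) (N : ℝ) (x : E3), 4 ≤ N →
    ∫⁻ y, decayKernel m N (x - y) * h y ≤
      C * (2 ^ ((m : ℝ) / 2) * weight m x) * (∫⁻ y, h y ^ 2) ^ (1 / 2 : ℝ) := by
  obtain ⟨C₁, hC₁⟩ := lintegral_decayKernel
  obtain ⟨C₂, hC₂⟩ := lintegral_decayKernel_radial
  refine ⟨(C₁ * C₂) ^ (1 / 2 : ℝ), fun h hh hrad m N x hN => ?_⟩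
  apply ennreal_le_of_sq_le_sq
  have hr : IsRadial fun y => h y ^ 2 := fun x y hxy => by simp only [hrad x y hxy]
  calc (∫⁻ y, decayKernel m N (x - y) * h y) ^ 2
      ≤ (∫⁻ y, decayKernel m N (x - y)) * ∫⁻ y, decayKernel m N (x - y) * h y ^ 2 :=
        sq_lintegral_kernel_mul_le (by fun_prop) hh
    _ ≤ C₁ * (C₂ * (2 ^ (m : ℝ) * weight m x ^ 2) * ∫⁻ y, h y ^ 2) := by
        gcongr
        · exact hC₁ m N x hN
        · exact hC₂ _ (by fun_prop) hr m N x hN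
    _ = _ := by
        rw [mul_pow, mul_pow, mul_pow, sq_sqrt, two_rpow_sq, ENNReal.coe_rpow_of_nonneg _ (by norm_num),
          sq_sqrt, mul_div_cancel₀ _ (two_ne_zero)]
        push_cast; ring

/-! ### The Littlewood-Paley kernels -/

/-- The symbol of `P_{≤ m}`, as a function of the ordinary frequency. -/
def lpSym (ψ : E3 → ℝ) (m : ℤ) (η : E3) : ℂ := ((ψ (((2 : ℝ) ^ m)⁻¹ • ((2 * Real.pi) • η)) : ℝ) : ℂ)

/-- The kernel of `P_{≤ m}`. -/
def lpKer (ψ : E3 → ℝ) (m : ℤ) : E3 → ℝ := multKernel fun ξ => ψ (((2 : ℝ) ^ m)⁻¹ • ξ)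

/-- The kernel of `P_m`. -/
def lpKerD (ψ : E3 → ℝ) (m : ℤ) : E3 → ℝ :=
  multKernel fun ξ => ψ (((2 : ℝ) ^ m)⁻¹ • ξ) - ψ ((2 * ((2 : ℝ) ^ m)⁻¹) • ξ)

lemma lpKer_eq (ψ : E3 → ℝ) (m : ℤ) (x : E3) : lpKer ψ m x = (𝓕⁻ (lpSym ψ m) x).re := rfl

namespace IsLPCutoff

variable {ψ : E3 → ℝ}

lemma radial (hψ : IsLPCutoff ψ) : IsRadial ψ := fun x y h =>
  le_antisymm (hψ.radial_decreasing y x h.ge) (hψ.radial_decreasing x y h.le)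

lemma nonneg (hψ : IsLPCutoff ψ) (x : E3) : 0 ≤ ψ x := by
  by_cases h : 2 ≤ ‖x‖
  · rw [hψ.eq_zero x h]
  obtain ⟨y, hy⟩ := exists_norm_eq E3 (show (0 : ℝ) ≤ 2 by norm_num)
  rw [← hψ.eq_zero y hy.ge]
  exact hψ.radial_decreasing x y (by linarith)

lemma le_one (hψ : IsLPCutoff ψ) (x : E3) : ψ x ≤ 1 := by
  rw [← hψ.eq_one 0 (by simp)]
  exact hψ.radial_decreasing 0 x (by simp)

lemma lpSym_radial (hψ : IsLPCutoff ψ) (m : ℤ) : IsRadial (lpSym ψ m) := fun x y h => by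
  unfold lpSym
  rw [hψ.radial _ (((2 : ℝ) ^ m)⁻¹ • ((2 * Real.pi) • y)) (by simp only [norm_smul, h])]

lemma contDiff_lpSym (hψ : IsLPCutoff ψ) (m : ℤ) : ContDiff ℝ ∞ (lpSym ψ m) :=
  Complex.ofRealCLM.contDiff.comp (hψ.smooth.comp (by fun_prop))

lemma lpSym_eq_zero (hψ : IsLPCutoff ψ) {m : ℤ} {η : E3} (h : 2 * 2 ^ m ≤ 2 * Real.pi * ‖η‖) :
    lpSym ψ m η = 0 := by
  unfold lpSym
  rw [hψ.eq_zero, Complex.ofReal_zero]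
  rw [norm_smul, norm_smul, norm_inv, Real.norm_of_nonneg (by positivity : (0 : ℝ) ≤ 2 ^ m),
    Real.norm_of_nonneg (by positivity : (0 : ℝ) ≤ 2 * Real.pi), inv_mul_eq_div,
    le_div_iff₀ (by positivity)]
  exact h

lemma lpSym_eq_one (hψ : IsLPCutoff ψ) {m : ℤ} {η : E3} (h : 2 * Real.pi * ‖η‖ ≤ 2 ^ m) :
    lpSym ψ m η = 1 := by
  unfold lpSym
  rw [hψ.eq_one, Complex.ofReal_one]
  rw [norm_smul, norm_smul, norm_inv, Real.norm_of_nonneg (by positivity : (0 : ℝ) ≤ 2 ^ m),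
    Real.norm_of_nonneg (by positivity : (0 : ℝ) ≤ 2 * Real.pi), inv_mul_eq_div,
    div_le_one (by positivity)]
  exact h

lemma norm_lpSym_le_one (hψ : IsLPCutoff ψ) (m : ℤ) (η : E3) : ‖lpSym ψ m η‖ ≤ 1 := by
  unfold lpSym
  rw [Complex.norm_real, Real.norm_of_nonneg (hψ.nonneg _)]
  exact hψ.le_one _

lemma norm_lpSym_mono (hψ : IsLPCutoff ψ) {m n : ℤ} (h : m ≤ n) (η : E3) :
    ‖lpSym ψ m η‖ ≤ ‖lpSym ψ n η‖ := by
  unfold lpSym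
  rw [Complex.norm_real, Complex.norm_real, Real.norm_of_nonneg (hψ.nonneg _),
    Real.norm_of_nonneg (hψ.nonneg _)]
  apply hψ.radial_decreasing
  rw [norm_smul, norm_smul _ ((2 * Real.pi) • η), norm_inv, norm_inv,
    Real.norm_of_nonneg (by positivity : (0 : ℝ) ≤ 2 ^ m),
    Real.norm_of_nonneg (by positivity : (0 : ℝ) ≤ 2 ^ n)]
  gcongr
  norm_num

lemma hasCompactSupport_lpSym (hψ : IsLPCutoff ψ) (m : ℤ) : HasCompactSupport (lpSym ψ m) := by
  refine HasCompactSupport.of_support_subset_isCompact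
    (isCompact_closedBall (0 : E3) (2 * 2 ^ m / (2 * Real.pi))) fun η hη => ?_
  rw [mem_closedBall_zero_iff, le_div_iff₀ (by positivity)]
  by_contra! h
  exact hη (hψ.lpSym_eq_zero (by linarith))

/-- The symbol of `P_{≤ m}` as a Schwartz function. -/
def symS (hψ : IsLPCutoff ψ) (m : ℤ) : 𝓢(E3, ℂ) :=
  (hψ.hasCompactSupport_lpSym m).toSchwartzMap (hψ.contDiff_lpSym m)

lemma coe_symS (hψ : IsLPCutoff ψ) (m : ℤ) : (hψ.symS m : E3 → ℂ) = lpSym ψ m := rfl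

end IsLPCutoff

lemma exists_isometry_of_norm_eq {x y : E3} (h : ‖x‖ = ‖y‖) : ∃ A : E3 ≃ₗᵢ[ℝ] E3, A x = y :=
  ⟨(ℝ ∙ (x - y))ᗮ.reflection, Submodule.reflection_sub h⟩

lemma IsRadial.fourierInv {F : E3 → ℂ} (hF : IsRadial F) : IsRadial (𝓕⁻ F) := fun x y h => by
  obtain ⟨A, hA⟩ := exists_isometry_of_norm_eq h
  have h1 : F ∘ A = F := funext fun z => hF _ _ (A.norm_map z)
  rw [← hA, ← Real.fourierInv_comp_linearIsometry, h1]

/-- Conjugating the integrand amounts to reflecting the variable, so the transform is its own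
conjugate. Hence the real part taken in `multKernel` loses nothing. -/
lemma fourierInv_ofReal_even_im {F : E3 → ℝ} (hF : ∀ x, F (-x) = F x) (x : E3) :
    (𝓕⁻ (fun η => (F η : ℂ)) x).im = 0 := by
  rw [← Complex.conj_eq_iff_im, Real.fourierInv_eq', ← integral_conj, ← integral_neg_eq_self]
  congr 1; ext η
  simp only [smul_eq_mul, map_mul, Complex.conj_ofReal, hF, ← Complex.exp_conj, inner_neg_left]
  congr 2
  simp

namespace IsLPCutoff

variable {ψ : E3 → ℝ}

lemma ofReal_lpKer (hψ : IsLPCutoff ψ) (m : ℤ) (x : E3) : (lpKer ψ m x : ℂ) = 𝓕⁻ (lpSym ψ m) x := by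
  rw [lpKer_eq]
  refine Complex.ext rfl ?_
  rw [Complex.ofReal_im]
  refine (fourierInv_ofReal_even_im (fun η => ?_) x).symm
  exact hψ.radial _ _ (by simp [norm_smul])

lemma lpKer_radial (hψ : IsLPCutoff ψ) (m : ℤ) : IsRadial (lpKer ψ m) := fun x y h => by
  rw [lpKer_eq, lpKer_eq, (hψ.lpSym_radial m).fourierInv x y h]

lemma _root_.lpKer_scale (ψ : E3 → ℝ) (m : ℤ) (x : E3) :
    lpKer ψ m x = (2 ^ m) ^ 3 * lpKer ψ 0 ((2 : ℝ) ^ m • x) := by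
  have : 𝓕⁻ (lpSym ψ m) x = ((2 ^ m) ^ 3 : ℝ) • 𝓕⁻ (lpSym ψ 0) ((2 : ℝ) ^ m • x) := by
    rw [Real.fourierInv_eq', Real.fourierInv_eq']
    have h := Measure.integral_comp_inv_smul_of_nonneg (volume : Measure E3)
      (fun v => Complex.exp (↑(2 * Real.pi * inner ℝ v ((2 : ℝ) ^ m • x)) * Complex.I) • lpSym ψ 0 v)
      (show (0 : ℝ) ≤ 2 ^ m by positivity)
    rw [finrank_euclideanSpace_fin] at h
    rw [← h]
    congr 1; ext v
    rw [inner_smul_left, inner_smul_right]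
    simp only [lpSym, zpow_zero, inv_one, one_smul, conj_trivial]
    rw [smul_comm (2 * Real.pi) ((2 : ℝ) ^ m)⁻¹ v, ← mul_assoc ((2 : ℝ) ^ m)⁻¹,
      inv_mul_cancel₀ (by positivity), one_mul]
  rw [lpKer_eq, lpKer_eq, this, Complex.real_smul, Complex.re_ofReal_mul]

lemma continuous_lpKer (hψ : IsLPCutoff ψ) (m : ℤ) : Continuous (lpKer ψ m) := by
  have : lpKer ψ m = fun x => ((𝓕⁻ (hψ.symS m)) x).re := by
    ext x; rw [lpKer_eq, SchwartzMap.fourierInv_coe]; rfl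
  rw [this]
  exact Complex.continuous_re.comp (SchwartzMap.continuous _)

/-- By scaling it suffices to treat m = 0, where the kernel is the real part of a Schwartz function.
Order eight suffices throughout: four orders for integrability in dimension three and up to four to
be spent on brackets. -/
lemma lpKer_le (hψ : IsLPCutoff ψ) :
    ∃ C : ℝ≥0, ∀ m x, ‖lpKer ψ m x‖ₑ ≤ C * decayKernel m 8 x := by
  have hC : ∀ x, ‖lpKer ψ 0 x‖ ≤
      2 ^ 8 * (Finset.Iic (8, 0)).sup (fun m => SchwartzMap.seminorm ℝ m.1 m.2) (𝓕⁻ (hψ.symS 0)) *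
        ((1 + ‖x‖) ^ 8)⁻¹ := by
    intro x
    rw [← div_eq_mul_inv, le_div_iff₀ (by positivity), mul_comm]
    refine le_trans ?_ (SchwartzMap.one_add_le_sup_seminorm_apply (𝕜 := ℝ) (m := (8, 0)) (k := 8)
      (n := 0) le_rfl le_rfl (𝓕⁻ (hψ.symS 0)) x)
    rw [norm_iteratedFDeriv_zero]
    gcongr
    rw [lpKer_eq, SchwartzMap.fourierInv_coe]
    exact Complex.abs_re_le_norm _
  set C : ℝ := 2 ^ 8 * (Finset.Iic (8, 0)).sup (fun m => SchwartzMap.seminorm ℝ m.1 m.2) (𝓕⁻ (hψ.symS 0))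
  have hC0 : 0 ≤ C := by positivity
  clear_value C
  refine ⟨C.toNNReal, fun m x => ?_⟩
  rw [lpKer_scale, ← ofReal_norm, norm_mul, Real.norm_of_nonneg (by positivity),
    ENNReal.ofReal_mul (by positivity), ENNReal.ofReal_pow (by positivity), ofReal_two_zpow]
  calc (2 ^ (m : ℝ)) ^ 3 * ENNReal.ofReal ‖lpKer ψ 0 ((2 : ℝ) ^ m • x)‖
      ≤ (2 ^ (m : ℝ)) ^ 3 * ENNReal.ofReal (C * ((1 + ‖(2 : ℝ) ^ m • x‖) ^ 8)⁻¹) := by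
        gcongr; exact hC _
    _ = 2 ^ (3 * (m : ℝ)) * (ENNReal.ofReal C * bracket m x ^ (-8 : ℝ)) := by
        rw [ENNReal.ofReal_mul hC0, ENNReal.ofReal_inv_of_pos (by positivity),
          ENNReal.ofReal_pow (by positivity), ENNReal.ofReal_add zero_le_one (by positivity),
          ENNReal.ofReal_one, norm_smul, ENNReal.ofReal_mul (by positivity),
          Real.norm_of_nonneg (by positivity), ofReal_two_zpow, ofReal_norm, ENNReal.rpow_neg,
          ← ENNReal.rpow_natCast (2 ^ (m : ℝ)), two_rpow_rpow, bracket, ← ENNReal.rpow_natCast]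
        congr 2
        push_cast; ring
    _ = _ := by rw [decayKernel, ENNReal.ofReal]; ring

lemma lpKerD_eq (hψ : IsLPCutoff ψ) (m : ℤ) (x : E3) :
    lpKerD ψ m x = lpKer ψ m x - lpKer ψ (m - 1) x := by
  have h : (fun η : E3 => ((ψ (((2 : ℝ) ^ m)⁻¹ • ((2 * Real.pi) • η)) -
      ψ ((2 * ((2 : ℝ) ^ m)⁻¹) • ((2 * Real.pi) • η)) : ℝ) : ℂ)) =
      (hψ.symS m - hψ.symS (m - 1) : 𝓢(E3, ℂ)) := by
    ext η
    rw [sub_apply, coe_symS, coe_symS]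
    simp only [lpSym]
    rw [zpow_sub_one₀ two_ne_zero, mul_inv, inv_inv, mul_comm _ (2 : ℝ)]
    push_cast; rfl
  rw [lpKerD, multKernel, h, lpKer_eq, lpKer_eq, ← SchwartzMap.fourierInv_coe, sub_eq_add_neg,
    FourierTransform.fourierInv_add, FourierTransform.fourierInv_neg, add_apply, neg_apply,
    Complex.add_re, Complex.neg_re, ← sub_eq_add_neg, SchwartzMap.fourierInv_coe, SchwartzMap.fourierInv_coe]
  rfl

lemma lpKerD_radial (hψ : IsLPCutoff ψ) (m : ℤ) : IsRadial (lpKerD ψ m) := fun x y h => by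
  rw [hψ.lpKerD_eq, hψ.lpKerD_eq, hψ.lpKer_radial m x y h, hψ.lpKer_radial (m - 1) x y h]

lemma continuous_lpKerD (hψ : IsLPCutoff ψ) (m : ℤ) : Continuous (lpKerD ψ m) := by
  rw [show lpKerD ψ m = fun x => lpKer ψ m x - lpKer ψ (m - 1) x from funext (hψ.lpKerD_eq m)]
  exact (hψ.continuous_lpKer m).sub (hψ.continuous_lpKer (m - 1))

lemma _root_.decayKernel_pred_le (m : ℤ) (x : E3) :
    decayKernel (m - 1) 8 x ≤ 2 ^ (8 : ℝ) * decayKernel m 8 x := by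
  have h : bracket m x ≤ 2 * bracket (m - 1) x := by
    unfold bracket
    rw [mul_add, ← mul_assoc]
    gcongr
    · norm_num
    · rw [show (m : ℝ) = 1 + ((m - 1 : ℤ) : ℝ) by push_cast; ring, two_rpow_add, ENNReal.rpow_one]
  have h2 : bracket (m - 1) x ^ (-8 : ℝ) ≤ 2 ^ (8 : ℝ) * bracket m x ^ (-8 : ℝ) := by
    calc bracket (m - 1) x ^ (-8 : ℝ) = 2 ^ (8 : ℝ) * (2 * bracket (m - 1) x) ^ (-8 : ℝ) := by
          rw [ENNReal.mul_rpow_of_ne_top (by simp) (bracket_ne_top _ _), ← mul_assoc, ← two_rpow_add]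
          simp
      _ ≤ _ := by
          gcongr 2 ^ (8 : ℝ) * ?_
          rw [ENNReal.rpow_neg, ENNReal.rpow_neg]
          exact ENNReal.inv_le_inv.2 (ENNReal.rpow_le_rpow h (by norm_num))
  unfold decayKernel
  rw [mul_left_comm]
  refine mul_le_mul' (two_rpow_le ?_) h2
  push_cast; linarith

lemma lpKerD_le (hψ : IsLPCutoff ψ) :
    ∃ C : ℝ≥0, ∀ m x, ‖lpKerD ψ m x‖ₑ ≤ C * decayKernel m 8 x := by
  obtain ⟨C, hC⟩ := hψ.lpKer_le
  refine ⟨C + C * 2 ^ (8 : ℝ), fun m x => ?_⟩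
  rw [hψ.lpKerD_eq]
  calc ‖lpKer ψ m x - lpKer ψ (m - 1) x‖ₑ ≤ ‖lpKer ψ m x‖ₑ + ‖lpKer ψ (m - 1) x‖ₑ := enorm_sub_le
    _ ≤ C * decayKernel m 8 x + C * (2 ^ (8 : ℝ) * decayKernel m 8 x) := by
        gcongr
        · exact hC m x
        · exact (hC (m - 1) x).trans (by gcongr; exact decayKernel_pred_le m x)
    _ = _ := by
        push_cast
        rw [ENNReal.coe_rpow_of_nonneg _ (by norm_num)]; push_cast; ring

end IsLPCutoff

lemma lpProj_apply (ψ : E3 → ℝ) (m : ℤ) (f : E3 → ℝ) (x : E3) :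
    lpProj ψ m f x = ∫ y, lpKerD ψ m (x - y) * f y := rfl

lemma lpProjLe_apply (ψ : E3 → ℝ) (m : ℤ) (f : E3 → ℝ) (x : E3) :
    lpProjLe ψ m f x = ∫ y, lpKer ψ m (x - y) * f y := rfl

lemma enorm_integral_kernel_le {k f : E3 → ℝ} {C : ℝ≥0} {m : ℤ}
    (hk : ∀ x, ‖k x‖ₑ ≤ C * decayKernel m 8 x) (x : E3) :
    ‖∫ y, k (x - y) * f y‖ₑ ≤ C * ∫⁻ y, decayKernel m 8 (x - y) * ‖f y‖ₑ := by
  refine (enorm_integral_le_lintegral_enorm _).trans ?_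
  rw [← lintegral_const_mul' _ _ ENNReal.coe_ne_top]
  refine lintegral_mono fun y => ?_
  rw [enorm_mul, ← mul_assoc]
  gcongr
  exact hk _

lemma integral_kernel_radial {k f : E3 → ℝ} (hk : IsRadial k) (hf : IsRadial f) :
    IsRadial fun x => ∫ y, k (x - y) * f y := fun x y h => by
  obtain ⟨A, hA⟩ := exists_isometry_of_norm_eq h
  simp only
  rw [← hA, ← A.measurePreserving.integral_comp A.toMeasurableEquiv.measurableEmbedding
    (fun z => k (A x - z) * f z)]
  refine integral_congr_ae (.of_forall fun z => ?_)
  simp only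
  rw [hf (A z) z (A.norm_map z), hk (A x - A z) (x - z) (by rw [← map_sub, A.norm_map])]

/-! ### The kernel of the smoothing operator -/

/-- A majorant for the kernel of the operator `I`. -/
def smoothingKernel (δ : ℝ) (k : ℤ) (z : E3) : ℝ≥0∞ :=
  ∑' n : ℕ, 2 ^ (-(δ * n)) * decayKernel (n + k) 8 z

@[fun_prop]
lemma measurable_smoothingKernel (δ : ℝ) (k : ℤ) : Measurable (smoothingKernel δ k) :=
  Measurable.tsum fun n => by fun_prop

lemma smoothingKernel_sub_comm (δ : ℝ) (k : ℤ) (x y : E3) :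
    smoothingKernel δ k (x - y) = smoothingKernel δ k (y - x) := by
  simp only [smoothingKernel, decayKernel_sub_comm _ _ x y]

lemma lintegral_smoothingKernel_mul (δ : ℝ) (k : ℤ) (x : E3) {G : E3 → ℝ≥0∞} (hG : AEMeasurable G) :
    ∫⁻ y, smoothingKernel δ k (x - y) * G y =
      ∑' n : ℕ, 2 ^ (-(δ * n)) * ∫⁻ y, decayKernel (n + k) 8 (x - y) * G y := by
  simp_rw [smoothingKernel, ← ENNReal.tsum_mul_right]
  rw [lintegral_tsum fun n => by fun_prop]
  congr 1; ext n
  simp_rw [mul_assoc]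
  exact lintegral_const_mul' _ _ (two_rpow_ne_top _)

/-- The n = 0 term of the majorant pays for P_{≤k}, the term n + 1 for P_{k+n+1} with its
coefficient. Afterwards I is seen only through this positive kernel. -/
lemma IsLPCutoff.opI_le {ψ : E3 → ℝ} (hψ : IsLPCutoff ψ) : ∃ C : ℝ≥0, ∀ (ε : ℝ) (k : ℤ) (F : E3 → ℝ)
    (x : E3), AEMeasurable F → ‖opI ψ ε k F x‖ₑ ≤
      C * ∫⁻ y, smoothingKernel (1 / 2 - ε) k (x - y) * ‖F y‖ₑ := by
  obtain ⟨C₁, hC₁⟩ := hψ.lpKer_le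
  obtain ⟨C₂, hC₂⟩ := hψ.lpKerD_le
  refine ⟨C₁ + C₂, fun ε k F x hF => ?_⟩
  rw [lintegral_smoothingKernel_mul _ _ _ (by fun_prop), tsum_eq_zero_add' ENNReal.summable, mul_add]
  refine (enorm_add_le _ _).trans (add_le_add ?_ ?_)
  · simp only [Nat.cast_zero, mul_zero, neg_zero, ENNReal.rpow_zero, one_mul, zero_add]
    refine (enorm_integral_kernel_le (hC₁ k) x).trans ?_
    gcongr; simp
  · refine enorm_tsum_le_tsum_enorm.trans ?_
    rw [← ENNReal.tsum_mul_left]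
    refine ENNReal.tsum_le_tsum fun n => ?_
    rw [enorm_mul]
    have h1 : ‖(2 : ℝ) ^ (-((n : ℝ) + 1) * (1 / 2 - ε))‖ₑ =
        (2 : ℝ≥0∞) ^ (-((1 / 2 - ε) * ((n + 1 : ℕ) : ℝ))) := by
      rw [Real.enorm_eq_ofReal (by positivity), ← ENNReal.ofReal_rpow_of_pos two_pos, ENNReal.ofReal_ofNat]
      congr 1; push_cast; ring
    rw [h1, mul_left_comm]
    gcongr
    refine (enorm_integral_kernel_le (hC₂ _) x).trans ?_
    push_cast
    gcongr; simp

lemma lintegral_smoothingKernel_le {δ : ℝ} (hδ : 0 < δ) : ∃ C : ℝ≥0, ∀ (k : ℤ) (x : E3)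
    (G : E3 → ℝ≥0∞) (B : ℝ≥0∞), AEMeasurable G →
    (∀ n : ℕ, ∫⁻ y, decayKernel (n + k) 8 (x - y) * G y ≤ B) →
    ∫⁻ y, smoothingKernel δ k (x - y) * G y ≤ C * B := by
  obtain ⟨C, hC⟩ := tsum_two_rpow hδ
  refine ⟨C, fun k x G B hG h => ?_⟩
  rw [lintegral_smoothingKernel_mul _ _ _ hG, ← hC, ← ENNReal.tsum_mul_right]
  gcongr
  exact h _

lemma decayKernel_mul_bracket_le {k m : ℤ} (h : k ≤ m) {N a : ℝ} (ha : 0 ≤ a) (z : E3) :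
    decayKernel m N z * bracket k z ^ a ≤ decayKernel m (N - a) z := by
  rw [← decayKernel_mul_bracket]
  gcongr
  exact bracket_mono h z

/-- All frequencies in the majorant are at least 2^k, so the bracket at scale k is dominated by that
of each term. Up to four powers come out of the order-eight decay and integrability remains. -/
lemma lintegral_smoothingKernel_bracket {δ : ℝ} (hδ : 0 < δ) : ∃ C : ℝ≥0, ∀ (k : ℤ) (x : E3) (a : ℝ),
    0 ≤ a → a ≤ 4 → ∫⁻ y, smoothingKernel δ k (x - y) * bracket k (x - y) ^ a ≤ C := by
  obtain ⟨C₁, hC₁⟩ := lintegral_decayKernel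
  obtain ⟨C₂, hC₂⟩ := lintegral_smoothingKernel_le hδ
  refine ⟨C₂ * C₁, fun k x a ha ha' => ?_⟩
  push_cast
  refine hC₂ k x _ _ (by fun_prop) fun n => ?_
  refine (lintegral_mono fun y => ?_).trans (hC₁ (n + k) (8 - a) x (by linarith))
  exact decayKernel_mul_bracket_le (by omega) ha _

lemma lintegral_smoothingKernel {δ : ℝ} (hδ : 0 < δ) : ∃ C : ℝ≥0, ∀ (k : ℤ) (x : E3),
    ∫⁻ y, smoothingKernel δ k (x - y) ≤ C := by
  obtain ⟨C, hC⟩ := lintegral_smoothingKernel_bracket hδ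
  exact ⟨C, fun k x => by simpa using hC k x 0 le_rfl (by norm_num)⟩

lemma lintegral_smoothingKernel_weight {δ : ℝ} (hδ : 0 < δ) : ∃ C : ℝ≥0, ∀ (k : ℤ) (x : E3),
    ∫⁻ y, smoothingKernel δ k (x - y) * weight k y ≤ C * weight k x := by
  obtain ⟨C, hC⟩ := lintegral_smoothingKernel_bracket hδ
  refine ⟨C, fun k x => ?_⟩
  calc ∫⁻ y, smoothingKernel δ k (x - y) * weight k y
      ≤ ∫⁻ y, (smoothingKernel δ k (x - y) * bracket k (x - y) ^ (1 : ℝ)) * weight k x := by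
        refine lintegral_mono fun y => ?_
        rw [ENNReal.rpow_one, mul_assoc, mul_comm (bracket _ _)]
        gcongr
        have := weight_le_mul k y x
        rwa [← neg_sub, bracket_neg] at this
    _ = (∫⁻ y, smoothingKernel δ k (x - y) * bracket k (x - y) ^ (1 : ℝ)) * weight k x := by
        rw [lintegral_mul_const]; fun_prop
    _ ≤ _ := by gcongr; exact hC k x 1 zero_le_one (by norm_num)

/-- The weight `|x|⁻¹ (1 + 2 ^ k |x|)⁻²` is stable under convolution with the smoothing kernel. -/
lemma lintegral_smoothingKernel_singular {δ : ℝ} (hδ : 0 < δ) : ∃ C : ℝ≥0, ∀ (k : ℤ) (x : E3),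
    ∫⁻ y, smoothingKernel δ k (x - y) * (‖y‖ₑ ^ (-1 : ℝ) * bracket k y ^ (-2 : ℝ)) ≤
      C * (‖x‖ₑ ^ (-1 : ℝ) * bracket k x ^ (-2 : ℝ)) := by
  obtain ⟨C₁, hC₁⟩ := lintegral_decayKernel_mul_inv
  obtain ⟨C₂, hC₂⟩ := lintegral_smoothingKernel_le hδ
  refine ⟨C₂ * C₁, fun k x => ?_⟩
  push_cast
  rw [mul_assoc]
  refine hC₂ k x _ _ (by fun_prop) fun n => ?_
  calc ∫⁻ y, decayKernel (n + k) 8 (x - y) * (‖y‖ₑ ^ (-1 : ℝ) * bracket k y ^ (-2 : ℝ))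
      ≤ ∫⁻ y, bracket k x ^ (-2 : ℝ) * (decayKernel (n + k) (8 - 2) (x - y) * ‖y‖ₑ ^ (-1 : ℝ)) := by
        refine lintegral_mono fun y => ?_
        have h1 := bracket_neg_rpow_le k y x zero_le_two
        rw [← neg_sub, bracket_neg] at h1
        have h2 := decayKernel_mul_bracket_le (k := k) (m := n + k) (by omega) (N := 8) zero_le_two (x - y)
        calc _ ≤ decayKernel (n + k) 8 (x - y) * (‖y‖ₑ ^ (-1 : ℝ) *
              (bracket k x ^ (-2 : ℝ) * bracket k (x - y) ^ (2 : ℝ))) := by gcongr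
          _ = bracket k x ^ (-2 : ℝ) * ((decayKernel (n + k) 8 (x - y) * bracket k (x - y) ^ (2 : ℝ)) *
              ‖y‖ₑ ^ (-1 : ℝ)) := by ring
          _ ≤ _ := by gcongr
    _ = bracket k x ^ (-2 : ℝ) * ∫⁻ y, decayKernel (n + k) (8 - 2) (x - y) * ‖y‖ₑ ^ (-1 : ℝ) := by
        rw [lintegral_const_mul]; fun_prop
    _ ≤ bracket k x ^ (-2 : ℝ) * (C₁ * weight (n + k) x) := by
        gcongr; exact hC₁ _ _ _ (by norm_num)
    _ ≤ bracket k x ^ (-2 : ℝ) * (C₁ * ‖x‖ₑ ^ (-1 : ℝ)) := by gcongr; exact weight_le_enorm _ _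
    _ = _ := by ring

lemma lintegral_lintegral_smoothingKernel_le {δ : ℝ} (hδ : 0 < δ) : ∃ C : ℝ≥0, ∀ (k : ℤ)
    (G : E3 → ℝ≥0∞), AEMeasurable G →
    ∫⁻ x, ∫⁻ y, smoothingKernel δ k (x - y) * G y ≤ C * ∫⁻ y, G y := by
  obtain ⟨C, hC⟩ := lintegral_smoothingKernel hδ
  refine ⟨C, fun k G hG => ?_⟩
  rw [lintegral_lintegral_swap (by fun_prop), ← lintegral_const_mul'' _ hG]
  refine lintegral_mono fun y => ?_
  simp only
  rw [lintegral_mul_const _ (by fun_prop)]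
  gcongr
  simp_rw [smoothingKernel_sub_comm δ k _ y]
  exact hC k y

/-- Cauchy-Schwarz in the frequency index, with 2^(-δn) split unevenly. The faster decaying factor
pays for a weight growing like 2^(2θn); the other one remains summable as long as θ < δ. -/
lemma smoothingKernel_sq_le (δ θ : ℝ) (k : ℤ) (z : E3) :
    smoothingKernel δ k z ^ 2 ≤ smoothingKernel (δ + θ) k z * smoothingKernel (δ - θ) k z := by
  have h := sq_lintegral_weighted_le (μ := Measure.count) (α := ℕ)
    (k := fun n => decayKernel (n + k) 8 z) (k₁ := fun n => decayKernel (n + k) 8 z)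
    (k₂ := fun n => decayKernel (n + k) 8 z)
    (a := fun n => 2 ^ (-((δ + θ) / 2 * n))) (b := fun n => 2 ^ (-((δ - θ) / 2 * n)))
    (fun n => (sq _).le) (measurable_of_countable _).aemeasurable (measurable_of_countable _).aemeasurable
    (measurable_of_countable _).aemeasurable (measurable_of_countable _).aemeasurable
  simp_rw [lintegral_count, two_rpow_sq, ← two_rpow_add] at h
  unfold smoothingKernel
  have e1 : ∀ n : ℕ, -((δ + θ) / 2 * (n : ℝ)) + -((δ - θ) / 2 * n) = -(δ * n) := fun n => by ring
  have e2 : ∀ n : ℕ, 2 * -((δ + θ) / 2 * (n : ℝ)) = -((δ + θ) * n) := fun n => by ring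
  have e3 : ∀ n : ℕ, 2 * -((δ - θ) / 2 * (n : ℝ)) = -((δ - θ) * n) := fun n => by ring
  simp only [e1, e2, e3, mul_comm (decayKernel _ _ _)] at h
  exact h

/-- A Stein-Weiss inequality for the smoothing kernel. -/
lemma lintegral_sq_smoothingKernel_singular {δ θ : ℝ} (hθ : 0 < θ) (hθδ : θ < δ) (hθ' : θ ≤ 1 / 2) :
    ∃ C : ℝ≥0, ∀ (k : ℤ) (u : E3 → ℝ≥0∞), AEMeasurable u →
    ∫⁻ x, (∫⁻ y, smoothingKernel δ k (x - y) * (‖y‖ₑ ^ (-θ) * u y)) ^ 2 ≤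
      C * 2 ^ (2 * k * θ) * ∫⁻ y, u y ^ 2 := by
  obtain ⟨C₁, hC₁⟩ := lintegral_decayKernel
  obtain ⟨C₂, hC₂⟩ := lintegral_decayKernel_mul_inv
  obtain ⟨C₃, hC₃⟩ := lintegral_lintegral_smoothingKernel_le (show 0 < δ - θ by linarith)
  obtain ⟨C₄, hC₄⟩ := tsum_two_rpow (show 0 < δ - θ by linarith)
  -- At scale 2^(-m) the average of |y|^(-2θ) is at most of order 2^(2mθ). Since 2θ ≤ 1, below that
  -- scale the power is dominated by a multiple of 1/|y|, for which the A₁ bound is available.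
  have hb : ∀ (m : ℤ) (x : E3), ∫⁻ y, decayKernel m 8 (x - y) * (‖y‖ₑ ^ (-θ)) ^ 2 ≤
      (C₁ + C₂) * 2 ^ (2 * m * θ) := by
    intro m x
    calc ∫⁻ y, decayKernel m 8 (x - y) * (‖y‖ₑ ^ (-θ)) ^ 2
        ≤ ∫⁻ y, (2 ^ (2 * m * θ) * decayKernel m 8 (x - y) +
            2 ^ (2 * m * θ - m) * (decayKernel m 8 (x - y) * ‖y‖ₑ ^ (-1 : ℝ))) := by
          refine lintegral_mono fun y => ?_
          have h1 : (‖y‖ₑ ^ (-θ)) ^ 2 ≤ 2 ^ (2 * m * θ) + 2 ^ (2 * m * θ - m) * ‖y‖ₑ ^ (-1 : ℝ) := by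
            rw [← ENNReal.rpow_ofNat, ← ENNReal.rpow_mul]
            rcases le_or_gt (2 ^ (-(m : ℝ))) ‖y‖ₑ with h | h
            · refine le_trans ?_ le_self_add
              calc ‖y‖ₑ ^ (-θ * 2) = (‖y‖ₑ ^ (θ * 2))⁻¹ := by rw [← ENNReal.rpow_neg]; ring_nf
                _ ≤ ((2 ^ (-(m : ℝ))) ^ (θ * 2))⁻¹ :=
                    ENNReal.inv_le_inv.2 (ENNReal.rpow_le_rpow h (by linarith))
                _ = _ := by rw [two_rpow_rpow, ← ENNReal.rpow_neg]; ring_nf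
            · refine le_trans ?_ le_add_self
              rcases eq_or_ne ‖y‖ₑ 0 with h0 | h0
              · rw [h0, ENNReal.zero_rpow_of_neg (y := -1) (by norm_num), ENNReal.mul_top (two_rpow_ne_zero _)]
                exact le_top
              calc ‖y‖ₑ ^ (-θ * 2) = ‖y‖ₑ ^ (1 - θ * 2) * ‖y‖ₑ ^ (-1 : ℝ) := by
                    rw [← ENNReal.rpow_add _ _ h0 enorm_ne_top]; ring_nf
                _ ≤ (2 ^ (-(m : ℝ))) ^ (1 - θ * 2) * ‖y‖ₑ ^ (-1 : ℝ) := by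
                    gcongr
                    linarith
                _ = _ := by rw [two_rpow_rpow]; ring_nf
          calc _ ≤ decayKernel m 8 (x - y) * (2 ^ (2 * m * θ) + 2 ^ (2 * m * θ - m) * ‖y‖ₑ ^ (-1 : ℝ)) := by
                gcongr
            _ = _ := by ring
      _ = 2 ^ (2 * m * θ) * (∫⁻ y, decayKernel m 8 (x - y)) +
          2 ^ (2 * m * θ - m) * ∫⁻ y, decayKernel m 8 (x - y) * ‖y‖ₑ ^ (-1 : ℝ) := by
          rw [lintegral_add_left (by fun_prop), lintegral_const_mul _ (by fun_prop),
            lintegral_const_mul _ (by fun_prop)]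
      _ ≤ 2 ^ (2 * m * θ) * C₁ + 2 ^ (2 * m * θ - m) * (C₂ * 2 ^ (m : ℝ)) := by
          gcongr
          · exact hC₁ _ _ _ (by norm_num)
          · refine (hC₂ _ _ _ (by norm_num)).trans ?_
            gcongr
            rw [weight]
            exact mul_le_of_le_one_right' (bracket_rpow_le_one m x zero_le_one)
      _ = 2 ^ (2 * m * θ) * C₁ + C₂ * (2 ^ (2 * m * θ - m) * 2 ^ (m : ℝ)) := by ring
      _ = _ := by rw [← two_rpow_add, sub_add_cancel]; ring
  -- The coefficient 2^(-(δ+θ)n) times 2^(2θ(n+k)) equals 2^(2kθ) 2^(-(δ-θ)n), which sums because θ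
  -- < δ.
  have hfirst : ∀ (k : ℤ) (x : E3), ∫⁻ y, smoothingKernel (δ + θ) k (x - y) * (‖y‖ₑ ^ (-θ)) ^ 2 ≤
      (C₁ + C₂) * C₄ * 2 ^ (2 * k * θ) := by
    intro k x
    rw [lintegral_smoothingKernel_mul _ _ _ (by fun_prop)]
    calc _ ≤ ∑' n : ℕ, 2 ^ (-((δ + θ) * n)) * ((C₁ + C₂ : ℝ≥0∞) * 2 ^ (2 * ((n + k : ℤ) : ℝ) * θ)) := by
          gcongr; exact hb _ x
      _ = ∑' n : ℕ, (C₁ + C₂ : ℝ≥0∞) * 2 ^ (2 * k * θ) * 2 ^ (-((δ - θ) * n)) := by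
          congr 1; ext n
          rw [mul_left_comm (2 ^ (-((δ + θ) * (n : ℝ)))), ← two_rpow_add, mul_assoc (C₁ + C₂ : ℝ≥0∞),
            ← two_rpow_add]
          congr 2; push_cast; ring
      _ = _ := by rw [ENNReal.tsum_mul_left, hC₄]; ring
  refine ⟨(C₁ + C₂) * C₄ * C₃, fun k u hu => ?_⟩
  calc ∫⁻ x, (∫⁻ y, smoothingKernel δ k (x - y) * (‖y‖ₑ ^ (-θ) * u y)) ^ 2
      ≤ ∫⁻ x, (C₁ + C₂) * C₄ * 2 ^ (2 * k * θ) * ∫⁻ y, smoothingKernel (δ - θ) k (x - y) * u y ^ 2 := by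
        refine lintegral_mono fun x => ?_
        refine (sq_lintegral_weighted_le (fun y => smoothingKernel_sq_le δ θ k (x - y)) (by fun_prop)
          (by fun_prop) (by fun_prop) hu).trans ?_
        gcongr
        exact hfirst k x
    _ = (C₁ + C₂) * C₄ * 2 ^ (2 * k * θ) * ∫⁻ x, ∫⁻ y, smoothingKernel (δ - θ) k (x - y) * u y ^ 2 := by
        refine lintegral_const_mul' _ _ (ENNReal.mul_ne_top (by finiteness) (two_rpow_ne_top _))
    _ ≤ (C₁ + C₂) * C₄ * 2 ^ (2 * k * θ) * (C₃ * ∫⁻ y, u y ^ 2) := by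
        gcongr; exact hC₃ k _ (by fun_prop)
    _ = _ := by push_cast; ring

/-! ### The Fourier representation of the Littlewood-Paley pieces -/

lemma integral_fourierInv_mul {u v : E3 → ℂ} (hu : Integrable u) (hv : Integrable v) :
    ∫ x, 𝓕⁻ u x * v x = ∫ x, u x * 𝓕⁻ v x := by
  have h := VectorFourier.integral_fourierIntegral_smul_eq_flip (μ := (volume : Measure E3))
    (ν := (volume : Measure E3)) (L := -innerₗ E3) Real.continuous_fourierChar
    (continuous_inner (𝕜 := ℝ) (E := E3)).neg hu hv
  have hflip : (-innerₗ E3).flip = -innerₗ E3 := by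
    ext x y; simp [real_inner_comm]
  rw [hflip] at h
  exact h

lemma continuous_fourierInv {u : E3 → ℂ} (hu : Integrable u) : Continuous (𝓕⁻ u) :=
  VectorFourier.fourierIntegral_continuous (L := -innerₗ E3) Real.continuous_fourierChar
    (continuous_inner (𝕜 := ℝ) (E := E3)).neg hu

/-- The inverse Fourier transform is an `L²` contraction on `L¹ ∩ L²`. -/
lemma lintegral_fourierInv_sq_le {u : E3 → ℂ} (hu : Integrable u) :
    ∫⁻ x, ‖𝓕⁻ u x‖ₑ ^ 2 ≤ ∫⁻ η, ‖u η‖ₑ ^ 2 := by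
  rcases eq_or_ne (∫⁻ η, ‖u η‖ₑ ^ 2) ⊤ with h | h
  · rw [h]; exact le_top
  have hsq : ∀ v : E3 → ℂ, eLpNorm v 2 volume ^ 2 = ∫⁻ x, ‖v x‖ₑ ^ 2 := fun v => by
    rw [eLpNorm_eq_lintegral_rpow_enorm_toReal (by norm_num) (by norm_num)]
    simp only [ENNReal.toReal_ofNat, ENNReal.rpow_ofNat]
    exact sq_sqrt _
  have hL2 : MemLp u 2 volume := by
    refine ⟨hu.1, ?_⟩
    rw [lt_top_iff_ne_top]
    intro h2
    rw [← hsq, h2] at h; simp at h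
  -- The integral formula and the Plancherel extension of the inverse transform are identified by
  -- testing against smooth compactly supported functions; Plancherel then compares the norms.
  have key : 𝓕⁻ u =ᵐ[volume] (𝓕⁻ (hL2.toLp u) : Lp ℂ 2 (volume : Measure E3)) := by
    refine ae_eq_of_integral_contDiff_smul_eq (continuous_fourierInv hu).locallyIntegrable
      ((Lp.memLp _).locallyIntegrable (by norm_num)) fun g hg hgc => ?_
    have hg' : ContDiff ℝ ∞ fun x => (g x : ℂ) := Complex.ofRealCLM.contDiff.comp hg
    have hgc' : HasCompactSupport fun x => (g x : ℂ) := hgc.comp_left Complex.ofReal_zero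
    set φ : 𝓢(E3, ℂ) := hgc'.toSchwartzMap hg'
    have h1 := congrArg (fun T => T φ) (Lp.fourierInv_toTemperedDistribution_eq (hL2.toLp u))
    simp only [TemperedDistribution.fourierInv_apply, Lp.toTemperedDistribution_apply] at h1
    have h2 := integral_fourierInv_mul hu φ.integrable
    have h3 : ∫ x, (𝓕⁻ φ : 𝓢(E3, ℂ)) x • (hL2.toLp u : E3 → ℂ) x = ∫ x, u x * 𝓕⁻ (φ : E3 → ℂ) x := by
      refine integral_congr_ae ?_
      filter_upwards [hL2.coeFn_toLp] with x hx
      rw [hx, SchwartzMap.fourierInv_coe, smul_eq_mul, mul_comm]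
    rw [h3, ← h2] at h1
    calc ∫ x, g x • 𝓕⁻ u x = ∫ x, 𝓕⁻ u x * φ x := by
          congr 1; ext x; rw [Complex.real_smul, mul_comm]; rfl
      _ = _ := by
          rw [h1]; congr 1
  calc ∫⁻ x, ‖𝓕⁻ u x‖ₑ ^ 2 = eLpNorm (𝓕⁻ u) 2 volume ^ 2 := (hsq _).symm
    _ = eLpNorm u 2 volume ^ 2 := by
        rw [eLpNorm_congr_ae key, ← Lp.enorm_def, ← ofReal_norm,
          ← Lp.norm_fourier_eq, FourierTransform.fourier_fourierInv_eq, ofReal_norm, Lp.enorm_toLp]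
    _ ≤ _ := (hsq u).le

namespace IsLPCutoff

variable {ψ : E3 → ℝ}

/-- The symbol of `P_{≤ m}`, modulated so that its Fourier transform is centered at `x`. -/
def modS (hψ : IsLPCutoff ψ) (m : ℤ) (x : E3) : 𝓢(E3, ℂ) :=
  HasCompactSupport.toSchwartzMap (f := fun η => Complex.exp (↑(2 * Real.pi * inner ℝ η x) * Complex.I) *
      lpSym ψ m η) (hψ.hasCompactSupport_lpSym m).mul_left (by
    refine ContDiff.mul (Complex.contDiff_exp.comp ?_) (hψ.contDiff_lpSym m)
    refine ContDiff.mul (Complex.ofRealCLM.contDiff.comp ?_) contDiff_const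
    exact contDiff_const.mul (contDiff_id.inner ℝ contDiff_const))

lemma modS_apply (hψ : IsLPCutoff ψ) (m : ℤ) (x η : E3) : hψ.modS m x η =
    Complex.exp (↑(2 * Real.pi * inner ℝ η x) * Complex.I) * lpSym ψ m η := rfl

/-- Makes P_{≤m}f(x) the pairing of f with the Fourier transform of a Schwartz function, so that the
distributional Fourier transform of f can be inserted. -/
lemma fourier_modS (hψ : IsLPCutoff ψ) (m : ℤ) (x y : E3) :
    (𝓕 (hψ.modS m x)) y = (lpKer ψ m (x - y) : ℂ) := by
  rw [hψ.ofReal_lpKer, SchwartzMap.fourier_coe, Real.fourier_eq', Real.fourierInv_eq']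
  congr 1; ext η
  rw [modS_apply, smul_eq_mul, smul_eq_mul, ← mul_assoc, ← Complex.exp_add, inner_sub_right]
  congr 2
  push_cast; ring

lemma integral_mul_modS (hψ : IsLPCutoff ψ) (m : ℤ) (x : E3) (w : E3 → ℂ) :
    ∫ η, w η * hψ.modS m x η = 𝓕⁻ (fun η => w η * lpSym ψ m η) x := by
  rw [Real.fourierInv_eq']
  congr 1; ext η
  rw [modS_apply, smul_eq_mul]; ring

end IsLPCutoff

namespace IsFourierTransform

variable {ψ : E3 → ℝ} {f : E3 → ℝ} {w : E3 → ℂ}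

lemma integrable_lpKer_mul (hf : IsFourierTransform f w) (hψ : IsLPCutoff ψ) (m : ℤ) (x : E3) :
    Integrable fun y => lpKer ψ m (x - y) * f y := by
  have h := (hf (𝓕 (hψ.modS m x))).1
  simp_rw [hψ.fourier_modS, ← Complex.ofReal_mul] at h
  simpa [mul_comm] using h.re

lemma integrable_mul_lpSym (hf : IsFourierTransform f w) (hψ : IsLPCutoff ψ) (m : ℤ) :
    Integrable fun η => w η * lpSym ψ m η := (hf (hψ.symS m)).2.1

lemma ofReal_lpProjLe (hf : IsFourierTransform f w) (hψ : IsLPCutoff ψ) (m : ℤ) (x : E3) :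
    (lpProjLe ψ m f x : ℂ) = 𝓕⁻ (fun η => w η * lpSym ψ m η) x := by
  rw [← hψ.integral_mul_modS, ← (hf (hψ.modS m x)).2.2, lpProjLe_apply, ← integral_complex_ofReal]
  congr 1; ext y
  rw [hψ.fourier_modS]; push_cast; ring

lemma lpProj_eq_sub (hf : IsFourierTransform f w) (hψ : IsLPCutoff ψ) (m : ℤ) (x : E3) :
    lpProj ψ m f x = lpProjLe ψ m f x - lpProjLe ψ (m - 1) f x := by
  rw [lpProj_apply, lpProjLe_apply, lpProjLe_apply,
    ← integral_sub (hf.integrable_lpKer_mul hψ m x) (hf.integrable_lpKer_mul hψ (m - 1) x)]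
  congr 1; ext y
  rw [hψ.lpKerD_eq]; ring

lemma integrable_mul_lpSym_sub (hf : IsFourierTransform f w) (hψ : IsLPCutoff ψ) (m : ℤ) :
    Integrable fun η => w η * (lpSym ψ m η - lpSym ψ (m - 1) η) := by
  simp_rw [mul_sub]
  exact (hf.integrable_mul_lpSym hψ m).sub (hf.integrable_mul_lpSym hψ (m - 1))

lemma ofReal_lpProj (hf : IsFourierTransform f w) (hψ : IsLPCutoff ψ) (m : ℤ) (x : E3) :
    (lpProj ψ m f x : ℂ) = 𝓕⁻ (fun η => w η * (lpSym ψ m η - lpSym ψ (m - 1) η)) x := by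
  rw [hf.lpProj_eq_sub hψ, Complex.ofReal_sub, hf.ofReal_lpProjLe hψ, hf.ofReal_lpProjLe hψ,
    ← hψ.integral_mul_modS, ← hψ.integral_mul_modS,
    ← integral_sub (hf (hψ.modS m x)).2.1 (hf (hψ.modS (m - 1) x)).2.1, Real.fourierInv_eq']
  congr 1; ext η
  rw [hψ.modS_apply, hψ.modS_apply, smul_eq_mul]; ring

lemma continuous_lpProj (hf : IsFourierTransform f w) (hψ : IsLPCutoff ψ) (m : ℤ) :
    Continuous (lpProj ψ m f) := by
  have h := Complex.continuous_re.comp (continuous_fourierInv (hf.integrable_mul_lpSym_sub hψ m))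
  convert h using 1
  ext x
  rw [Function.comp_apply, ← hf.ofReal_lpProj hψ, Complex.ofReal_re]

lemma continuous_lpProjLe (hf : IsFourierTransform f w) (hψ : IsLPCutoff ψ) (m : ℤ) :
    Continuous (lpProjLe ψ m f) := by
  have h := Complex.continuous_re.comp (continuous_fourierInv (hf.integrable_mul_lpSym hψ m))
  convert h using 1
  ext x
  rw [Function.comp_apply, ← hf.ofReal_lpProjLe hψ, Complex.ofReal_re]

/-- A Littlewood-Paley piece is reproduced by a wider projection. -/
lemma lpProjLe_lpProj (hf : IsFourierTransform f w) (hψ : IsLPCutoff ψ) (m : ℤ) (x : E3) :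
    lpProjLe ψ (m + 1) (lpProj ψ m f) x = lpProj ψ m f x := by
  rw [← Complex.ofReal_inj, lpProjLe_apply, ← integral_complex_ofReal]
  set u : E3 → ℂ := fun η => w η * (lpSym ψ m η - lpSym ψ (m - 1) η)
  have hu : Integrable u := hf.integrable_mul_lpSym_sub hψ m
  calc ∫ y, ((lpKer ψ (m + 1) (x - y) * lpProj ψ m f y : ℝ) : ℂ)
      = ∫ y, 𝓕⁻ u y * (𝓕 (hψ.modS (m + 1) x)) y := by
        congr 1; ext y
        rw [hψ.fourier_modS, ← hf.ofReal_lpProj hψ]; push_cast; ring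
    _ = ∫ η, u η * hψ.modS (m + 1) x η := by
        rw [integral_fourierInv_mul hu (SchwartzMap.integrable _), ← SchwartzMap.fourierInv_coe,
          FourierTransform.fourierInv_fourier_eq]
    _ = 𝓕⁻ u x := by
        rw [hψ.integral_mul_modS]
        refine congrArg (fun F : E3 → ℂ => 𝓕⁻ F x) (funext fun η => ?_)
        by_cases h : 2 * Real.pi * ‖η‖ ≤ 2 ^ (m + 1)
        · rw [hψ.lpSym_eq_one h, mul_one]
        · have h1 : lpSym ψ m η = 0 := hψ.lpSym_eq_zero (by
            rw [zpow_add_one₀ two_ne_zero] at h; linarith)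
          have h2 : lpSym ψ (m - 1) η = 0 := by
            have := hψ.norm_lpSym_mono (show m - 1 ≤ m by omega) η
            rw [h1, norm_zero] at this
            exact norm_le_zero_iff.1 this
          simp [u, h1, h2]
    _ = _ := (hf.ofReal_lpProj hψ m x).symm

/-- Bernstein's inequality for `Ḣ¹`. -/
lemma lintegral_lpProj_sq_le (hf : IsFourierTransform f w) (hψ : IsLPCutoff ψ) (m : ℤ) :
    ∫⁻ x, ‖lpProj ψ m f x‖ₑ ^ 2 ≤
      16 * 2 ^ (-(2 * (m : ℝ))) * ∫⁻ η, ‖((2 * Real.pi * ‖η‖) ^ (1 : ℝ)) • w η‖ₑ ^ 2 := by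
  have h1 : ∫⁻ x, ‖lpProj ψ m f x‖ₑ ^ 2 =
      ∫⁻ x, ‖𝓕⁻ (fun η => w η * (lpSym ψ m η - lpSym ψ (m - 1) η)) x‖ₑ ^ 2 := by
    congr 1; ext x
    rw [← hf.ofReal_lpProj hψ, ← ofReal_norm, ← ofReal_norm, Complex.norm_real]
  rw [h1]
  refine (lintegral_fourierInv_sq_le (hf.integrable_mul_lpSym_sub hψ m)).trans ?_
  rw [← lintegral_const_mul' _ _ (ENNReal.mul_ne_top (by simp) (two_rpow_ne_top _))]
  refine lintegral_mono fun η => ?_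
  -- The difference of symbols vanishes for 2π|η| ≤ 2^(m-1); elsewhere it is at most 2, which is
  -- below 4 · 2^(-m) · 2π|η|.
  have h2 : ‖w η * (lpSym ψ m η - lpSym ψ (m - 1) η)‖ ≤
      4 * ((2 : ℝ) ^ m)⁻¹ * ‖((2 * Real.pi * ‖η‖) ^ (1 : ℝ)) • w η‖ := by
    rw [Real.rpow_one, norm_smul, norm_mul, Real.norm_of_nonneg (by positivity)]
    have hp : (0 : ℝ) < 2 ^ m := by positivity
    by_cases h : 2 * Real.pi * ‖η‖ ≤ 2 ^ (m - 1)
    · rw [hψ.lpSym_eq_one h, hψ.lpSym_eq_one (h.trans (zpow_le_zpow_right₀ one_le_two (by omega)))]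
      simp; positivity
    · have h3 : ‖lpSym ψ m η - lpSym ψ (m - 1) η‖ ≤ 2 := by
        refine (norm_sub_le _ _).trans ?_
        linarith [hψ.norm_lpSym_le_one m η, hψ.norm_lpSym_le_one (m - 1) η]
      have h4 : 2 ≤ 4 * ((2 : ℝ) ^ m)⁻¹ * (2 * Real.pi * ‖η‖) := by
        rw [not_le, zpow_sub_one₀ two_ne_zero] at h
        rw [mul_assoc, inv_mul_eq_div, mul_div_assoc', le_div_iff₀ hp]; linarith
      calc ‖w η‖ * ‖lpSym ψ m η - lpSym ψ (m - 1) η‖ ≤ ‖w η‖ * (4 * ((2 : ℝ) ^ m)⁻¹ * (2 * Real.pi * ‖η‖)) := by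
            gcongr; exact h3.trans h4
        _ = _ := by ring
  have h5 := ENNReal.ofReal_le_ofReal h2
  rw [ENNReal.ofReal_mul (by positivity), ENNReal.ofReal_mul (by positivity), ofReal_norm, ofReal_norm,
    ENNReal.ofReal_inv_of_pos (by positivity), ofReal_two_zpow, ← ENNReal.rpow_neg, ENNReal.ofReal_ofNat] at h5
  refine (pow_le_pow_left' h5 2).trans (le_of_eq ?_)
  rw [mul_pow, mul_pow, two_rpow_sq]
  norm_num

end IsFourierTransform

/-! ### Reconstruction from the Littlewood-Paley pieces -/

namespace IsFourierTransform

variable {ψ : E3 → ℝ} {f : E3 → ℝ} {w : E3 → ℂ}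

/-- On a given compact set some cutoff symbol, read as a test function in x, equals 1, so f agrees
there with an integrable product. -/
lemma locallyIntegrable (hf : IsFourierTransform f w) (hψ : IsLPCutoff ψ) : LocallyIntegrable f := by
  rw [locallyIntegrable_iff]
  intro k hk
  obtain ⟨R, hR⟩ := hk.isBounded.subset_closedBall (0 : E3)
  obtain ⟨n, hn⟩ := pow_unbounded_of_one_lt (2 * Real.pi * R) (one_lt_two (α := ℝ))
  refine ((hf (hψ.symS n)).1.re.integrableOn (s := k)).congr_fun (fun x hx => ?_) hk.measurableSet
  have h1 : lpSym ψ n x = 1 := hψ.lpSym_eq_one (by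
    have := mem_closedBall_zero_iff.1 (hR hx)
    rw [zpow_natCast]
    refine le_trans ?_ hn.le
    gcongr)
  have h2 : hψ.symS n x = 1 := h1
  simp [h2]

/-- On the Fourier side the symbol increases to 1 and is eventually equal to 1 at each point, so
dominated convergence applies with the transform of the test function. -/
lemma tendsto_integral_lpProjLe (hf : IsFourierTransform f w) (hψ : IsLPCutoff ψ) (m : ℤ) (φ : 𝓢(E3, ℂ)) :
    Filter.Tendsto (fun n : ℕ => ∫ x, (lpProjLe ψ (n + m) f x : ℂ) * φ x) Filter.atTop
      (nhds (∫ x, (f x : ℂ) * φ x)) := by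
  have h1 : ∀ n : ℕ, ∫ x, (lpProjLe ψ (n + m) f x : ℂ) * φ x =
      ∫ η, w η * lpSym ψ (n + m) η * (𝓕⁻ φ : 𝓢(E3, ℂ)) η := fun n => by
    simp_rw [hf.ofReal_lpProjLe hψ]
    rw [integral_fourierInv_mul (hf.integrable_mul_lpSym hψ _) φ.integrable, SchwartzMap.fourierInv_coe]
  have h2 : ∫ x, (f x : ℂ) * φ x = ∫ η, w η * (𝓕⁻ φ : 𝓢(E3, ℂ)) η := by
    rw [← (hf (𝓕⁻ φ)).2.2, FourierTransform.fourier_fourierInv_eq]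
  simp_rw [h1]
  rw [h2]
  refine tendsto_integral_of_dominated_convergence (fun η => ‖w η * (𝓕⁻ φ : 𝓢(E3, ℂ)) η‖) (fun n => ?_)
    (hf (𝓕⁻ φ)).2.1.norm (fun n => .of_forall fun η => ?_) (.of_forall fun η => ?_)
  · exact (hf.integrable_mul_lpSym hψ _).1.mul (SchwartzMap.continuous _).aestronglyMeasurable
  · rw [norm_mul, norm_mul, norm_mul]
    gcongr
    exact mul_le_of_le_one_right (norm_nonneg _) (hψ.norm_lpSym_le_one _ _)
  · refine tendsto_const_nhds.congr' ?_
    obtain ⟨N, hN⟩ := pow_unbounded_of_one_lt (2 * Real.pi * ‖η‖ / 2 ^ m) (one_lt_two (α := ℝ))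
    filter_upwards [Filter.eventually_ge_atTop N] with n hn
    rw [hψ.lpSym_eq_one, mul_one]
    rw [div_lt_iff₀ (by positivity)] at hN
    rw [zpow_add₀ two_ne_zero, zpow_natCast]
    refine hN.le.trans ?_
    gcongr
    norm_num

/-- The supports of the symbols shrink to the origin, a null set, and the transform is a function;
dominated convergence concludes. For a nonzero constant, whose transform is concentrated at 0, this
would fail. -/
lemma tendsto_lpProjLe_zero (hf : IsFourierTransform f w) (hψ : IsLPCutoff ψ) (x : E3) :
    Filter.Tendsto (fun n : ℕ => lpProjLe ψ (-n) f x) Filter.atTop (nhds 0) := by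
  have h : Filter.Tendsto (fun n : ℕ => ∫ η, w η * hψ.modS (-n) x η) Filter.atTop
      (nhds (∫ _ : E3, (0 : ℂ))) := by
    refine tendsto_integral_of_dominated_convergence (fun η => ‖w η * lpSym ψ 0 η‖)
      (fun n => (hf _).2.1.1) (hf.integrable_mul_lpSym hψ 0).norm
      (fun n => .of_forall fun η => ?_) ?_
    · rw [hψ.modS_apply, norm_mul, norm_mul, norm_mul, Complex.norm_exp_ofReal_mul_I, one_mul]
      gcongr
      exact hψ.norm_lpSym_mono (by omega) η
    · filter_upwards [Measure.ae_ne volume (0 : E3)] with η hη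
      refine tendsto_const_nhds.congr' ?_
      have hη' : 0 < ‖η‖ := norm_pos_iff.2 hη
      obtain ⟨N, hN⟩ := pow_unbounded_of_one_lt (2 / (2 * Real.pi * ‖η‖)) (one_lt_two (α := ℝ))
      filter_upwards [Filter.eventually_ge_atTop N] with n hn
      rw [hψ.modS_apply, hψ.lpSym_eq_zero, mul_zero, mul_zero]
      rw [div_lt_iff₀ (by positivity)] at hN
      rw [zpow_neg, zpow_natCast, ← div_eq_mul_inv, div_le_iff₀ (by positivity), mul_comm _ ((2 : ℝ) ^ n)]
      refine hN.le.trans ?_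
      gcongr
      norm_num
  rw [integral_zero] at h
  have h2 := (Complex.continuous_re.tendsto _).comp h
  rw [Complex.zero_re] at h2
  refine h2.congr fun n => ?_
  rw [Function.comp_apply, hψ.integral_mul_modS, ← hf.ofReal_lpProjLe hψ, Complex.ofReal_re]

lemma sum_lpProj (hf : IsFourierTransform f w) (hψ : IsLPCutoff ψ) (m : ℤ) (x : E3) (N : ℕ) :
    ∑ n ∈ Finset.range N, lpProj ψ (n + m) f x = lpProjLe ψ (N + (m - 1)) f x - lpProjLe ψ (m - 1) f x := by
  induction N with
  | zero => simp
  | succ N ih =>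
    rw [Finset.sum_range_succ, ih, hf.lpProj_eq_sub hψ]
    push_cast
    rw [show (N : ℤ) + m - 1 = N + (m - 1) by ring, show (N : ℤ) + 1 + (m - 1) = N + m by ring]
    ring

/-- The high frequencies are the sum of their Littlewood-Paley pieces. -/
lemma enorm_lpProjGe_le (hf : IsFourierTransform f w) (hψ : IsLPCutoff ψ) (m : ℤ)
    (hfin : ∀ l : ℕ, ∫⁻ x in dball l, ∑' n : ℕ, ‖lpProj ψ (n + m) f x‖ₑ ≠ ⊤) :
    ∀ᵐ x, ‖lpProjGe ψ m f x‖ₑ ≤ ∑' n : ℕ, ‖lpProj ψ (n + m) f x‖ₑ := by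
  set G : E3 → ℝ≥0∞ := fun x => ∑' n : ℕ, ‖lpProj ψ (n + m) f x‖ₑ
  have hGm : Measurable G := Measurable.tsum fun n => (hf.continuous_lpProj hψ _).measurable.enorm
  have hball : ∀ l : ℕ, ∀ᵐ x ∂volume.restrict (dball l), G x ≠ ⊤ := fun l =>
    (ae_lt_top hGm (hfin l)).mono fun x hx => hx.ne
  have hcover : ∀ x : E3, ∃ l : ℕ, x ∈ dball l := fun x => by
    obtain ⟨n, hn⟩ := pow_unbounded_of_one_lt ‖x‖ (one_lt_two (α := ℝ))
    exact ⟨n, by rw [dball, mem_closedBall_zero_iff, zpow_natCast]; exact hn.le⟩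
  have hGtop : ∀ᵐ x, G x ≠ ⊤ := by
    have h : ∀ᵐ x, ∀ l : ℕ, x ∈ dball l → G x ≠ ⊤ :=
      ae_all_iff.2 fun l => (ae_restrict_iff' (measurableSet_dball l)).1 (hball l)
    filter_upwards [h] with x hx
    obtain ⟨l, hl⟩ := hcover x
    exact hx l hl
  set S : E3 → ℝ := fun x => ∑' n : ℕ, lpProj ψ (n + m) f x
  have hSG : ∀ x, ‖S x‖ₑ ≤ G x := fun x => enorm_tsum_le_tsum_enorm
  have hlim : ∀ᵐ x, Filter.Tendsto (fun N : ℕ => ∑ n ∈ Finset.range N, lpProj ψ (n + m) f x) Filter.atTop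
      (nhds (S x)) := by
    filter_upwards [hGtop] with x hx
    have : Summable fun n : ℕ => lpProj ψ (n + m) f x := by
      refine Summable.of_enorm hx
    exact this.hasSum.tendsto_sum_nat
  have hSm : AEStronglyMeasurable S := by
    refine aestronglyMeasurable_of_tendsto_ae Filter.atTop (fun N => ?_) hlim
    exact (continuous_finsetSum _ fun n _ => hf.continuous_lpProj hψ _).aestronglyMeasurable
  have hGint : ∀ l : ℕ, IntegrableOn (fun x => (G x).toReal) (dball l) := fun l =>
    integrable_toReal_of_lintegral_ne_top hGm.aemeasurable (hfin l)
  have hSloc : LocallyIntegrable S := by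
    rw [locallyIntegrable_iff]
    intro k hk
    obtain ⟨R, hR⟩ := hk.isBounded.subset_closedBall (0 : E3)
    obtain ⟨n, hn⟩ := pow_unbounded_of_one_lt R (one_lt_two (α := ℝ))
    have hsub : k ⊆ dball n := hR.trans (Metric.closedBall_subset_closedBall (by
      rw [zpow_natCast]; exact hn.le))
    refine IntegrableOn.mono_set ?_ hsub
    refine (hGint n).mono' hSm.restrict ?_
    filter_upwards [hball n] with x hx
    have := ENNReal.toReal_mono hx (hSG x)
    rwa [toReal_enorm] at this
  have hge : LocallyIntegrable (lpProjGe ψ m f) :=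
    (hf.locallyIntegrable hψ).sub (hf.continuous_lpProjLe hψ (m - 1)).locallyIntegrable
  -- The partial sums telescope, so tested against g they converge to P_{≥m}f. They also converge to
  -- S by dominated convergence, with the locally integrable majorant G on the support of g. The two
  -- limits agree.
  have key : ∀ᵐ x, lpProjGe ψ m f x = S x := by
    refine ae_eq_of_integral_contDiff_smul_eq hge hSloc fun g hg hgc => ?_
    have hg' : ContDiff ℝ ∞ fun x => (g x : ℂ) := Complex.ofRealCLM.contDiff.comp hg
    have hgc' : HasCompactSupport fun x => (g x : ℂ) := hgc.comp_left Complex.ofReal_zero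
    set φ : 𝓢(E3, ℂ) := hgc'.toSchwartzMap hg'
    have hgi : ∀ h : E3 → ℝ, LocallyIntegrable h → Integrable fun x => g x * h x := fun h hh =>
      hh.integrable_smul_left_of_hasCompactSupport hg.continuous hgc
    have hple : ∀ k : ℤ, Integrable fun x => g x * lpProjLe ψ k f x := fun k =>
      hgi _ (hf.continuous_lpProjLe hψ k).locallyIntegrable
    have hofR : ∀ h : E3 → ℝ, ∫ x, (h x : ℂ) * φ x = ((∫ x, g x * h x : ℝ) : ℂ) := fun h => by
      rw [← integral_complex_ofReal]
      congr 1; ext x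
      have : φ x = g x := rfl
      rw [this]; push_cast; ring
    have t1 : Filter.Tendsto (fun n : ℕ => ∫ x, g x * lpProjLe ψ (n + (m - 1)) f x) Filter.atTop
        (nhds (∫ x, g x * f x)) := by
      have h := hf.tendsto_integral_lpProjLe hψ (m - 1) φ
      simp_rw [hofR] at h
      exact (Complex.continuous_re.tendsto _).comp h
    have t2 : Filter.Tendsto (fun N : ℕ => ∫ x, g x * ∑ n ∈ Finset.range N, lpProj ψ (n + m) f x) Filter.atTop
        (nhds (∫ x, g x * lpProjGe ψ m f x)) := by
      have e1 : ∀ N : ℕ, ∫ x, g x * ∑ n ∈ Finset.range N, lpProj ψ (n + m) f x =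
          (∫ x, g x * lpProjLe ψ (N + (m - 1)) f x) - ∫ x, g x * lpProjLe ψ (m - 1) f x := fun N => by
        rw [← integral_sub (hple _) (hple _)]
        congr 1; ext x
        rw [hf.sum_lpProj hψ]; ring
      have e2 : ∫ x, g x * lpProjGe ψ m f x =
          (∫ x, g x * f x) - ∫ x, g x * lpProjLe ψ (m - 1) f x := by
        rw [← integral_sub (hgi _ (hf.locallyIntegrable hψ)) (hple _)]
        congr 1; ext x
        rw [lpProjGe]; ring
      simp_rw [e1]
      rw [e2]
      exact t1.sub_const _
    have t3 : Filter.Tendsto (fun N : ℕ => ∫ x, g x * ∑ n ∈ Finset.range N, lpProj ψ (n + m) f x) Filter.atTop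
        (nhds (∫ x, g x * S x)) := by
      obtain ⟨R, hR⟩ := hgc.isCompact.isBounded.subset_closedBall (0 : E3)
      obtain ⟨l, hl⟩ := pow_unbounded_of_one_lt R (one_lt_two (α := ℝ))
      obtain ⟨B, hB⟩ := hgc.exists_bound_of_continuous hg.continuous
      refine tendsto_integral_of_dominated_convergence
        (fun x => B * (dball l).indicator (fun x => (G x).toReal) x) (fun N => ?_) ?_ (fun N => ?_) ?_
      · exact (hg.continuous.mul (continuous_finsetSum _ fun n _ =>
          hf.continuous_lpProj hψ _)).aestronglyMeasurable
      · exact ((hGint l).integrable_indicator (measurableSet_dball l)).const_mul B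
      · filter_upwards [hGtop] with x hx
        by_cases hxl : x ∈ dball l
        · rw [indicator_of_mem hxl, norm_mul]
          have h1 : ‖∑ n ∈ Finset.range N, lpProj ψ (n + m) f x‖ₑ ≤ G x :=
            (enorm_sum_le _ _).trans (ENNReal.sum_le_tsum _)
          have h2 := ENNReal.toReal_mono hx h1
          rw [toReal_enorm] at h2
          have := hB x
          gcongr
          exact (norm_nonneg _).trans this
        · have : g x = 0 := by
            by_contra h0
            refine hxl ?_
            rw [dball, zpow_natCast]
            exact Metric.closedBall_subset_closedBall hl.le (hR (subset_tsupport g h0))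
          rw [this, indicator_of_notMem hxl]; simp
      · filter_upwards [hlim] with x hx using hx.const_mul _
    simp only [smul_eq_mul]
    exact tendsto_nhds_unique t2 t3
  filter_upwards [key] with x hx
  rw [hx]; exact hSG x

/-- A function is bounded by the sum of its Littlewood-Paley pieces. -/
lemma enorm_le_tsum (hf : IsFourierTransform f w) (hψ : IsLPCutoff ψ)
    (hfin : ∀ l : ℕ, ∫⁻ x in dball l, ∑' n : ℕ, ‖lpProj ψ n f x‖ₑ ≠ ⊤) :
    ∀ᵐ x, ‖f x‖ₑ ≤ ∑' j : ℤ, ‖lpProj ψ j f x‖ₑ := by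
  have h := hf.enorm_lpProjGe_le hψ 0 (by simpa using hfin)
  filter_upwards [h] with x hx
  rw [tsum_of_nat_of_neg_add_one ENNReal.summable ENNReal.summable]
  -- The negative frequencies telescope to P_{≤-1}f minus a term that tends to zero pointwise.
  have h1 : ‖lpProjLe ψ (0 - 1) f x‖ₑ ≤ ∑' n : ℕ, ‖lpProj ψ (-(n + 1)) f x‖ₑ := by
    have hs : ∀ N : ℕ, ∑ n ∈ Finset.range N, lpProj ψ (-(n + 1)) f x =
        lpProjLe ψ (-1) f x - lpProjLe ψ (-((N + 1 : ℕ) : ℤ)) f x := fun N => by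
      induction N with
      | zero => simp
      | succ N ih =>
        rw [Finset.sum_range_succ, ih, hf.lpProj_eq_sub hψ]
        push_cast
        rw [show -((N : ℤ) + 1) - 1 = -(N + 1 + 1) by ring]
        ring
    have t : Filter.Tendsto (fun N : ℕ => ‖∑ n ∈ Finset.range N, lpProj ψ (-(n + 1)) f x‖ₑ) Filter.atTop
        (nhds ‖lpProjLe ψ (-1) f x - 0‖ₑ) := by
      simp_rw [hs]
      exact (tendsto_const_nhds.sub ((Filter.tendsto_add_atTop_iff_nat 1).2
        (hf.tendsto_lpProjLe_zero hψ x))).enorm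
    rw [sub_zero] at t
    refine le_of_tendsto t (.of_forall fun N => ?_)
    exact (enorm_sum_le _ _).trans (ENNReal.sum_le_tsum _)
  calc ‖f x‖ₑ = ‖lpProjGe ψ 0 f x + lpProjLe ψ (0 - 1) f x‖ₑ := by rw [lpProjGe, sub_add_cancel]
    _ ≤ _ := (enorm_add_le _ _).trans (add_le_add (by simpa using hx) h1)

end IsFourierTransform

/-! ### Radial Sobolev embeddings -/

lemma tsum_int_le_of_abs {a : ℝ} (ha : 0 < a) : ∃ C : ℝ≥0, ∀ k : ℤ,
    ∑' j : ℤ, (2 : ℝ≥0∞) ^ (-(a * |(j : ℝ) - k|)) ≤ C := by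
  obtain ⟨C, hC⟩ := tsum_two_rpow ha
  refine ⟨C + C, fun k => ?_⟩
  rw [← (Equiv.addRight k).tsum_eq, tsum_of_nat_of_neg_add_one ENNReal.summable ENNReal.summable]
  push_cast
  gcongr
  · rw [← hC]
    gcongr with n
    · norm_num
    · simp
  · rw [← hC]
    gcongr with n
    · norm_num
    · simp only [Equiv.coe_addRight]
      push_cast
      rw [add_sub_cancel_right, abs_neg, abs_of_nonneg (by positivity)]
      linarith

lemma IsLPCutoff.enorm_lpProjLe_radial_le {ψ : E3 → ℝ} (hψ : IsLPCutoff ψ) : ∃ C : ℝ≥0, ∀ h : E3 → ℝ,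
    AEMeasurable h → IsRadial h → ∀ (m : ℤ) (x : E3), ‖lpProjLe ψ m h x‖ₑ ≤
      C * (2 ^ ((m : ℝ) / 2) * weight m x) * (∫⁻ y, ‖h y‖ₑ ^ 2) ^ (1 / 2 : ℝ) := by
  obtain ⟨C₁, hC₁⟩ := hψ.lpKer_le
  obtain ⟨C₂, hC₂⟩ := lintegral_decayKernel_radial_sq
  refine ⟨C₁ * C₂, fun h hh hrad m x => ?_⟩
  refine (enorm_integral_kernel_le (hC₁ m) x).trans ?_
  push_cast
  rw [mul_assoc, mul_assoc, ← mul_assoc (C₂ : ℝ≥0∞)]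
  gcongr
  refine hC₂ _ hh.enorm (fun x y hxy => ?_) m 8 x (by norm_num)
  simp only [hrad x y hxy]

lemma IsLPCutoff.lpProj_radial {ψ : E3 → ℝ} (hψ : IsLPCutoff ψ) {f : E3 → ℝ} (hf : IsRadial f) (m : ℤ) :
    IsRadial (lpProj ψ m f) := integral_kernel_radial (hψ.lpKerD_radial m) hf

lemma weight_succ_le (m : ℤ) (x : E3) : weight (m + 1) x ≤ 2 * weight m x := by
  unfold weight
  rw [Int.cast_add, two_rpow_add, Int.cast_one, ENNReal.rpow_one, mul_comm (2 ^ (m : ℝ)) 2, mul_assoc]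
  refine mul_le_mul_right (mul_le_mul_right ?_ _) _
  rw [ENNReal.rpow_neg_one, ENNReal.rpow_neg_one]
  exact ENNReal.inv_le_inv.2 (bracket_mono (by omega) x)

/-- Frequency-localized radial Sobolev embedding. -/
lemma IsLPCutoff.enorm_lpProj_radial_le {ψ : E3 → ℝ} (hψ : IsLPCutoff ψ) : ∃ C : ℝ≥0,
    ∀ (f : E3 → ℝ) (w : E3 → ℂ), IsFourierTransform f w → IsRadial f → ∀ (m : ℤ) (x : E3),
    ‖lpProj ψ m f x‖ₑ ≤
      C * (2 ^ ((m : ℝ) / 2) * weight m x) * (∫⁻ y, ‖lpProj ψ m f y‖ₑ ^ 2) ^ (1 / 2 : ℝ) := by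
  obtain ⟨C, hC⟩ := hψ.enorm_lpProjLe_radial_le
  refine ⟨C * 4, fun f w hf hrad m x => ?_⟩
  -- Reproducing P_m f by P_{≤m+1} puts the L² norm of P_m f itself, instead of that of f, on the
  -- right-hand side.
  rw [← hf.lpProjLe_lpProj hψ]
  refine (hC _ (hf.continuous_lpProj hψ m).aemeasurable (hψ.lpProj_radial hrad m) (m + 1) x).trans ?_
  refine mul_le_mul_left ?_ _
  push_cast
  rw [mul_assoc (C : ℝ≥0∞)]
  refine mul_le_mul_right ?_ _
  calc (2 : ℝ≥0∞) ^ (((m : ℝ) + 1) / 2) * weight (m + 1) x ≤ (2 * 2 ^ ((m : ℝ) / 2)) * (2 * weight m x) := by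
        gcongr
        · calc (2 : ℝ≥0∞) ^ (((m : ℝ) + 1) / 2) ≤ 2 ^ (1 + (m : ℝ) / 2) := two_rpow_le (by linarith)
            _ = _ := by rw [two_rpow_add, ENNReal.rpow_one]
        · exact weight_succ_le m x
    _ = _ := by ring

lemma weight_le_two_rpow (m : ℤ) (x : E3) : weight m x ≤ 2 ^ (m : ℝ) :=
  mul_le_of_le_one_right' (bracket_rpow_le_one m x zero_le_one)

/-- The summand is about 2^(-j/2) min(2^j, 1/|x|). It peaks where 2^j is about 1/|x|, with value
|x|^(-1/2), and decays geometrically on both sides. -/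
lemma tsum_weight_le : ∃ C : ℝ≥0, ∀ x : E3, x ≠ 0 →
    ∑' j : ℤ, 2 ^ (-(j : ℝ) / 2) * weight j x ≤ C * ‖x‖ₑ ^ (-(1 / 2) : ℝ) := by
  obtain ⟨C, hC⟩ := tsum_int_le_of_abs (show (0 : ℝ) < 1 / 2 by norm_num)
  refine ⟨2 * C, fun x hx => ?_⟩
  set b := ‖x‖ₑ ^ (-1 : ℝ)
  have hb0 : b ≠ 0 := (ENNReal.rpow_pos (by simpa using hx) enorm_ne_top).ne'
  have hbt : b ≠ ⊤ := ENNReal.rpow_ne_top_of_ne_zero (by simpa using hx) enorm_ne_top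
  obtain ⟨k, hk1, hk2⟩ := ENNReal.exists_mem_Ico_zpow hb0 hbt (y := 2) (by norm_num) (by norm_num)
  rw [← ENNReal.rpow_intCast] at hk1 hk2
  have hsq : ‖x‖ₑ ^ (-(1 / 2) : ℝ) = b ^ (1 / 2 : ℝ) := by
    rw [← ENNReal.rpow_mul]; norm_num
  have hk3 : (2 : ℝ≥0∞) ^ ((k : ℝ) / 2) ≤ b ^ (1 / 2 : ℝ) := by
    have := ENNReal.rpow_le_rpow hk1 (show (0 : ℝ) ≤ 1 / 2 by norm_num)
    rwa [two_rpow_rpow, mul_one_div] at this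
  calc ∑' j : ℤ, 2 ^ (-(j : ℝ) / 2) * weight j x
      ≤ ∑' j : ℤ, 2 * 2 ^ ((k : ℝ) / 2) * 2 ^ (-((1 / 2) * |(j : ℝ) - k|)) := by
        refine ENNReal.tsum_le_tsum fun j => ?_
        rw [mul_assoc, ← two_rpow_add]
        rcases le_total (k : ℝ) j with h | h
        · rw [abs_of_nonneg (by linarith)]
          calc 2 ^ (-(j : ℝ) / 2) * weight j x ≤ 2 ^ (-(j : ℝ) / 2) * 2 ^ ((k + 1 : ℤ) : ℝ) := by
                gcongr; exact (weight_le_enorm j x).trans hk2.le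
            _ = 2 ^ (1 + ((k : ℝ) / 2 + -(1 / 2 * ((j : ℝ) - k)))) := by
                rw [← two_rpow_add]; congr 1; push_cast; ring
            _ = _ := by rw [two_rpow_add 1, ENNReal.rpow_one]
        · rw [abs_of_nonpos (by linarith)]
          calc 2 ^ (-(j : ℝ) / 2) * weight j x ≤ 2 ^ (-(j : ℝ) / 2) * 2 ^ (j : ℝ) := by
                gcongr; exact weight_le_two_rpow j x
            _ = 1 * 2 ^ ((k : ℝ) / 2 + -(1 / 2 * -((j : ℝ) - k))) := by
                rw [← two_rpow_add, one_mul]; congr 1; ring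
            _ ≤ _ := by gcongr; norm_num
    _ ≤ 2 * b ^ (1 / 2 : ℝ) * C := by
        rw [ENNReal.tsum_mul_left]; gcongr; exact hC k
    _ = _ := by rw [hsq]; push_cast; ring

/-- The radial Sobolev embedding of `Ḣ¹`. -/
lemma IsLPCutoff.radial_sobolev {ψ : E3 → ℝ} (hψ : IsLPCutoff ψ) : ∃ C : ℝ≥0, ∀ g : E3 → ℝ, IsRadial g →
    ∀ᵐ x, ‖g x‖ₑ * ‖x‖ₑ ^ (1 / 2 : ℝ) ≤ C * hDotNorm 1 g := by
  obtain ⟨C₁, hC₁⟩ := hψ.enorm_lpProj_radial_le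
  obtain ⟨C₂, hC₂⟩ := tsum_weight_le
  obtain ⟨C₃, hC₃⟩ := lintegral_dball_rpow (show (0 : ℝ) ≤ 1 / 2 by norm_num) (by norm_num)
  set C : ℝ≥0 := 4 * C₁ * C₂ + 1
  refine ⟨C, fun g hg => ?_⟩
  -- The homogeneous norm is an infimum over the possible Fourier transforms, infinite if there is
  -- none. Dividing by the nonzero constant reduces the bound to one fixed transform.
  suffices h : essSup (fun x => ‖g x‖ₑ * ‖x‖ₑ ^ (1 / 2 : ℝ)) volume / C ≤ hDotNorm 1 g by
    rw [ENNReal.div_le_iff_le_mul (Or.inl (by simp [C])) (Or.inl ENNReal.coe_ne_top), mul_comm] at h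
    filter_upwards [ENNReal.ae_le_essSup fun x => ‖g x‖ₑ * ‖x‖ₑ ^ (1 / 2 : ℝ)] with x hx using hx.trans h
  refine le_iInf₂ fun w hw => ?_
  rw [ENNReal.div_le_iff_le_mul (Or.inl (by simp [C])) (Or.inl ENNReal.coe_ne_top)]
  refine essSup_le_of_ae_le _ ?_
  set D := eLpNorm (fun η : E3 => ((2 * Real.pi * ‖η‖) ^ (1 : ℝ)) • w η) 2 volume
  have hD : ∫⁻ η, ‖((2 * Real.pi * ‖η‖) ^ (1 : ℝ)) • w η‖ₑ ^ 2 = D ^ 2 := by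
    simp only [D]
    rw [eLpNorm_eq_lintegral_rpow_enorm_toReal (by norm_num) (by norm_num)]
    simp only [ENNReal.toReal_ofNat, ENNReal.rpow_ofNat]
    exact (sq_sqrt _).symm
  rcases eq_or_ne D ⊤ with hDt | hDt
  · rw [hDt, ENNReal.top_mul (by simp [C])]
    exact .of_forall fun _ => le_top
  have hsum : ∀ x : E3, x ≠ 0 → ∑' j : ℤ, ‖lpProj ψ j g x‖ₑ ≤ 4 * C₁ * C₂ * D * ‖x‖ₑ ^ (-(1 / 2) : ℝ) := by
    intro x hx
    calc ∑' j : ℤ, ‖lpProj ψ j g x‖ₑ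
        ≤ ∑' j : ℤ, 4 * C₁ * D * (2 ^ (-(j : ℝ) / 2) * weight j x) := by
          refine ENNReal.tsum_le_tsum fun j => (hC₁ g w hw hg j x).trans ?_
          have h1 : (∫⁻ y, ‖lpProj ψ j g y‖ₑ ^ 2) ^ (1 / 2 : ℝ) ≤ 4 * 2 ^ (-(j : ℝ)) * D := by
            refine (ENNReal.rpow_le_rpow (hw.lintegral_lpProj_sq_le hψ j) (by norm_num)).trans
              (le_of_eq ?_)
            rw [hD, ← sqrt_sq (4 * 2 ^ (-(j : ℝ)) * D), mul_pow, mul_pow, two_rpow_sq]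
            norm_num
          refine (mul_le_mul_right h1 _).trans (le_of_eq ?_)
          rw [show -(j : ℝ) / 2 = (j : ℝ) / 2 + -j by ring, two_rpow_add]
          ring
      _ = 4 * C₁ * D * ∑' j : ℤ, (2 ^ (-(j : ℝ) / 2) * weight j x) := ENNReal.tsum_mul_left
      _ ≤ 4 * C₁ * D * (C₂ * ‖x‖ₑ ^ (-(1 / 2) : ℝ)) := by gcongr; exact hC₂ x hx
      _ = _ := by ring
  have hfin : ∀ l : ℕ, ∫⁻ x in dball l, ∑' n : ℕ, ‖lpProj ψ n g x‖ₑ ≠ ⊤ := fun l => by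
    refine ne_top_of_le_ne_top (b := 4 * C₁ * C₂ * D * (C₃ * 2 ^ ((3 - 1 / 2) * ((l : ℤ) : ℝ)))) ?_ ?_
    · have := two_rpow_ne_top ((3 - 1 / 2) * ((l : ℤ) : ℝ))
      finiteness
    calc ∫⁻ x in dball l, ∑' n : ℕ, ‖lpProj ψ n g x‖ₑ
        ≤ ∫⁻ x in dball l, 4 * C₁ * C₂ * D * ‖x‖ₑ ^ (-(1 / 2) : ℝ) := by
          refine lintegral_mono_ae ?_
          filter_upwards [ae_restrict_of_ae (Measure.ae_ne volume (0 : E3))] with x hx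
          refine le_trans ?_ (hsum x hx)
          exact ENNReal.tsum_comp_le_tsum_of_injective Nat.cast_injective fun j : ℤ => ‖lpProj ψ j g x‖ₑ
      _ = 4 * C₁ * C₂ * D * ∫⁻ x in dball l, ‖x‖ₑ ^ (-(1 / 2) : ℝ) := by
          rw [lintegral_const_mul]; fun_prop
      _ ≤ _ := by gcongr; exact hC₃ l
  filter_upwards [hw.enorm_le_tsum hψ hfin, Measure.ae_ne volume (0 : E3)] with x hx hx0
  calc ‖g x‖ₑ * ‖x‖ₑ ^ (1 / 2 : ℝ)
      ≤ 4 * C₁ * C₂ * D * ‖x‖ₑ ^ (-(1 / 2) : ℝ) * ‖x‖ₑ ^ (1 / 2 : ℝ) := by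
        gcongr; exact hx.trans (hsum x hx0)
    _ = 4 * C₁ * C₂ * D := by
        rw [mul_assoc, ← ENNReal.rpow_add _ _ (by simpa using hx0) enorm_ne_top]; simp
    _ ≤ D * C := by
        simp only [C]; push_cast
        rw [mul_comm D]; gcongr; exact le_self_add

/-! ### Space-time norms -/

section norms

variable {J : Set ℝ} {F : ℝ → E3 → ℝ} {A : Set E3}

lemma stNorm_two_sq (J : Set ℝ) (A : Set E3) (F : ℝ → E3 → ℝ) :
    stNorm 2 2 J A F ^ 2 = ∫⁻ t in J, ∫⁻ x in A, ‖F t x‖ₑ ^ 2 := by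
  unfold stNorm
  rw [eLpNorm_eq_lintegral_rpow_enorm_toReal (by norm_num) (by norm_num)]
  simp only [ENNReal.toReal_ofNat, ENNReal.rpow_ofNat, enorm_eq_self]
  rw [sq_sqrt]
  congr 1; ext t
  rw [eLpNorm_eq_lintegral_rpow_enorm_toReal (by norm_num) (by norm_num)]
  simp only [ENNReal.toReal_ofNat, ENNReal.rpow_ofNat]
  rw [sq_sqrt]

lemma stNorm_one (J : Set ℝ) (A : Set E3) (F : ℝ → E3 → ℝ) :
    stNorm 1 1 J A F = ∫⁻ t in J, ∫⁻ x in A, ‖F t x‖ₑ := by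
  unfold stNorm
  simp only [eLpNorm_one_eq_lintegral_enorm, enorm_eq_self]

lemma stNorm_one_two (J : Set ℝ) (A : Set E3) (F : ℝ → E3 → ℝ) :
    stNorm 1 2 J A F = ∫⁻ t in J, (∫⁻ x in A, ‖F t x‖ₑ ^ 2) ^ (1 / 2 : ℝ) := by
  unfold stNorm
  rw [eLpNorm_one_eq_lintegral_enorm]
  congr 1; ext t
  rw [eLpNorm_eq_lintegral_rpow_enorm_toReal (by norm_num) (by norm_num)]
  simp only [ENNReal.toReal_ofNat, ENNReal.rpow_ofNat, enorm_eq_self]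

lemma stNorm_rpow {p : ℝ} (hp : 0 < p) (J : Set ℝ) (A : Set E3) (F : ℝ → E3 → ℝ) :
    stNorm (ENNReal.ofReal p) (ENNReal.ofReal p) J A F ^ p = ∫⁻ t in J, ∫⁻ x in A, ‖F t x‖ₑ ^ p := by
  have h0 : ENNReal.ofReal p ≠ 0 := by simpa using hp
  unfold stNorm
  rw [eLpNorm_eq_lintegral_rpow_enorm_toReal h0 ENNReal.ofReal_ne_top]
  simp only [ENNReal.toReal_ofReal hp.le, enorm_eq_self]
  rw [← ENNReal.rpow_mul, one_div, inv_mul_cancel₀ hp.ne', ENNReal.rpow_one]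
  congr 1; ext t
  rw [eLpNorm_eq_lintegral_rpow_enorm_toReal h0 ENNReal.ofReal_ne_top]
  simp only [ENNReal.toReal_ofReal hp.le]
  rw [← ENNReal.rpow_mul, one_div, inv_mul_cancel₀ hp.ne', ENNReal.rpow_one]

lemma stNorm_two_top_sq (J : Set ℝ) (A : Set E3) (F : ℝ → E3 → ℝ) :
    stNorm 2 ⊤ J A F ^ 2 = ∫⁻ t in J, eLpNorm (F t) ⊤ (volume.restrict A) ^ 2 := by
  unfold stNorm
  rw [eLpNorm_eq_lintegral_rpow_enorm_toReal (by norm_num) (by norm_num)]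
  simp only [ENNReal.toReal_ofNat, ENNReal.rpow_ofNat, enorm_eq_self]
  rw [sq_sqrt]

lemma ae_le_stNorm_top (q : ℝ≥0∞) (J : Set ℝ) (A : Set E3) (F : ℝ → E3 → ℝ) :
    ∀ᵐ t ∂volume.restrict J, eLpNorm (F t) q (volume.restrict A) ≤ stNorm ⊤ q J A F := by
  unfold stNorm
  rw [eLpNorm_exponent_top]
  simpa using ae_le_eLpNormEssSup (μ := volume.restrict J)
    (f := fun t => eLpNorm (F t) q (volume.restrict A))

lemma ae_lintegral_sq_le_stNorm (J : Set ℝ) (F : ℝ → E3 → ℝ) :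
    ∀ᵐ t ∂volume.restrict J, (∫⁻ x, ‖F t x‖ₑ ^ 2) ^ (1 / 2 : ℝ) ≤ stNorm ⊤ 2 J univ F := by
  filter_upwards [ae_le_stNorm_top 2 J univ F] with t ht
  rw [Measure.restrict_univ, eLpNorm_eq_lintegral_rpow_enorm_toReal (by norm_num) (by norm_num)] at ht
  simpa using ht

lemma ae_ae_le_stNorm_top (J : Set ℝ) (F : ℝ → E3 → ℝ) :
    ∀ᵐ t ∂volume.restrict J, ∀ᵐ x, ‖F t x‖ₑ ≤ stNorm ⊤ ⊤ J univ F := by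
  filter_upwards [ae_le_stNorm_top ⊤ J univ F] with t ht
  rw [Measure.restrict_univ, eLpNorm_exponent_top] at ht
  filter_upwards [ae_le_eLpNormEssSup (f := F t) (μ := volume)] with x hx using hx.trans ht

lemma ae_le_supHDotNorm (σ : ℝ) (J : Set ℝ) (F : ℝ → E3 → ℝ) :
    ∀ᵐ t ∂volume.restrict J, hDotNorm σ (F t) ≤ supHDotNorm σ J F := by
  unfold supHDotNorm
  rw [eLpNorm_exponent_top]
  simpa using ae_le_eLpNormEssSup (μ := volume.restrict J) (f := fun t => hDotNorm σ (F t))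

lemma lintegral_dball_sq_le (J : Set ℝ) (F : ℝ → E3 → ℝ) {k l : ℤ} (h : -k ≤ l) :
    ∫⁻ t in J, ∫⁻ x in dball l, ‖F t x‖ₑ ^ 2 ≤ 2 ^ (l : ℝ) * localEnergyNorm k J F ^ 2 := by
  have h1 : (2 : ℝ≥0∞) ^ (-(l : ℝ) / 2) * stNorm 2 2 J (dball l) F ≤ localEnergyNorm k J F :=
    le_iSup₂_of_le l h le_rfl
  rw [← stNorm_two_sq]
  calc stNorm 2 2 J (dball l) F ^ 2
      = 2 ^ (l : ℝ) * (2 ^ (-(l : ℝ) / 2) * stNorm 2 2 J (dball l) F) ^ 2 := by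
        rw [mul_pow, two_rpow_sq, ← mul_assoc, ← two_rpow_add,
          show (l : ℝ) + 2 * (-l / 2) = 0 by ring, ENNReal.rpow_zero, one_mul]
    _ ≤ _ := by gcongr

lemma localEnergyNorm_mono {j k : ℤ} (h : j ≤ k) (J : Set ℝ) (F : ℝ → E3 → ℝ) :
    localEnergyNorm j J F ≤ localEnergyNorm k J F :=
  iSup₂_le fun l hl => le_iSup₂_of_le l (by omega) le_rfl

namespace MeasurableOnST

lemma ae (hF : MeasurableOnST J F) :
    ∀ᵐ t ∂volume.restrict J, AEMeasurable (F t) := by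
  have h := Measure.ae_ae_of_ae_prod hF.ae_eq_mk
  filter_upwards [h] with t ht
  exact ⟨fun x => hF.mk _ (t, x),
    (hF.stronglyMeasurable_mk.comp_measurable (by fun_prop)).measurable, ht⟩

lemma aemeasurable (hF : MeasurableOnST J F) :
    AEMeasurable (Function.uncurry F) ((volume.restrict J).prod volume) := AEStronglyMeasurable.aemeasurable hF

lemma mul {G : ℝ → E3 → ℝ} (hF : MeasurableOnST J F) (hG : MeasurableOnST J G) :
    MeasurableOnST J fun t x => F t x * G t x := AEStronglyMeasurable.mul hF hG

lemma integral_kernel {κ : E3 → ℝ} (hκ : Continuous κ) (hF : MeasurableOnST J F) :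
    MeasurableOnST J fun t x => ∫ y, κ (x - y) * F t y := by
  set F' := hF.mk (Function.uncurry F)
  have hF' : StronglyMeasurable F' := hF.stronglyMeasurable_mk
  have hm : StronglyMeasurable fun p : ℝ × E3 => ∫ y, κ (p.2 - y) * F' (p.1, y) := by
    refine StronglyMeasurable.integral_prod_right (f := fun (p : ℝ × E3) (y : E3) => κ (p.2 - y) * F' (p.1, y)) ?_
    refine StronglyMeasurable.mul (hκ.comp_stronglyMeasurable (by fun_prop)) ?_
    exact hF'.comp_measurable (g := fun q : (ℝ × E3) × E3 => (q.1.1, q.2)) (by fun_prop)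
  refine ⟨_, hm, ?_⟩
  have h := Measure.ae_ae_of_ae_prod hF.ae_eq_mk
  have h2 := (Measure.quasiMeasurePreserving_fst (μ := volume.restrict J) (ν := (volume : Measure E3))).ae h
  filter_upwards [h2] with p hp
  refine integral_congr_ae ?_
  filter_upwards [hp] with y hy
  simp only [F', ← hy, Function.uncurry]

lemma lpProj {ψ : E3 → ℝ} (hψ : IsLPCutoff ψ) (j : ℤ) (hF : MeasurableOnST J F) :
    MeasurableOnST J fun t => lpProj ψ j (F t) := hF.integral_kernel (hψ.continuous_lpKerD j)

lemma aemeasurable_lintegral (hF : MeasurableOnST J F) (A : Set E3) {w : E3 → ℝ≥0∞} (hw : Measurable w)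
    (p : ℝ) : AEMeasurable (fun t => ∫⁻ x in A, w x * ‖F t x‖ₑ ^ p) (volume.restrict J) := by
  refine AEMeasurable.lintegral_prod_right' (f := fun q : ℝ × E3 => w q.2 * ‖F q.1 q.2‖ₑ ^ p) ?_
  refine AEMeasurable.mul (by fun_prop) (AEMeasurable.pow_const (AEMeasurable.enorm ?_) _)
  exact hF.aemeasurable.mono_measure (Measure.prod_mono le_rfl Measure.restrict_le_self)

lemma aemeasurable_lintegral_sq (hF : MeasurableOnST J F) (A : Set E3) :
    AEMeasurable (fun t => ∫⁻ x in A, ‖F t x‖ₑ ^ 2) (volume.restrict J) := by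
  simpa using hF.aemeasurable_lintegral A (w := fun _ => 1) (by fun_prop) 2

/-- The essential supremum of a slice is at most a exactly when the slice of a superlevel set is
null, and the measure of slices is a measurable function. -/
lemma aemeasurable_eLpNorm_top (hF : MeasurableOnST J F) :
    AEMeasurable (fun t => eLpNorm (F t) ⊤ volume) (volume.restrict J) := by
  set F' := hF.mk (Function.uncurry F)
  have hF' : StronglyMeasurable F' := hF.stronglyMeasurable_mk
  refine ⟨fun t => eLpNorm (fun x => F' (t, x)) ⊤ volume, ?_, ?_⟩
  · refine measurable_of_Iic fun a => ?_
    have : (fun t => eLpNorm (fun x => F' (t, x)) ⊤ volume) ⁻¹' Iic a =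
        {t | volume (Prod.mk t ⁻¹' {p : ℝ × E3 | a < ‖F' p‖ₑ}) = 0} := by
      ext t
      simp only [mem_preimage, mem_Iic, mem_ofPred_eq, eLpNorm_exponent_top]
      refine ⟨fun h => ?_, fun h => essSup_le_of_ae_le _ ?_⟩
      · have := (ae_le_eLpNormEssSup (f := fun x => F' (t, x)) (μ := volume)).mono fun x hx => hx.trans h
        simpa [ae_iff] using this
      · simpa [Filter.EventuallyLE, ae_iff] using h
    rw [this]
    exact measurable_measure_prodMk_left (measurableSet_lt measurable_const hF'.enorm)
      (measurableSet_singleton 0)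
  · filter_upwards [Measure.ae_ae_of_ae_prod hF.ae_eq_mk] with t ht
    exact eLpNorm_congr_ae ht

end MeasurableOnST

/-- Space-time integration against a radially decreasing weight, by means of the local energy norm. -/
lemma lintegral_layers_sq_le (hF : MeasurableOnST J F) {φ : E3 → ℝ≥0∞} {c : ℕ → ℝ≥0∞} (j : ℤ)
    (h0 : ∀ x ∈ dball (-j), φ x ≤ c 0) (h1 : ∀ x, ∀ n : ℕ, x ∉ dball (n + -j) → φ x ≤ c (n + 1)) :
    ∫⁻ t in J, ∫⁻ x, φ x * ‖F t x‖ₑ ^ 2 ≤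
      (∑' n : ℕ, c n * 2 ^ ((n : ℝ) - j)) * localEnergyNorm j J F ^ 2 := by
  calc ∫⁻ t in J, ∫⁻ x, φ x * ‖F t x‖ₑ ^ 2
      ≤ ∫⁻ t in J, ∑' n : ℕ, c n * ∫⁻ x in dball (n + -j), ‖F t x‖ₑ ^ 2 := by
        refine lintegral_mono_ae ?_
        filter_upwards [hF.ae] with t ht
        simpa [dball] using lintegral_layers (-j) 0 (φ := φ) (G := fun x => ‖F t x‖ₑ ^ 2) (c := c)
          (ht.enorm.pow_const 2) h0 h1
    _ = ∑' n : ℕ, c n * ∫⁻ t in J, ∫⁻ x in dball (n + -j), ‖F t x‖ₑ ^ 2 := by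
        rw [lintegral_tsum fun n => (hF.aemeasurable_lintegral_sq _).const_mul _]
        congr 1; ext n
        rw [lintegral_const_mul'' _ (hF.aemeasurable_lintegral_sq _)]
    _ ≤ ∑' n : ℕ, c n * 2 ^ ((n : ℝ) - j) * localEnergyNorm j J F ^ 2 := by
        refine ENNReal.tsum_le_tsum fun n => ?_
        rw [mul_assoc]
        gcongr
        refine (lintegral_dball_sq_le J F (k := j) (by omega)).trans (le_of_eq ?_)
        push_cast; rw [sub_eq_add_neg]
    _ = _ := ENNReal.tsum_mul_right

/-- The first K + 1 terms are at most 1 each and the rest is geometric; this count of shells is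
where the logarithm arises. -/
lemma tsum_min_le : ∃ C : ℝ≥0, ∀ K : ℕ,
    ∑' n : ℕ, min 1 ((2 : ℝ≥0∞) ^ ((K : ℝ) + 1 - n)) ≤ C * ENNReal.ofReal (max 1 (K : ℝ)) := by
  obtain ⟨C, hC⟩ := tsum_two_rpow zero_lt_one
  refine ⟨2 + C, fun K => ?_⟩
  rw [← Summable.sum_add_tsum_nat_add' (k := K + 1) ENNReal.summable]
  have h1 : (1 : ℝ≥0∞) ≤ ENNReal.ofReal (max 1 (K : ℝ)) := by simp
  push_cast
  rw [add_mul]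
  gcongr
  · calc ∑ n ∈ Finset.range (K + 1), min 1 ((2 : ℝ≥0∞) ^ ((K : ℝ) + 1 - n))
        ≤ ∑ n ∈ Finset.range (K + 1), 1 := Finset.sum_le_sum fun _ _ => min_le_left _ _
      _ = ENNReal.ofReal K + 1 := by simp
      _ ≤ ENNReal.ofReal (max 1 (K : ℝ)) + ENNReal.ofReal (max 1 (K : ℝ)) := by
        gcongr; exact le_max_right _ _
      _ = _ := (two_mul _).symm
  · refine le_trans ?_ (le_mul_of_one_le_right' h1)
    rw [← hC]
    gcongr with n
    refine (min_le_right _ _).trans (two_rpow_le ?_)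
    linarith

/-- The local energy norm controls the weighted norm up to a logarithm. -/
lemma lintegral_weight_sq_le : ∃ C : ℝ≥0, ∀ (k : ℤ) (J : Set ℝ) (F : ℝ → E3 → ℝ), MeasurableOnST J F →
    ∫⁻ t in J, ∫⁻ x, weight k x * bracket 0 x ^ (-1 : ℝ) * ‖F t x‖ₑ ^ 2 ≤
      C * ENNReal.ofReal (max 1 (k : ℝ)) * localEnergyNorm k J F ^ 2 := by
  obtain ⟨C, hC⟩ := tsum_min_le
  refine ⟨2 * C, fun k J F hF => ?_⟩
  refine (lintegral_layers_sq_le hF k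
    -- The two factors bound the weight and the decay of (1 + |x|)^(-1) between radii 2^(n-1-k) and
    -- 2^(n-k). Multiplied by the mass factor 2^(n-k) of the ball they give 2 min(1, 2^(k+1-n)) for
    -- k ≥ 0. The truncation `k.toNat` also covers negative k.
    (c := fun n => 2 ^ ((k : ℝ) + 1 - n) * min 1 (2 ^ ((k.toNat : ℝ) + 1 - n))) ?_ ?_).trans ?_
  · intro x _
    refine mul_le_mul' ((weight_le_two_rpow k x).trans (two_rpow_le (by simp))) ?_
    refine (bracket_rpow_le_one 0 x zero_le_one).trans (le_min le_rfl ?_)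
    calc (1 : ℝ≥0∞) = 2 ^ (0 : ℝ) := by simp
      _ ≤ _ := two_rpow_le (by simp; positivity)
  · intro x n hx
    have hx' : ‖x‖ₑ ^ (-1 : ℝ) ≤ 2 ^ ((k : ℝ) - n) := by
      rw [mem_dball, not_le] at hx
      calc ‖x‖ₑ ^ (-1 : ℝ) ≤ ((2 : ℝ≥0∞) ^ (((n : ℤ) + -k : ℤ) : ℝ)) ^ (-1 : ℝ) := by
            rw [ENNReal.rpow_neg_one, ENNReal.rpow_neg_one]
            exact ENNReal.inv_le_inv.2 hx.le
        _ = _ := by rw [two_rpow_rpow]; congr 1; push_cast; ring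
    refine mul_le_mul' ((weight_le_enorm k x).trans (hx'.trans (two_rpow_le ?_))) (le_min ?_ ?_)
    · push_cast; linarith
    · exact bracket_rpow_le_one 0 x zero_le_one
    · have h0 : bracket 0 x ^ (-1 : ℝ) ≤ ‖x‖ₑ ^ (-1 : ℝ) := by
        simpa [weight] using weight_le_enorm 0 x
      refine h0.trans (hx'.trans (two_rpow_le ?_))
      have : (k : ℝ) ≤ k.toNat := by exact_mod_cast Int.self_le_toNat k
      push_cast; linarith
  · gcongr
    calc ∑' n : ℕ, 2 ^ ((k : ℝ) + 1 - n) * min 1 ((2 : ℝ≥0∞) ^ ((k.toNat : ℝ) + 1 - n)) * 2 ^ ((n : ℝ) - k)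
        = ∑' n : ℕ, 2 * min 1 ((2 : ℝ≥0∞) ^ ((k.toNat : ℝ) + 1 - n)) := by
          congr 1; ext n
          rw [mul_right_comm, ← two_rpow_add]
          congr 1
          rw [show (k : ℝ) + 1 - n + (n - k) = 1 by ring, ENNReal.rpow_one]
      _ = 2 * ∑' n : ℕ, min 1 ((2 : ℝ≥0∞) ^ ((k.toNat : ℝ) + 1 - n)) := ENNReal.tsum_mul_left
      _ ≤ 2 * (C * ENNReal.ofReal (max 1 (k.toNat : ℝ))) := by gcongr; exact hC _
      _ ≤ _ := by
          push_cast
          rw [mul_assoc]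
          gcongr 2 * (_ * ENNReal.ofReal ?_)
          refine max_le (le_max_left _ _) ?_
          rcases le_total 0 k with h | h
          · refine le_max_of_le_right (le_of_eq ?_)
            exact_mod_cast Int.toNat_of_nonneg h
          · simp [Int.toNat_of_nonpos h]

lemma lintegral_dball_singular_sq_le {a : ℝ} (ha0 : 0 ≤ a) (ha : a < 3) : ∃ C : ℝ≥0, ∀ (j : ℤ) (J : Set ℝ)
    (F : ℝ → E3 → ℝ), ∫⁻ t in J, ∫⁻ x in dball (-j), ‖x‖ₑ ^ (-a) * ‖F t x‖ₑ ^ 2 ≤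
      C * 2 ^ ((j : ℝ) * (a - 3)) * stNorm 2 ⊤ J univ F ^ 2 := by
  obtain ⟨C, hC⟩ := lintegral_dball_rpow ha0 ha
  refine ⟨C, fun j J F => ?_⟩
  rw [stNorm_two_top_sq, Measure.restrict_univ, ← lintegral_const_mul' _ _
    (ENNReal.mul_ne_top ENNReal.coe_ne_top (two_rpow_ne_top _))]
  refine lintegral_mono fun t => ?_
  calc ∫⁻ x in dball (-j), ‖x‖ₑ ^ (-a) * ‖F t x‖ₑ ^ 2
      ≤ ∫⁻ x in dball (-j), ‖x‖ₑ ^ (-a) * eLpNorm (F t) ⊤ volume ^ 2 := by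
        refine lintegral_mono_ae (ae_restrict_of_ae ?_)
        filter_upwards [ae_le_eLpNormEssSup (f := F t) (μ := volume)] with x hx
        rw [eLpNorm_exponent_top]
        gcongr
    _ = (∫⁻ x in dball (-j), ‖x‖ₑ ^ (-a)) * eLpNorm (F t) ⊤ volume ^ 2 := by
        rw [lintegral_mul_const]; fun_prop
    _ ≤ _ := by
        gcongr
        refine (hC (-j)).trans (le_of_eq ?_)
        congr 2; push_cast; ring

/-- Inside radius 2^(-j) the L²_t L^∞_x norm is used and the weight is integrable because a < 3.
Outside, shells are summed with the local energy norm, which converges because a > 1. -/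
lemma lintegral_singular_sq_le {a : ℝ} (ha1 : 1 < a) (ha : a < 3) : ∃ C : ℝ≥0, ∀ (j : ℤ) (J : Set ℝ)
    (F : ℝ → E3 → ℝ), MeasurableOnST J F → ∫⁻ t in J, ∫⁻ x, ‖x‖ₑ ^ (-a) * ‖F t x‖ₑ ^ 2 ≤
      C * (2 ^ ((j : ℝ) * (a - 3)) * stNorm 2 ⊤ J univ F ^ 2 +
        2 ^ ((j : ℝ) * (a - 1)) * localEnergyNorm j J F ^ 2) := by
  obtain ⟨C₁, hC₁⟩ := lintegral_dball_singular_sq_le (show 0 ≤ a by linarith) ha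
  obtain ⟨C₂, hC₂⟩ := tsum_two_rpow (show 0 < a - 1 by linarith)
  refine ⟨C₁ + 2 ^ a * C₂, fun j J F hF => ?_⟩
  have hsplit : ∀ t, ∫⁻ x, ‖x‖ₑ ^ (-a) * ‖F t x‖ₑ ^ 2 = (∫⁻ x in dball (-j), ‖x‖ₑ ^ (-a) * ‖F t x‖ₑ ^ 2) +
      ∫⁻ x, (dball (-j))ᶜ.indicator (fun x => ‖x‖ₑ ^ (-a)) x * ‖F t x‖ₑ ^ 2 := fun t => by
    rw [← lintegral_add_compl _ (measurableSet_dball (-j))]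
    congr 1
    rw [← lintegral_indicator (measurableSet_dball _).compl]
    congr 1; ext x
    by_cases hx : x ∈ (dball (-j))ᶜ
    · rw [indicator_of_mem hx, indicator_of_mem hx]
    · rw [indicator_of_notMem hx, indicator_of_notMem hx, zero_mul]
  simp_rw [hsplit]
  have hm : AEMeasurable (fun t => ∫⁻ x in dball (-j), ‖x‖ₑ ^ (-a) * ‖F t x‖ₑ ^ 2) (volume.restrict J) := by
    simpa using hF.aemeasurable_lintegral (dball (-j)) (w := fun x => ‖x‖ₑ ^ (-a)) (by fun_prop) 2
  rw [lintegral_add_left' hm, mul_add]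
  refine add_le_add ((hC₁ j J F).trans ?_) ?_
  · rw [mul_assoc]; gcongr; exact_mod_cast le_self_add
  refine (lintegral_layers_sq_le hF j (c := fun n => 2 ^ (a * ((j : ℝ) + 1 - n))) ?_ ?_).trans ?_
  · intro x hx
    rw [indicator_of_notMem (by simpa using hx)]; exact zero_le
  · intro x n hx
    refine (indicator_le_self _ _ x).trans ?_
    rw [mem_dball, not_le] at hx
    calc ‖x‖ₑ ^ (-a) ≤ ((2 : ℝ≥0∞) ^ (((n : ℤ) + -j : ℤ) : ℝ)) ^ (-a) := by
          rw [ENNReal.rpow_neg, ENNReal.rpow_neg]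
          exact ENNReal.inv_le_inv.2 (ENNReal.rpow_le_rpow hx.le (by linarith))
      _ = _ := by rw [two_rpow_rpow]; congr 1; push_cast; ring
  · rw [← mul_assoc]
    gcongr
    calc ∑' n : ℕ, 2 ^ (a * ((j : ℝ) + 1 - n)) * 2 ^ ((n : ℝ) - j)
        = ∑' n : ℕ, 2 ^ a * 2 ^ ((j : ℝ) * (a - 1)) * (2 : ℝ≥0∞) ^ (-((a - 1) * n)) := by
          congr 1; ext n
          rw [← two_rpow_add, ← two_rpow_add, ← two_rpow_add]; congr 1; ring
      _ = 2 ^ a * 2 ^ ((j : ℝ) * (a - 1)) * C₂ := by rw [ENNReal.tsum_mul_left, hC₂]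
      _ = 2 ^ a * C₂ * 2 ^ ((j : ℝ) * (a - 1)) := by ring
      _ ≤ _ := by
          gcongr
          rw [ENNReal.coe_add, ENNReal.coe_mul, ENNReal.coe_rpow_of_ne_zero (by norm_num)]
          exact le_add_self

end norms

/-- The parts of the Strichartz norm that are used. -/
lemma stNorm_le_strichartzS (ψ : E3 → ℝ) (J : Set ℝ) (j : ℤ) (f : ℝ → E3 → ℝ) :
    stNorm 2 ⊤ J univ (fun t => lpProj ψ j (f t)) ≤ strichartzS ψ J j f := by
  unfold strichartzS
  exact le_self_add.trans (le_self_add.trans (le_self_add.trans le_self_add))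

lemma localEnergyNorm_le_strichartzS (ψ : E3 → ℝ) (J : Set ℝ) (j : ℤ) (f : ℝ → E3 → ℝ) :
    2 ^ (j : ℝ) * localEnergyNorm j J (fun t => lpProj ψ j (f t)) ≤ strichartzS ψ J j f := by
  unfold strichartzS; exact le_add_self

lemma energy_le_strichartzS (ψ : E3 → ℝ) (J : Set ℝ) (j : ℤ) (f : ℝ → E3 → ℝ) :
    2 ^ (j : ℝ) * stNorm ⊤ 2 J univ (fun t => lpProj ψ j (f t)) ≤ strichartzS ψ J j f := by
  unfold strichartzS
  exact le_add_self.trans (le_self_add.trans le_self_add)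

lemma localEnergyNorm_sq_le_strichartzS (ψ : E3 → ℝ) (J : Set ℝ) (j : ℤ) (f : ℝ → E3 → ℝ) :
    localEnergyNorm j J (fun t => lpProj ψ j (f t)) ^ 2 ≤ 2 ^ (-2 * (j : ℝ)) * strichartzS ψ J j f ^ 2 := by
  calc localEnergyNorm j J (fun t => lpProj ψ j (f t)) ^ 2
      = 2 ^ (-2 * (j : ℝ)) * (2 ^ (j : ℝ) * localEnergyNorm j J (fun t => lpProj ψ j (f t))) ^ 2 := by
        rw [mul_pow, two_rpow_sq, ← mul_assoc, ← two_rpow_add]; simp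
    _ ≤ _ := by gcongr; exact localEnergyNorm_le_strichartzS ψ J j f

/-- Both parts of the Strichartz norm scale alike here: the local energy part carries 2^(-2j), and
2^(j(a-1)) 2^(-2j) = 2^(j(a-3)). -/
lemma lintegral_singular_lpProj_sq_le {ψ : E3 → ℝ} (hψ : IsLPCutoff ψ) {a : ℝ} (ha1 : 1 < a) (ha : a < 3) :
    ∃ C : ℝ≥0, ∀ (j : ℤ) (J : Set ℝ) (f : ℝ → E3 → ℝ), MeasurableOnST J f →
    ∫⁻ t in J, ∫⁻ x, ‖x‖ₑ ^ (-a) * ‖lpProj ψ j (f t) x‖ₑ ^ 2 ≤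
      C * 2 ^ ((j : ℝ) * (a - 3)) * strichartzS ψ J j f ^ 2 := by
  obtain ⟨C, hC⟩ := lintegral_singular_sq_le ha1 ha
  refine ⟨C * 2, fun j J f hf => (hC j J _ (hf.lpProj hψ j)).trans ?_⟩
  push_cast
  rw [mul_assoc, mul_assoc, two_mul, mul_add, mul_add]
  refine add_le_add ?_ (mul_le_mul_right ?_ _)
  · gcongr; exact stNorm_le_strichartzS ψ J j f
  · calc _ ≤ 2 ^ ((j : ℝ) * (a - 1)) * (2 ^ (-2 * (j : ℝ)) * strichartzS ψ J j f ^ 2) := by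
          gcongr; exact localEnergyNorm_sq_le_strichartzS ψ J j f
      _ = _ := by rw [← mul_assoc, ← two_rpow_add]; congr 2; ring

/-- A bound by two power weights implies a bound by `weight`. -/
lemma sq_le_weight (k : ℤ) {x : E3} {a D : ℝ≥0∞} (h1 : 2 ^ (-(k : ℝ) / 2) * a ≤ D)
    (h2 : a * ‖x‖ₑ ^ (1 / 2 : ℝ) ≤ D) : a ^ 2 ≤ 2 * D ^ 2 * weight k x := by
  have h3 : a ^ 2 * (2 ^ (-(k : ℝ)) * bracket k x) ≤ 2 * D ^ 2 := by
    calc a ^ 2 * (2 ^ (-(k : ℝ)) * bracket k x)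
        = (2 ^ (-(k : ℝ) / 2) * a) ^ 2 + (a * ‖x‖ₑ ^ (1 / 2 : ℝ)) ^ 2 := by
          rw [bracket, mul_add, ← mul_assoc, ← two_rpow_add, mul_pow, mul_pow, two_rpow_sq, sq_sqrt,
            neg_add_cancel, ENNReal.rpow_zero, one_mul, mul_one, mul_add, mul_comm,
            show 2 * (-(k : ℝ) / 2) = -k by ring]
      _ ≤ D ^ 2 + D ^ 2 := by gcongr
      _ = _ := (two_mul _).symm
  calc a ^ 2 = a ^ 2 * (2 ^ (-(k : ℝ)) * bracket k x) * weight k x := by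
        rw [weight, mul_assoc, mul_mul_mul_comm, ← two_rpow_add, ENNReal.rpow_neg_one,
          ENNReal.mul_inv_cancel (bracket_ne_zero k x) (bracket_ne_top k x)]
        simp
    _ ≤ _ := by gcongr

/-! ### Trilinear and bilinear estimates -/

lemma enorm_norm_rpow (x : E3) {p : ℝ} (hp : 0 ≤ p) : ‖‖x‖ ^ p‖ₑ = ‖x‖ₑ ^ p := by
  rw [Real.enorm_rpow_of_nonneg (norm_nonneg x) hp, enorm_norm]

/-- One power of decay of M is all that is needed: it makes the dyadic shells beyond radius 1
summable. -/
lemma enorm_le_bracket {c : ℝ} (hc : 0 < c) (K : ℝ) : ∃ C : ℝ≥0, ∀ M : E3 → ℝ,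
    (∀ x, |M x| ≤ K * Real.exp (-c * ‖x‖)) → ∀ x, ‖M x‖ₑ ≤ C * bracket 0 x ^ (-1 : ℝ) := by
  refine ⟨(|K| * (1 + 1 / c)).toNNReal, fun M hM x => ?_⟩
  rw [ENNReal.rpow_neg_one, ← div_eq_mul_inv,
    ENNReal.le_div_iff_mul_le (Or.inl (bracket_ne_zero 0 x)) (Or.inl (bracket_ne_top 0 x))]
  have hb : bracket 0 x = ENNReal.ofReal (1 + ‖x‖) := by
    rw [bracket, ENNReal.ofReal_add zero_le_one (norm_nonneg x)]; simp
  rw [hb, ← ofReal_norm, ← ENNReal.ofReal_mul (norm_nonneg _)]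
  refine ENNReal.ofReal_le_ofReal ?_
  have h1 : 1 + c * ‖x‖ ≤ Real.exp (c * ‖x‖) := by linarith [Real.add_one_le_exp (c * ‖x‖)]
  have h2 : Real.exp (-c * ‖x‖) * Real.exp (c * ‖x‖) = 1 := by rw [← Real.exp_add]; simp
  have h3 : 1 + ‖x‖ ≤ (1 + 1 / c) * (1 + c * ‖x‖) := by
    have : (1 + 1 / c) * (1 + c * ‖x‖) = 1 + ‖x‖ + (c * ‖x‖ + 1 / c) := by field_simp; ring
    rw [this]; linarith [show 0 ≤ c * ‖x‖ + 1 / c by positivity]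
  calc ‖M x‖ * (1 + ‖x‖) ≤ (|K| * Real.exp (-c * ‖x‖)) * ((1 + 1 / c) * Real.exp (c * ‖x‖)) := by
        gcongr
        · exact (hM x).trans (by gcongr; exact le_abs_self K)
        · exact h3.trans (by gcongr)
    _ = |K| * (1 + 1 / c) * (Real.exp (-c * ‖x‖) * Real.exp (c * ‖x‖)) := by ring
    _ = _ := by rw [h2, mul_one]

/-- The weight that `lintegral_weight_sq_le` controls. -/
def energyWeight (k : ℤ) (x : E3) : ℝ≥0∞ := weight k x * bracket 0 x ^ (-1 : ℝ)

@[fun_prop]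
lemma measurable_energyWeight (k : ℤ) : Measurable (energyWeight k) := by unfold energyWeight; fun_prop

lemma lintegral_lintegral_mul_le {J : Set ℝ} {f g : ℝ → E3 → ℝ} (hf : MeasurableOnST J f)
    (hg : MeasurableOnST J g) {W : E3 → ℝ≥0∞} (hW : Measurable W) :
    ∫⁻ t in J, ∫⁻ x, W x * (‖f t x‖ₑ * ‖g t x‖ₑ) ≤
      (∫⁻ t in J, ∫⁻ x, W x * ‖f t x‖ₑ ^ 2) ^ (1 / 2 : ℝ) *
        (∫⁻ t in J, ∫⁻ x, W x * ‖g t x‖ₑ ^ 2) ^ (1 / 2 : ℝ) := by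
  have hf' := hf.aemeasurable.enorm
  have hg' := hg.aemeasurable.enorm
  have hW' : AEMeasurable (fun p : ℝ × E3 => W p.2) ((volume.restrict J).prod volume) := by fun_prop
  have e1 := lintegral_prod (fun p : ℝ × E3 => W p.2 * (‖f p.1 p.2‖ₑ * ‖g p.1 p.2‖ₑ))
    (hW'.mul (hf'.mul hg'))
  have e2 := lintegral_prod (fun p : ℝ × E3 => W p.2 * ‖f p.1 p.2‖ₑ ^ 2) (hW'.mul (hf'.pow_const 2))
  have e3 := lintegral_prod (fun p : ℝ × E3 => W p.2 * ‖g p.1 p.2‖ₑ ^ 2) (hW'.mul (hg'.pow_const 2))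
  simp only at e1 e2 e3
  rw [← e1, ← e2, ← e3, ← ENNReal.mul_rpow_of_nonneg _ _ (by norm_num)]
  exact le_sqrt_of_sq_le (sq_lintegral_weighted_le (k := fun p : ℝ × E3 => W p.2)
    (k₁ := fun p : ℝ × E3 => W p.2) (k₂ := fun p : ℝ × E3 => W p.2) (fun p => (sq _).le) hW' hW' hf' hg')

lemma ofReal_max_one {k : ℤ} (hk : 1 ≤ k) : ENNReal.ofReal (max 1 (k : ℝ)) = ENNReal.ofReal |(k : ℝ)| := by
  have : (1 : ℝ) ≤ k := by exact_mod_cast hk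
  rw [max_eq_right this, abs_of_nonneg (by linarith)]

lemma one_le_ofReal_abs {k : ℤ} (hk : 1 ≤ k) : 1 ≤ ENNReal.ofReal |(k : ℝ)| := by
  rw [← ofReal_max_one hk]; simp

/-- Bilinear form of `lintegral_weight_sq_le`. -/
lemma lintegral_weight_mul_le : ∃ C : ℝ≥0, ∀ (k : ℤ) (J : Set ℝ) (f g : ℝ → E3 → ℝ), 1 ≤ k →
    MeasurableOnST J f → MeasurableOnST J g →
    ∫⁻ t in J, ∫⁻ x, energyWeight k x * (‖f t x‖ₑ * ‖g t x‖ₑ) ≤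
      C * (ENNReal.ofReal |(k : ℝ)| * localEnergyNorm k J f * localEnergyNorm k J g) := by
  obtain ⟨C, hC⟩ := lintegral_weight_sq_le
  refine ⟨C, fun k J f g hk hf hg => (lintegral_lintegral_mul_le hf hg (by fun_prop)).trans ?_⟩
  refine (mul_le_mul' (ENNReal.rpow_le_rpow (hC k J f hf) (by norm_num))
    (ENNReal.rpow_le_rpow (hC k J g hg) (by norm_num))).trans (le_of_eq ?_)
  rw [ofReal_max_one hk, ← ENNReal.mul_rpow_of_nonneg _ _ (by norm_num),
    ← sqrt_sq (C * (ENNReal.ofReal |(k : ℝ)| * localEnergyNorm k J f * localEnergyNorm k J g))]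
  congr 1; ring

/-- The positive majorant of `opI`. -/
def smoothMajorant (δ : ℝ) (k : ℤ) (F : E3 → ℝ) (x : E3) : ℝ≥0∞ :=
  ∫⁻ y, smoothingKernel δ k (x - y) * ‖F y‖ₑ

lemma MeasurableOnST.of_space {M : E3 → ℝ} (hM : AEStronglyMeasurable M volume) (J : Set ℝ) :
    MeasurableOnST J fun _ => M := hM.comp_snd

lemma MeasurableOnST.aemeasurable_smoothMajorant {J : Set ℝ} {F : ℝ → E3 → ℝ} (hF : MeasurableOnST J F)
    (δ : ℝ) (k : ℤ) : AEMeasurable (fun p : ℝ × E3 => smoothMajorant δ k (F p.1) p.2)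
      ((volume.restrict J).prod volume) := by
  set F' := hF.mk (Function.uncurry F)
  have hF' : StronglyMeasurable F' := hF.stronglyMeasurable_mk
  have hm : Measurable fun p : ℝ × E3 => ∫⁻ y, smoothingKernel δ k (p.2 - y) * ‖F' (p.1, y)‖ₑ := by
    refine Measurable.lintegral_prod_right'
      (f := fun q : (ℝ × E3) × E3 => smoothingKernel δ k (q.1.2 - q.2) * ‖F' (q.1.1, q.2)‖ₑ) ?_
    refine Measurable.mul ((measurable_smoothingKernel δ k).comp (by fun_prop)) ?_
    exact (hF'.measurable.comp (by fun_prop)).enorm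
  refine ⟨_, hm, ?_⟩
  have h := Measure.ae_ae_of_ae_prod hF.ae_eq_mk
  have h2 := (Measure.quasiMeasurePreserving_fst (μ := volume.restrict J) (ν := (volume : Measure E3))).ae h
  filter_upwards [h2] with p hp
  refine lintegral_congr_ae ?_
  filter_upwards [hp] with y hy
  simp only [F', ← hy, Function.uncurry]

/-- The smoothing majorant does not see the weight. -/
lemma lintegral_smoothMajorant_mul_weight_le {δ : ℝ} (hδ : 0 < δ) : ∃ C : ℝ≥0, ∀ (k : ℤ) (F : E3 → ℝ),
    AEMeasurable F → ∫⁻ x, smoothMajorant δ k F x * weight k x ≤ C * ∫⁻ x, ‖F x‖ₑ * weight k x := by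
  obtain ⟨C, hC⟩ := lintegral_smoothingKernel_weight hδ
  refine ⟨C, fun k F hF => ?_⟩
  have hw : ∀ x : E3, weight k x ≠ ⊤ := fun x => ENNReal.mul_ne_top (two_rpow_ne_top _)
    (ENNReal.rpow_ne_top_of_ne_zero (bracket_ne_zero k x) (bracket_ne_top k x))
  calc ∫⁻ x, smoothMajorant δ k F x * weight k x
      = ∫⁻ x, ∫⁻ y, smoothingKernel δ k (x - y) * ‖F y‖ₑ * weight k x := by
        congr 1; ext x
        rw [smoothMajorant, lintegral_mul_const' _ _ (hw x)]
    _ = ∫⁻ y, ∫⁻ x, smoothingKernel δ k (x - y) * ‖F y‖ₑ * weight k x := by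
        rw [lintegral_lintegral_swap]
        refine AEMeasurable.mul (AEMeasurable.mul ?_ ?_) (by fun_prop)
        · exact ((measurable_smoothingKernel _ k).comp (by fun_prop : Measurable
            fun p : E3 × E3 => p.1 - p.2)).aemeasurable
        · exact (hF.comp_quasiMeasurePreserving Measure.quasiMeasurePreserving_snd).enorm
    _ ≤ ∫⁻ y, C * (‖F y‖ₑ * weight k y) := by
        gcongr with y
        calc ∫⁻ x, smoothingKernel δ k (x - y) * ‖F y‖ₑ * weight k x
            = ∫⁻ x, ‖F y‖ₑ * (smoothingKernel δ k (y - x) * weight k x) := by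
              congr 1; ext x; rw [smoothingKernel_sub_comm]; ring
          _ = ‖F y‖ₑ * ∫⁻ x, smoothingKernel δ k (y - x) * weight k x :=
              lintegral_const_mul' _ _ enorm_ne_top
          _ ≤ ‖F y‖ₑ * (C * weight k y) := by gcongr; exact hC k y
          _ = _ := by ring
    _ = _ := lintegral_const_mul' _ _ ENNReal.coe_ne_top

/-- The weighted `L¹` estimate behind the first two trilinear estimates. -/
lemma lintegral_mul_weight_le {δ : ℝ} (hδ : 0 < δ) {c : ℝ} (hc : 0 < c)
    (K : ℝ) : ∃ C : ℝ≥0, ∀ k : ℤ, 1 ≤ k → ∀ (J : Set ℝ) (M : E3 → ℝ), AEStronglyMeasurable M volume →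
    (∀ x, |M x| ≤ K * Real.exp (-c * ‖x‖)) → ∀ f g : ℝ → E3 → ℝ, MeasurableOnST J f → MeasurableOnST J g →
    (∫⁻ t in J, ∫⁻ x, smoothMajorant δ k (fun y => M y * f t y * g t y) x * weight k x ≤
      C * (ENNReal.ofReal |(k : ℝ)| * localEnergyNorm k J f * localEnergyNorm k J g)) ∧
    ∫⁻ t in J, ∫⁻ x, ‖M x * f t x * g t x‖ₑ * weight k x ≤
      C * (ENNReal.ofReal |(k : ℝ)| * localEnergyNorm k J f * localEnergyNorm k J g) := by
  obtain ⟨C₂, hC₂⟩ := lintegral_smoothMajorant_mul_weight_le hδ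
  obtain ⟨C₃, hC₃⟩ := enorm_le_bracket hc K
  obtain ⟨C₄, hC₄⟩ := lintegral_weight_mul_le
  refine ⟨C₂ * C₃ * C₄ + C₃ * C₄, fun k hk J M hMm hM f g hf hg => ?_⟩
  set R := ENNReal.ofReal |(k : ℝ)| * localEnergyNorm k J f * localEnergyNorm k J g
  have h2 : ∫⁻ t in J, ∫⁻ x, ‖M x * f t x * g t x‖ₑ * weight k x ≤ (C₃ * C₄ : ℝ≥0) * R := by
    calc ∫⁻ t in J, ∫⁻ x, ‖M x * f t x * g t x‖ₑ * weight k x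
        ≤ ∫⁻ t in J, ∫⁻ x, C₃ * (energyWeight k x * (‖f t x‖ₑ * ‖g t x‖ₑ)) := by
          refine lintegral_mono fun t => lintegral_mono fun x => ?_
          rw [enorm_mul, enorm_mul]
          change _ ≤ C₃ * (weight k x * bracket 0 x ^ (-1 : ℝ) * _)
          calc ‖M x‖ₑ * ‖f t x‖ₑ * ‖g t x‖ₑ * weight k x
              ≤ C₃ * bracket 0 x ^ (-1 : ℝ) * ‖f t x‖ₑ * ‖g t x‖ₑ * weight k x := by
                gcongr; exact hC₃ M hM x
            _ = _ := by ring
      _ = C₃ * ∫⁻ t in J, ∫⁻ x, energyWeight k x * (‖f t x‖ₑ * ‖g t x‖ₑ) := by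
          simp_rw [lintegral_const_mul' _ _ ENNReal.coe_ne_top]
      _ ≤ C₃ * (C₄ * R) := by gcongr; exact hC₄ k J f g hk hf hg
      _ = _ := by push_cast; ring
  refine ⟨?_, h2.trans (mul_le_mul_left (ENNReal.coe_le_coe.2 le_add_self) _)⟩
  calc ∫⁻ t in J, ∫⁻ x, smoothMajorant δ k (fun y => M y * f t y * g t y) x * weight k x
      ≤ ∫⁻ t in J, C₂ * ∫⁻ x, ‖M x * f t x * g t x‖ₑ * weight k x := by
        refine lintegral_mono_ae ?_
        filter_upwards [hf.ae, hg.ae] with t hft hgt using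
          hC₂ k _ ((hMm.aemeasurable.mul hft).mul hgt)
    _ = C₂ * ∫⁻ t in J, ∫⁻ x, ‖M x * f t x * g t x‖ₑ * weight k x :=
        lintegral_const_mul' _ _ ENNReal.coe_ne_top
    _ ≤ C₂ * ((C₃ * C₄ : ℝ≥0) * R) := by gcongr
    _ ≤ _ := by
        rw [← mul_assoc (C₂ : ℝ≥0∞) _ R, ← ENNReal.coe_mul]
        refine mul_le_mul_left (ENNReal.coe_le_coe.2 ?_) _
        rw [← mul_assoc]; exact le_self_add

/-! ### The first trilinear estimate and its exterior analogue -/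

lemma lintegral_lintegral_mul_const {J : Set ℝ} {U : ℝ → E3 → ℝ≥0∞}
    (hU : AEMeasurable (Function.uncurry U) ((volume.restrict J).prod volume)) (A : ℝ≥0∞) :
    ∫⁻ t in J, ∫⁻ x, U t x * A = (∫⁻ t in J, ∫⁻ x, U t x) * A := by
  have h := lintegral_mul_const'' A hU.lintegral_prod_right'
  refine Eq.trans ?_ h
  refine lintegral_congr_ae ?_
  filter_upwards [hU.aestronglyMeasurable.prodMk_left] with t ht
  exact lintegral_mul_const'' _ ht.aemeasurable

/-- Radial Sobolev bounds P_{≤k}h by 2^(k/2) times the weight, uniformly in time, which leaves the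
weighted L¹ norms of I(Mfg) and of Mfg. -/
lemma trilinear_low_frequency {ψ : E3 → ℝ} (hψ : IsLPCutoff ψ) {ε : ℝ} (hε : ε < 1 / 2) {c : ℝ} (hc : 0 < c)
    (K : ℝ) : ∃ C : ℝ≥0, ∀ k : ℤ, 1 ≤ k → ∀ J : Set ℝ, MeasurableSet J → ∀ M : E3 → ℝ,
    AEStronglyMeasurable M volume → (∀ x, |M x| ≤ K * Real.exp (-c * ‖x‖)) → ∀ f g h : ℝ → E3 → ℝ,
    MeasurableOnST J f → MeasurableOnST J g → MeasurableOnST J h → RadialOn J h →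
    stNorm 1 1 J univ (fun t x => opI ψ ε k (fun y => M y * f t y * g t y) x * lpProjLe ψ k (h t) x) +
      stNorm 1 1 J univ (fun t x => M x * f t x * g t x * lpProjLe ψ k (h t) x) ≤
    C * ((2 : ℝ≥0∞) ^ ((k : ℝ) / 2) * ENNReal.ofReal |(k : ℝ)| * localEnergyNorm k J f *
      localEnergyNorm k J g * stNorm ⊤ 2 J univ h) := by
  obtain ⟨C₁, hC₁⟩ := hψ.enorm_lpProjLe_radial_le
  obtain ⟨C₂, hC₂⟩ := lintegral_mul_weight_le (show 0 < 1 / 2 - ε by linarith) hc K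
  obtain ⟨C₃, hC₃⟩ := hψ.opI_le
  refine ⟨C₁ * C₂ * C₃ + C₁ * C₂, fun k hk J hJ M hMm hM f g h hf hg hh hrad => ?_⟩
  set R := ENNReal.ofReal |(k : ℝ)| * localEnergyNorm k J f * localEnergyNorm k J g with hR
  set H := stNorm ⊤ 2 J univ h
  have hMfg : MeasurableOnST J fun t x => M x * f t x * g t x := ((MeasurableOnST.of_space hMm J).mul hf).mul hg
  -- Both terms are treated at once: U stands for the smoothing majorant of Mfg or for |Mfg| itself.
  have key : ∀ (u : ℝ → E3 → ℝ) (U : ℝ → E3 → ℝ≥0∞) (B : ℝ≥0),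
      (∀ᵐ t ∂volume.restrict J, ∀ x, ‖u t x‖ₑ ≤ B * U t x) →
      AEMeasurable (Function.uncurry U) ((volume.restrict J).prod volume) →
      ∫⁻ t in J, ∫⁻ x, U t x * weight k x ≤ C₂ * R →
      stNorm 1 1 J univ (fun t x => u t x * lpProjLe ψ k (h t) x) ≤
        C₁ * C₂ * B * (2 ^ ((k : ℝ) / 2) * R * H) := by
    intro u U B hu hUm hU
    rw [stNorm_one]
    simp only [Measure.restrict_univ]
    calc ∫⁻ t in J, ∫⁻ x, ‖u t x * lpProjLe ψ k (h t) x‖ₑ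
        ≤ ∫⁻ t in J, ∫⁻ x, (U t x * weight k x) * (B * (C₁ * 2 ^ ((k : ℝ) / 2) * H)) := by
          refine lintegral_mono_ae ?_
          filter_upwards [hh.ae, ae_lintegral_sq_le_stNorm J h, ae_restrict_mem hJ, hu] with t ht hH htJ hut
          refine lintegral_mono fun x => ?_
          rw [enorm_mul]
          calc ‖u t x‖ₑ * ‖lpProjLe ψ k (h t) x‖ₑ
              ≤ B * U t x * (C₁ * (2 ^ ((k : ℝ) / 2) * weight k x) * H) := by
                gcongr
                · exact hut x
                · exact (hC₁ (h t) ht (hrad t htJ) k x).trans (by gcongr)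
            _ = _ := by ring
      _ = (∫⁻ t in J, ∫⁻ x, U t x * weight k x) * (B * (C₁ * 2 ^ ((k : ℝ) / 2) * H)) :=
          lintegral_lintegral_mul_const (U := fun t x => U t x * weight k x) (hUm.mul (by fun_prop)) _
      _ ≤ C₂ * R * (B * (C₁ * 2 ^ ((k : ℝ) / 2) * H)) := by gcongr
      _ = _ := by ring
  obtain ⟨h1, h2⟩ := hC₂ k hk J M hMm hM f g hf hg
  refine (add_le_add (key _ (fun t => smoothMajorant (1 / 2 - ε) k fun y => M y * f t y * g t y) C₃ ?_
    (hMfg.aemeasurable_smoothMajorant (1 / 2 - ε) k) h1)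
    (key _ (fun t x => ‖M x * f t x * g t x‖ₑ) 1 ?_ hMfg.aemeasurable.enorm h2)).trans (le_of_eq ?_)
  · filter_upwards [hMfg.ae] with t ht x using hC₃ ε k _ x ht
  · simp
  · rw [hR]; push_cast; ring

/-- On this region 1/|x| is at most twice the weight, so the same weighted L¹ bounds apply. -/
lemma bilinear_exterior {ψ : E3 → ℝ} (hψ : IsLPCutoff ψ) {ε : ℝ} (hε : ε < 1 / 2) {c : ℝ} (hc : 0 < c)
    (K : ℝ) : ∃ C : ℝ≥0, ∀ k : ℤ, 1 ≤ k → ∀ J : Set ℝ, ∀ M : E3 → ℝ,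
    AEStronglyMeasurable M volume → (∀ x, |M x| ≤ K * Real.exp (-c * ‖x‖)) → ∀ f g : ℝ → E3 → ℝ,
    MeasurableOnST J f → MeasurableOnST J g →
    stNorm 1 1 J {x : E3 | (2 : ℝ) ^ (1 - k) < ‖x‖} (fun t x =>
        opI ψ ε k (fun y => M y * f t y * g t y) x * (1 / ‖x‖)) +
      stNorm 1 1 J {x : E3 | (2 : ℝ) ^ (1 - k) < ‖x‖} (fun t x => M x * f t x * g t x * (1 / ‖x‖)) ≤
    C * (ENNReal.ofReal |(k : ℝ)| * localEnergyNorm k J f * localEnergyNorm k J g) := by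
  obtain ⟨C₂, hC₂⟩ := lintegral_mul_weight_le (show 0 < 1 / 2 - ε by linarith) hc K
  obtain ⟨C₃, hC₃⟩ := hψ.opI_le
  refine ⟨2 * C₃ * C₂ + 2 * C₂, fun k hk J M hMm hM f g hf hg => ?_⟩
  set R := ENNReal.ofReal |(k : ℝ)| * localEnergyNorm k J f * localEnergyNorm k J g with hR
  have hMfg : MeasurableOnST J fun t x => M x * f t x * g t x := ((MeasurableOnST.of_space hMm J).mul hf).mul hg
  have key : ∀ (u : ℝ → E3 → ℝ) (U : ℝ → E3 → ℝ≥0∞) (B : ℝ≥0),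
      (∀ᵐ t ∂volume.restrict J, ∀ x, ‖u t x‖ₑ ≤ B * U t x) →
      ∫⁻ t in J, ∫⁻ x, U t x * weight k x ≤ C₂ * R →
      stNorm 1 1 J {x : E3 | (2 : ℝ) ^ (1 - k) < ‖x‖} (fun t x => u t x * (1 / ‖x‖)) ≤ 2 * B * C₂ * R := by
    intro u U B hu hU
    rw [stNorm_one]
    calc ∫⁻ t in J, ∫⁻ x in {x : E3 | (2 : ℝ) ^ (1 - k) < ‖x‖}, ‖u t x * (1 / ‖x‖)‖ₑ
        ≤ ∫⁻ t in J, ∫⁻ x, (2 * B : ℝ≥0) * (U t x * weight k x) := by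
          refine lintegral_mono_ae ?_
          filter_upwards [hu] with t hut
          refine le_trans (setLIntegral_mono_ae' (measurableSet_lt measurable_const measurable_norm)
            (.of_forall fun x hx => ?_)) (setLIntegral_le_lintegral _ _)
          have hx0 : 0 < ‖x‖ := lt_trans (by positivity) hx
          have hx' : x ∉ dball (-k) := by
            rw [dball, mem_closedBall_zero_iff, not_le]
            refine lt_of_le_of_lt ?_ hx
            exact zpow_le_zpow_right₀ (by norm_num) (by omega)
          have he : ‖1 / ‖x‖‖ₑ = ‖x‖ₑ ^ (-1 : ℝ) := by
            rw [one_div, enorm_inv hx0.ne', enorm_norm, ENNReal.rpow_neg_one]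
          rw [enorm_mul, he]
          refine (mul_le_mul' (hut x) (enorm_le_weight hx')).trans (le_of_eq ?_)
          push_cast; ring
      _ = (2 * B : ℝ≥0) * ∫⁻ t in J, ∫⁻ x, U t x * weight k x := by
          simp_rw [lintegral_const_mul' _ _ ENNReal.coe_ne_top]
      _ ≤ (2 * B : ℝ≥0) * (C₂ * R) := by gcongr
      _ = _ := by push_cast; ring
  obtain ⟨h1, h2⟩ := hC₂ k hk J M hMm hM f g hf hg
  refine (add_le_add (key _ _ C₃ ?_ h1) (key _ _ 1 ?_ h2)).trans (le_of_eq ?_)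
  · filter_upwards [hMfg.ae] with t ht x using hC₃ ε k _ x ht
  · simp
  · push_cast; ring

/-! ### The second trilinear estimate -/

/-- The natural factor is |k|^(1/2); since k ≥ 1 it is enlarged to the |k| of the final estimate. -/
lemma lintegral_energyWeight_sqrt_le : ∃ C : ℝ≥0, ∀ (k : ℤ) (J : Set ℝ) (F : ℝ → E3 → ℝ), 1 ≤ k →
    MeasurableOnST J F → (∫⁻ t in J, ∫⁻ x, energyWeight k x * ‖F t x‖ₑ ^ 2) ^ (1 / 2 : ℝ) ≤
      C * (ENNReal.ofReal |(k : ℝ)| * localEnergyNorm k J F) := by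
  obtain ⟨C, hC⟩ := lintegral_weight_sq_le
  refine ⟨C + 1, fun k J F hk hF => ?_⟩
  rw [← sqrt_sq (((C + 1 : ℝ≥0) : ℝ≥0∞) * (ENNReal.ofReal |(k : ℝ)| * localEnergyNorm k J F))]
  refine ENNReal.rpow_le_rpow ((hC k J F hF).trans ?_) (by norm_num)
  rw [ofReal_max_one hk, mul_pow, mul_pow, ← mul_assoc]
  gcongr
  · calc (C : ℝ≥0∞) ≤ (C + 1 : ℝ≥0) := by push_cast; exact le_self_add
      _ ≤ _ := le_self_pow₀ (by push_cast; exact le_add_self) two_ne_zero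
  · exact le_self_pow₀ (one_le_ofReal_abs hk) two_ne_zero

/-- Each of the two factors of the weight loses at most one bracket at scale k, the bracket at scale
0 being smaller since k ≥ 1. The square root therefore loses exactly one. -/
lemma energyWeight_sqrt_le {k : ℤ} (hk : 1 ≤ k) (x y : E3) :
    energyWeight k y ^ (1 / 2 : ℝ) ≤ energyWeight k x ^ (1 / 2 : ℝ) * bracket k (x - y) := by
  rw [← sqrt_sq (bracket k (x - y)), ← ENNReal.mul_rpow_of_nonneg _ _ (by norm_num)]
  refine ENNReal.rpow_le_rpow ?_ (by norm_num)
  have h0 : bracket 0 y ^ (-1 : ℝ) ≤ bracket 0 x ^ (-1 : ℝ) * bracket k (x - y) := by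
    refine (bracket_neg_rpow_le 0 y x zero_le_one).trans ?_
    rw [ENNReal.rpow_one, ← neg_sub, bracket_neg]
    gcongr
    exact bracket_mono (by omega) _
  have h1 := weight_le_mul k y x
  rw [← neg_sub, bracket_neg] at h1
  calc weight k y * bracket 0 y ^ (-1 : ℝ)
      ≤ (weight k x * bracket k (x - y)) * (bracket 0 x ^ (-1 : ℝ) * bracket k (x - y)) := by gcongr
    _ = weight k x * bracket 0 x ^ (-1 : ℝ) * bracket k (x - y) ^ 2 := by ring

lemma measurable_bracketKernel (δ : ℝ) (k : ℤ) : Measurable fun p : E3 × E3 =>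
    smoothingKernel δ k (p.1 - p.2) * bracket k (p.1 - p.2) :=
  ((measurable_smoothingKernel δ k).comp (by fun_prop)).mul ((measurable_bracket k).comp (by fun_prop))

/-- Schur's test: the kernel times one bracket has bounded integral in either variable. -/
lemma lintegral_sq_bracketKernel_le {δ : ℝ} (hδ : 0 < δ) : ∃ C : ℝ≥0, ∀ (k : ℤ) (u : E3 → ℝ≥0∞),
    AEMeasurable u →
    ∫⁻ x, (∫⁻ y, smoothingKernel δ k (x - y) * bracket k (x - y) * u y) ^ 2 ≤ C * ∫⁻ y, u y ^ 2 := by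
  obtain ⟨C, hC⟩ := lintegral_smoothingKernel_bracket hδ
  refine ⟨C * C, fun k u hu => ?_⟩
  have hC1 : ∀ x : E3, ∫⁻ y, smoothingKernel δ k (x - y) * bracket k (x - y) ≤ C := fun x => by
    simpa using hC k x 1 zero_le_one (by norm_num)
  calc ∫⁻ x, (∫⁻ y, smoothingKernel δ k (x - y) * bracket k (x - y) * u y) ^ 2
      ≤ ∫⁻ x, C * ∫⁻ y, smoothingKernel δ k (x - y) * bracket k (x - y) * u y ^ 2 := by
        refine lintegral_mono fun x => (sq_lintegral_kernel_mul_le ?_ hu).trans ?_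
        · exact ((measurable_bracketKernel δ k).comp (by fun_prop : Measurable fun y => (x, y))).aemeasurable
        · gcongr; exact hC1 x
    _ = C * ∫⁻ y, ∫⁻ x, smoothingKernel δ k (x - y) * bracket k (x - y) * u y ^ 2 := by
        rw [lintegral_const_mul' _ _ ENNReal.coe_ne_top, lintegral_lintegral_swap]
        refine AEMeasurable.mul (measurable_bracketKernel δ k).aemeasurable (AEMeasurable.pow_const ?_ 2)
        exact hu.comp_quasiMeasurePreserving Measure.quasiMeasurePreserving_snd
    _ ≤ C * ∫⁻ y, C * u y ^ 2 := by
        gcongr with y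
        rw [lintegral_mul_const]
        · refine mul_le_mul_left ?_ _
          calc ∫⁻ x, smoothingKernel δ k (x - y) * bracket k (x - y)
              = ∫⁻ x, smoothingKernel δ k (y - x) * bracket k (y - x) := by
                congr 1; ext x; rw [smoothingKernel_sub_comm, ← neg_sub, bracket_neg]
            _ ≤ C := hC1 y
        · fun_prop
    _ = _ := by rw [lintegral_const_mul' _ _ ENNReal.coe_ne_top]; push_cast; ring

/-- The two norms of h give |h|² ≲ D² `weight k`, so |Mgh| is at most D times the square root of
`energyWeight k` times |g|. That root is moved through the kernel onto f; Cauchy-Schwarz then pairs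
g in plain L² with f in the weighted L² norm. -/
lemma trilinear_high_frequency {ψ : E3 → ℝ} (hψ : IsLPCutoff ψ) {ε : ℝ} (hε : ε < 1 / 2) {c : ℝ} (hc : 0 < c)
    (K : ℝ) : ∃ C : ℝ≥0, ∀ k : ℤ, 1 ≤ k → ∀ J : Set ℝ, ∀ M : E3 → ℝ,
    AEStronglyMeasurable M volume → (∀ x, |M x| ≤ K * Real.exp (-c * ‖x‖)) → ∀ f g h : ℝ → E3 → ℝ,
    MeasurableOnST J f → MeasurableOnST J g → MeasurableOnST J h →
    stNorm 1 1 J univ (fun t x => opI ψ ε k (fun y => M y * g t y * h t y) x * f t x) ≤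
    C * (ENNReal.ofReal |(k : ℝ)| * stNorm 2 2 J univ g * localEnergyNorm k J f *
      ((2 : ℝ≥0∞) ^ (-(k : ℝ) / 2) * stNorm ⊤ ⊤ J univ h +
        stNorm ⊤ ⊤ J univ (fun t x => ‖x‖ ^ (1 / 2 : ℝ) * h t x))) := by
  obtain ⟨C₁, hC₁⟩ := enorm_le_bracket hc K
  obtain ⟨C₂, hC₂⟩ := lintegral_sq_bracketKernel_le (show 0 < 1 / 2 - ε by linarith)
  obtain ⟨C₃, hC₃⟩ := hψ.opI_le
  obtain ⟨C₄, hC₄⟩ := lintegral_energyWeight_sqrt_le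
  refine ⟨C₃ * C₁ * 2 * C₂ ^ (1 / 2 : ℝ) * C₄, fun k hk J M hMm hM f g h hf hg hh => ?_⟩
  set D := (2 : ℝ≥0∞) ^ (-(k : ℝ) / 2) * stNorm ⊤ ⊤ J univ h +
        stNorm ⊤ ⊤ J univ (fun t x => ‖x‖ ^ (1 / 2 : ℝ) * h t x)
  have hMgh : MeasurableOnST J fun t x => M x * g t x * h t x := ((MeasurableOnST.of_space hMm J).mul hg).mul hh
  have hpt : ∀ᵐ t ∂volume.restrict J, ∫⁻ x, ‖opI ψ ε k (fun y => M y * g t y * h t y) x * f t x‖ₑ ≤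
      C₃ * (C₁ * 2 * D) * C₂ ^ (1 / 2 : ℝ) *
        ((∫⁻ y, ‖g t y‖ₑ ^ 2) ^ (1 / 2 : ℝ) * (∫⁻ x, energyWeight k x * ‖f t x‖ₑ ^ 2) ^ (1 / 2 : ℝ)) := by
    filter_upwards [hf.ae, hg.ae, hMgh.ae, ae_ae_le_stNorm_top J h,
      ae_ae_le_stNorm_top J (fun t x => ‖x‖ ^ (1 / 2 : ℝ) * h t x)] with t hft hgt hFt h1 h2
    have hbd : ∀ᵐ y, ‖M y * g t y * h t y‖ₑ ≤ (C₁ * 2 * D) * (energyWeight k y ^ (1 / 2 : ℝ) * ‖g t y‖ₑ) := by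
      filter_upwards [h1, h2] with y hy1 hy2
      rw [enorm_mul, enorm_norm_rpow _ (by norm_num)] at hy2
      have h3 : ‖h t y‖ₑ ^ 2 ≤ 2 * D ^ 2 * weight k y := by
        refine sq_le_weight k (le_trans (by gcongr) le_self_add) ?_
        rw [mul_comm]; exact hy2.trans le_add_self
      have h4 : ‖M y‖ₑ * ‖h t y‖ₑ ≤ C₁ * 2 * D * energyWeight k y ^ (1 / 2 : ℝ) := by
        refine ennreal_le_of_sq_le_sq ?_
        rw [mul_pow, mul_pow _ (energyWeight k y ^ (1 / 2 : ℝ)), sq_sqrt]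
        calc ‖M y‖ₑ ^ 2 * ‖h t y‖ₑ ^ 2
            ≤ (C₁ * bracket 0 y ^ (-1 : ℝ)) ^ 2 * (2 * D ^ 2 * weight k y) := by
              gcongr; exact hC₁ M hM y
          _ = (C₁ ^ 2 * 2 * D ^ 2) * (weight k y * (bracket 0 y ^ (-1 : ℝ) * bracket 0 y ^ (-1 : ℝ))) := by ring
          _ ≤ (C₁ ^ 2 * 4 * D ^ 2) * (weight k y * (bracket 0 y ^ (-1 : ℝ) * 1)) := by
              gcongr
              · norm_num
              · exact bracket_rpow_le_one 0 y zero_le_one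
          _ = _ := by rw [mul_one, energyWeight]; ring
      rw [enorm_mul, enorm_mul]
      calc ‖M y‖ₑ * ‖g t y‖ₑ * ‖h t y‖ₑ = (‖M y‖ₑ * ‖h t y‖ₑ) * ‖g t y‖ₑ := by ring
        _ ≤ C₁ * 2 * D * energyWeight k y ^ (1 / 2 : ℝ) * ‖g t y‖ₑ := by gcongr
        _ = _ := by ring
    set a := fun x => ∫⁻ y, smoothingKernel (1 / 2 - ε) k (x - y) * bracket k (x - y) * ‖g t y‖ₑ
    have ha : AEMeasurable a := by
      refine AEMeasurable.lintegral_prod_right' (f := fun p : E3 × E3 =>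
        smoothingKernel (1 / 2 - ε) k (p.1 - p.2) * bracket k (p.1 - p.2) * ‖g t p.2‖ₑ) ?_
      exact (measurable_bracketKernel _ k).aemeasurable.mul
          (hgt.comp_quasiMeasurePreserving Measure.quasiMeasurePreserving_snd).enorm
    have hI : ∀ x, ‖opI ψ ε k (fun y => M y * g t y * h t y) x‖ₑ ≤
        C₃ * (C₁ * 2 * D) * (a x * energyWeight k x ^ (1 / 2 : ℝ)) := by
      intro x
      have hmx : AEMeasurable fun y =>
          smoothingKernel (1 / 2 - ε) k (x - y) * bracket k (x - y) * ‖g t y‖ₑ :=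
        ((measurable_bracketKernel (1 / 2 - ε) k).comp
          (by fun_prop : Measurable fun y => (x, y))).aemeasurable.mul hgt.enorm
      refine (hC₃ ε k _ x hFt).trans ?_
      rw [mul_assoc]
      gcongr
      calc ∫⁻ y, smoothingKernel (1 / 2 - ε) k (x - y) * ‖M y * g t y * h t y‖ₑ
          ≤ ∫⁻ y, (C₁ * 2 * D) * energyWeight k x ^ (1 / 2 : ℝ) *
              (smoothingKernel (1 / 2 - ε) k (x - y) * bracket k (x - y) * ‖g t y‖ₑ) := by
            refine lintegral_mono_ae ?_
            filter_upwards [hbd] with y hy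
            calc smoothingKernel (1 / 2 - ε) k (x - y) * ‖M y * g t y * h t y‖ₑ
                ≤ smoothingKernel (1 / 2 - ε) k (x - y) * ((C₁ * 2 * D) *
                  (energyWeight k x ^ (1 / 2 : ℝ) * bracket k (x - y) * ‖g t y‖ₑ)) := by
                  gcongr; exact hy.trans (by gcongr; exact energyWeight_sqrt_le hk x y)
              _ = _ := by ring
        _ = (C₁ * 2 * D) * energyWeight k x ^ (1 / 2 : ℝ) * a x := lintegral_const_mul'' _ hmx
        _ = _ := by ring
    have hCS : ∫⁻ x, a x * (energyWeight k x ^ (1 / 2 : ℝ) * ‖f t x‖ₑ) ≤ C₂ ^ (1 / 2 : ℝ) *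
        ((∫⁻ y, ‖g t y‖ₑ ^ 2) ^ (1 / 2 : ℝ) * (∫⁻ x, energyWeight k x * ‖f t x‖ₑ ^ 2) ^ (1 / 2 : ℝ)) := by
      have h5 := le_sqrt_of_sq_le (sq_lintegral_mul_le ha
        (b := fun x => energyWeight k x ^ (1 / 2 : ℝ) * ‖f t x‖ₑ)
        (((measurable_energyWeight k).pow_const _).aemeasurable.mul hft.enorm))
      refine h5.trans ?_
      rw [← ENNReal.mul_rpow_of_nonneg _ _ (by norm_num), ← ENNReal.mul_rpow_of_nonneg _ _ (by norm_num),
        ← mul_assoc]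
      simp_rw [mul_pow, sq_sqrt]
      gcongr
      exact hC₂ k _ hgt.enorm
    calc ∫⁻ x, ‖opI ψ ε k (fun y => M y * g t y * h t y) x * f t x‖ₑ
        ≤ ∫⁻ x, C₃ * (C₁ * 2 * D) * (a x * (energyWeight k x ^ (1 / 2 : ℝ) * ‖f t x‖ₑ)) := by
          refine lintegral_mono fun x => ?_
          rw [enorm_mul]
          refine (mul_le_mul_left (hI x) _).trans (le_of_eq (by ring))
      _ = C₃ * (C₁ * 2 * D) * ∫⁻ x, a x * (energyWeight k x ^ (1 / 2 : ℝ) * ‖f t x‖ₑ) :=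
          lintegral_const_mul'' _ (ha.mul (((measurable_energyWeight k).pow_const _).aemeasurable.mul hft.enorm))
      _ ≤ _ := by rw [mul_assoc _ ((C₂ : ℝ≥0∞) ^ (1 / 2 : ℝ))]; gcongr
  have hGm := hg.aemeasurable_lintegral_sq univ
  have hEm : AEMeasurable (fun t => ∫⁻ x, energyWeight k x * ‖f t x‖ₑ ^ 2) (volume.restrict J) := by
    simpa using hf.aemeasurable_lintegral univ (measurable_energyWeight k) 2
  have hGE := stNorm_two_sq J univ g
  simp only [Measure.restrict_univ] at hGm hGE
  have hG' : stNorm 2 2 J univ g = (∫⁻ t in J, ∫⁻ x, ‖g t x‖ₑ ^ 2) ^ (1 / 2 : ℝ) := by rw [← hGE, sqrt_sq]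
  rw [stNorm_one]
  simp only [Measure.restrict_univ]
  refine (lintegral_mono_ae hpt).trans ?_
  have h7 := lintegral_const_mul'' (C₃ * (C₁ * 2 * D) * C₂ ^ (1 / 2 : ℝ))
    ((hGm.pow_const (1 / 2 : ℝ)).mul (hEm.pow_const (1 / 2 : ℝ)))
  simp only [Pi.mul_apply] at h7
  rw [h7]
  have h6 := le_sqrt_of_sq_le (sq_lintegral_mul_le (hGm.pow_const (1 / 2 : ℝ)) (hEm.pow_const (1 / 2 : ℝ)))
  simp_rw [sq_sqrt] at h6
  rw [ENNReal.mul_rpow_of_nonneg _ _ (by norm_num), ← hG'] at h6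
  calc _ ≤ C₃ * (C₁ * 2 * D) * C₂ ^ (1 / 2 : ℝ) *
        (stNorm 2 2 J univ g * (C₄ * (ENNReal.ofReal |(k : ℝ)| * localEnergyNorm k J f))) := by
        gcongr; exact h6.trans (by gcongr; exact hC₄ k J f hk hf)
    _ = _ := by
        push_cast
        rw [ENNReal.coe_rpow_of_nonneg _ (by norm_num)]
        ring

/-! ### The bilinear estimate -/

/-- For j ≥ k the local energy norm at scale j controls the one at scale k. For j < k it does not
see radii below 2^(-j); there L²_t L^∞_x is used with the integral of 1/|x|, while outside the
weight at scale k is at most twice the one at scale j. -/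
lemma lintegral_energyWeight_lpProj_sq_le {ψ : E3 → ℝ} (hψ : IsLPCutoff ψ) : ∃ C : ℝ≥0,
    ∀ (k j : ℤ) (J : Set ℝ) (f : ℝ → E3 → ℝ), 1 ≤ k → MeasurableOnST J f →
    ∫⁻ t in J, ∫⁻ x, energyWeight k x * ‖lpProj ψ j (f t) x‖ₑ ^ 2 ≤
      C * (ENNReal.ofReal |(k : ℝ)| * 2 ^ (-2 * (j : ℝ)) * strichartzS ψ J j f ^ 2) := by
  obtain ⟨C₁, hC₁⟩ := lintegral_weight_sq_le
  obtain ⟨C₂, hC₂⟩ := lintegral_dball_singular_sq_le zero_le_one (show (1 : ℝ) < 3 by norm_num)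
  refine ⟨C₂ + 2 * C₁, fun k j J f hk hf => ?_⟩
  have hLE : ∀ m, m ≤ j → m ≤ k → ∫⁻ t in J, ∫⁻ x, energyWeight m x * ‖lpProj ψ j (f t) x‖ₑ ^ 2 ≤
      C₁ * (ENNReal.ofReal |(k : ℝ)| * 2 ^ (-2 * (j : ℝ)) * strichartzS ψ J j f ^ 2) := by
    intro m hmj hmk
    refine (hC₁ m J _ (hf.lpProj hψ j)).trans ?_
    rw [mul_assoc, mul_assoc]
    refine mul_le_mul_right (mul_le_mul' ?_ ?_) _
    · rw [← ofReal_max_one hk]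
      gcongr
    · refine le_trans ?_ (localEnergyNorm_sq_le_strichartzS ψ J j f)
      gcongr
      exact localEnergyNorm_mono hmj J _
  rcases le_total k j with hkj | hjk
  · refine (hLE k hkj le_rfl).trans (mul_le_mul_left (ENNReal.coe_le_coe.2 ?_) _)
    refine le_trans ?_ le_add_self
    exact le_mul_of_one_le_left' (by norm_num)
  have hpt : ∀ x : E3, energyWeight k x ≤ (dball (-j)).indicator (fun x => ‖x‖ₑ ^ (-1 : ℝ)) x +
      2 * energyWeight j x := by
    intro x
    by_cases hx : x ∈ dball (-j)
    · rw [indicator_of_mem hx]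
      refine le_trans ?_ le_self_add
      calc energyWeight k x ≤ ‖x‖ₑ ^ (-1 : ℝ) * 1 :=
            mul_le_mul' (weight_le_enorm k x) (bracket_rpow_le_one 0 x zero_le_one)
        _ = _ := mul_one _
    · rw [indicator_of_notMem hx, zero_add, energyWeight, energyWeight, ← mul_assoc]
      gcongr
      exact (weight_le_enorm k x).trans (enorm_le_weight hx)
  have hm := hf.lpProj hψ j
  calc ∫⁻ t in J, ∫⁻ x, energyWeight k x * ‖lpProj ψ j (f t) x‖ₑ ^ 2
      ≤ ∫⁻ t in J, ((∫⁻ x in dball (-j), ‖x‖ₑ ^ (-1 : ℝ) * ‖lpProj ψ j (f t) x‖ₑ ^ 2) +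
          2 * ∫⁻ x, energyWeight j x * ‖lpProj ψ j (f t) x‖ₑ ^ 2) := by
        refine lintegral_mono_ae ?_
        filter_upwards [hm.ae] with t ht
        have hmi : AEMeasurable ((dball (-j)).indicator
            fun x => ‖x‖ₑ ^ (-1 : ℝ) * ‖lpProj ψ j (f t) x‖ₑ ^ 2) :=
          AEMeasurable.indicator (AEMeasurable.mul (by fun_prop) (ht.enorm.pow_const 2)) (measurableSet_dball _)
        rw [← lintegral_const_mul' _ _ ENNReal.ofNat_ne_top, ← lintegral_indicator (measurableSet_dball _),
          ← lintegral_add_left' hmi]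
        refine lintegral_mono fun x => ?_
        refine (mul_le_mul_left (hpt x) _).trans (le_of_eq ?_)
        rw [add_mul, mul_assoc]
        by_cases hx : x ∈ dball (-j) <;> simp [hx]
    _ = (∫⁻ t in J, ∫⁻ x in dball (-j), ‖x‖ₑ ^ (-1 : ℝ) * ‖lpProj ψ j (f t) x‖ₑ ^ 2) +
          2 * ∫⁻ t in J, ∫⁻ x, energyWeight j x * ‖lpProj ψ j (f t) x‖ₑ ^ 2 := by
        rw [lintegral_add_left', lintegral_const_mul' _ _ ENNReal.ofNat_ne_top]
        simpa using hm.aemeasurable_lintegral (dball (-j)) (w := fun x => ‖x‖ₑ ^ (-1 : ℝ)) (by fun_prop) 2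
    _ ≤ C₂ * (ENNReal.ofReal |(k : ℝ)| * 2 ^ (-2 * (j : ℝ)) * strichartzS ψ J j f ^ 2) +
          2 * (C₁ * (ENNReal.ofReal |(k : ℝ)| * 2 ^ (-2 * (j : ℝ)) * strichartzS ψ J j f ^ 2)) := by
        gcongr
        · refine (hC₂ j J _).trans ?_
          rw [mul_assoc, mul_assoc (ENNReal.ofReal _)]
          refine mul_le_mul_right ?_ _
          refine le_trans ?_ (le_mul_of_one_le_left' (one_le_ofReal_abs hk))
          rw [show (j : ℝ) * (1 - 3) = -2 * j by ring]
          gcongr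
          exact stNorm_le_strichartzS ψ J j f
        · exact hLE j le_rfl hjk
    _ = _ := by push_cast; ring

/-- The sup norm of g near the origin and radial Sobolev away from it give |g|² ≲ D² `weight k`.
With one power of decay of M this leaves the weighted L² norm of the frequency piece. -/
lemma bilinear_estimate {ψ : E3 → ℝ} (hψ : IsLPCutoff ψ) {c : ℝ} (hc : 0 < c)
    (K : ℝ) : ∃ C : ℝ≥0, ∀ k : ℤ, 1 ≤ k → ∀ J : Set ℝ, MeasurableSet J → ∀ M : E3 → ℝ,
    (∀ x, |M x| ≤ K * Real.exp (-c * ‖x‖)) → ∀ f g : ℝ → E3 → ℝ, ∀ j : ℤ,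
    MeasurableOnST J f → RadialOn J g →
    stNorm 2 2 J univ (fun t x => M x * lpProj ψ j (f t) x * g t x) ≤
    C * (ENNReal.ofReal |(k : ℝ)| * (2 : ℝ≥0∞) ^ (-(j : ℝ)) * strichartzS ψ J j f *
      ((2 : ℝ≥0∞) ^ (-(k : ℝ) / 2) * stNorm ⊤ ⊤ J univ g + supHDotNorm 1 J g)) := by
  obtain ⟨C₁, hC₁⟩ := enorm_le_bracket hc K
  obtain ⟨C₂, hC₂⟩ := hψ.radial_sobolev
  obtain ⟨C₃, hC₃⟩ := lintegral_energyWeight_lpProj_sq_le hψ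
  refine ⟨2 * C₁ * (C₂ + 1) * (C₃ + 1), fun k hk J hJ M hM f g j hf hrad => ?_⟩
  set D := (2 : ℝ≥0∞) ^ (-(k : ℝ) / 2) * stNorm ⊤ ⊤ J univ g + supHDotNorm 1 J g
  have hm := hf.lpProj hψ j
  have hem : AEMeasurable (Function.uncurry fun t x => energyWeight k x * ‖lpProj ψ j (f t) x‖ₑ ^ 2)
      ((volume.restrict J).prod volume) :=
    AEMeasurable.mul (by fun_prop) (hm.aemeasurable.enorm.pow_const 2)
  refine ennreal_le_of_sq_le_sq ?_
  rw [stNorm_two_sq]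
  simp only [Measure.restrict_univ]
  calc ∫⁻ t in J, ∫⁻ x, ‖M x * lpProj ψ j (f t) x * g t x‖ₑ ^ 2
      ≤ ∫⁻ t in J, ∫⁻ x, energyWeight k x * ‖lpProj ψ j (f t) x‖ₑ ^ 2 *
          (2 * (C₁ * (C₂ + 1) * D) ^ 2) := by
        refine lintegral_mono_ae ?_
        filter_upwards [ae_ae_le_stNorm_top J g, ae_le_supHDotNorm 1 J g, ae_restrict_mem hJ] with t h1 h2 htJ
        refine lintegral_mono_ae ?_
        filter_upwards [h1, hC₂ (g t) (hrad t htJ)] with x hx1 hx2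
        have h3 : ‖g t x‖ₑ ^ 2 ≤ 2 * ((C₂ + 1) * D) ^ 2 * weight k x := by
          refine sq_le_weight k ?_ ?_
          · calc 2 ^ (-(k : ℝ) / 2) * ‖g t x‖ₑ ≤ D := le_trans (by gcongr) le_self_add
              _ ≤ _ := le_mul_of_one_le_left' le_add_self
          · refine hx2.trans (mul_le_mul' le_self_add (h2.trans le_add_self))
        rw [enorm_mul, enorm_mul, mul_pow, mul_pow]
        calc ‖M x‖ₑ ^ 2 * ‖lpProj ψ j (f t) x‖ₑ ^ 2 * ‖g t x‖ₑ ^ 2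
            ≤ (C₁ ^ 2 * (bracket 0 x ^ (-1 : ℝ) * 1)) * ‖lpProj ψ j (f t) x‖ₑ ^ 2 *
                (2 * ((C₂ + 1) * D) ^ 2 * weight k x) := by
              gcongr
              calc ‖M x‖ₑ ^ 2 ≤ (C₁ * bracket 0 x ^ (-1 : ℝ)) ^ 2 := by gcongr; exact hC₁ M hM x
                _ = C₁ ^ 2 * (bracket 0 x ^ (-1 : ℝ) * bracket 0 x ^ (-1 : ℝ)) := by ring
                _ ≤ _ := by gcongr; exact bracket_rpow_le_one 0 x zero_le_one
          _ = _ := by rw [energyWeight]; ring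
    _ = (∫⁻ t in J, ∫⁻ x, energyWeight k x * ‖lpProj ψ j (f t) x‖ₑ ^ 2) * (2 * (C₁ * (C₂ + 1) * D) ^ 2) :=
        lintegral_lintegral_mul_const hem _
    _ ≤ (C₃ * (ENNReal.ofReal |(k : ℝ)| * 2 ^ (-2 * (j : ℝ)) * strichartzS ψ J j f ^ 2)) *
          (2 * (C₁ * (C₂ + 1) * D) ^ 2) := by gcongr; exact hC₃ k j J f hk hf
    _ ≤ ((C₃ + 1) ^ 2 * (ENNReal.ofReal |(k : ℝ)| ^ 2 * (2 ^ (-(j : ℝ))) ^ 2 * strichartzS ψ J j f ^ 2)) *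
          (2 ^ 2 * (C₁ * (C₂ + 1) * D) ^ 2) := by
        gcongr
        · exact (le_self_add (a := (C₃ : ℝ≥0∞)) (b := 1)).trans (le_self_pow₀ le_add_self two_ne_zero)
        · exact le_self_pow₀ (one_le_ofReal_abs hk) two_ne_zero
        · rw [two_rpow_sq]; exact two_rpow_le (by linarith)
        · norm_num
    _ = _ := by push_cast; ring

/-! ### The trilinear estimate near the origin -/

lemma sq_tsum_le {ι : Type*} [Countable ι] {a b c : ι → ℝ≥0∞} (h : ∀ i, a i ^ 2 ≤ b i * c i) :
    (∑' i, a i) ^ 2 ≤ (∑' i, b i) * ∑' i, c i := by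
  let _ : MeasurableSpace ι := ⊤
  have := sq_lintegral_weighted_le (μ := Measure.count) (a := fun _ => 1) (b := fun _ => 1) h
    (Measurable.of_discrete).aemeasurable (Measurable.of_discrete).aemeasurable (by fun_prop) (by fun_prop)
  simpa [lintegral_count] using this

lemma le_two_rpow_mul {a : ℝ} {x y : ℝ≥0∞} (h : 2 ^ (-a) * x ≤ y) : x ≤ 2 ^ a * y := by
  calc x = 2 ^ a * (2 ^ (-a) * x) := by rw [← mul_assoc, ← two_rpow_add]; simp
    _ ≤ _ := by gcongr

/-- Hölder with exponents 4 and 4/3, the kernel being split as κ^(1/4) κ^(3/4). -/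
lemma rpow_lintegral_kernel_mul_le {α : Type*} [MeasurableSpace α] {μ : Measure α} {κ u : α → ℝ≥0∞}
    (hκ : AEMeasurable κ μ) (hu : AEMeasurable u μ) :
    (∫⁻ x, κ x * u x ∂μ) ^ (4 / 3 : ℝ) ≤
      (∫⁻ x, κ x ∂μ) ^ (1 / 3 : ℝ) * ∫⁻ x, κ x * u x ^ (4 / 3 : ℝ) ∂μ := by
  have h := ENNReal.lintegral_mul_le_Lp_mul_Lq μ (p := 4) (q := 4 / 3)
    (by rw [Real.holderConjugate_iff]; norm_num) (hκ.pow_const (1 / 4 : ℝ)) ((hκ.pow_const (3 / 4 : ℝ)).mul hu)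
  have e1 : ∀ x, κ x ^ (1 / 4 : ℝ) * (κ x ^ (3 / 4 : ℝ) * u x) = κ x * u x := fun x => by
    rw [← mul_assoc, ← ENNReal.rpow_add_of_nonneg _ _ (by norm_num) (by norm_num)]; norm_num
  have e2 : ∀ x, (κ x ^ (1 / 4 : ℝ)) ^ (4 : ℝ) = κ x := fun x => by
    rw [← ENNReal.rpow_mul]; norm_num
  have e3 : ∀ x, (κ x ^ (3 / 4 : ℝ) * u x) ^ (4 / 3 : ℝ) = κ x * u x ^ (4 / 3 : ℝ) := fun x => by
    rw [ENNReal.mul_rpow_of_nonneg _ _ (by norm_num), ← ENNReal.rpow_mul]; norm_num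
  simp only [Pi.mul_apply, e1, e2, e3] at h
  refine (ENNReal.rpow_le_rpow h (by norm_num)).trans (le_of_eq ?_)
  rw [ENNReal.mul_rpow_of_nonneg _ _ (by norm_num), ← ENNReal.rpow_mul, ← ENNReal.rpow_mul]
  norm_num

/-- Inside radius 2^(-k) the power 3/2 is below the dimension; outside, the total decay of order 7/2
exceeds it. -/
lemma lintegral_rpow_bracket : ∃ C : ℝ≥0, ∀ k : ℤ,
    ∫⁻ x, ‖x‖ₑ ^ (-(3 / 2) : ℝ) * bracket k x ^ (-2 : ℝ) ≤ C * 2 ^ (-(3 / 2) * (k : ℝ)) := by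
  obtain ⟨C₁, hC₁⟩ := lintegral_dball_rpow (show (0 : ℝ) ≤ 3 / 2 by norm_num) (by norm_num)
  obtain ⟨C₂, hC₂⟩ := tsum_two_rpow (show (0 : ℝ) < 1 / 2 by norm_num)
  refine ⟨C₁ + 2 ^ (7 / 2 : ℝ) * unitVol * C₂, fun k => ?_⟩
  have h := lintegral_layers (-k) 0 (φ := (dball (-k))ᶜ.indicator
    fun x => ‖x‖ₑ ^ (-(3 / 2) : ℝ) * bracket k x ^ (-2 : ℝ)) (G := fun _ => 1)
    (c := fun n => 2 ^ ((3 / 2) * ((k : ℝ) + 1 - n) + (2 - 2 * n))) (by fun_prop) (fun x hx => by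
      rw [indicator_of_notMem (by simpa using hx)]; exact zero_le) (fun x n hx => by
      refine (indicator_le_self _ _ x).trans ?_
      rw [two_rpow_add]
      refine mul_le_mul' ?_ ((bracket_rpow_le_of_notMem (by norm_num) hx))
      rw [mem_dball, not_le] at hx
      calc ‖x‖ₑ ^ (-(3 / 2) : ℝ) ≤ ((2 : ℝ≥0∞) ^ (((n : ℤ) + -k : ℤ) : ℝ)) ^ (-(3 / 2) : ℝ) := by
            rw [ENNReal.rpow_neg, ENNReal.rpow_neg]
            exact ENNReal.inv_le_inv.2 (ENNReal.rpow_le_rpow hx.le (by norm_num))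
        _ = _ := by rw [two_rpow_rpow]; congr 1; push_cast; ring)
  simp only [sub_zero, mul_one, lintegral_indicator (measurableSet_dball (-k)).compl,
    setLIntegral_one, volume_closedBall_zpow] at h
  rw [← lintegral_add_compl _ (measurableSet_dball (-k))]
  push_cast
  rw [add_mul]
  refine add_le_add ?_ (h.trans (le_of_eq ?_))
  · calc ∫⁻ x in dball (-k), ‖x‖ₑ ^ (-(3 / 2) : ℝ) * bracket k x ^ (-2 : ℝ)
        ≤ ∫⁻ x in dball (-k), ‖x‖ₑ ^ (-(3 / 2) : ℝ) := by
          gcongr with x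
          exact mul_le_of_le_one_right' (bracket_rpow_le_one k x (by norm_num))
      _ ≤ _ := (hC₁ (-k)).trans (le_of_eq (by congr 2; push_cast; ring))
  · rw [← hC₂, ENNReal.coe_rpow_of_ne_zero (by norm_num), ← ENNReal.tsum_mul_left, ← ENNReal.tsum_mul_right]
    congr 1; ext n
    rw [← mul_assoc, mul_right_comm _ (unitVol : ℝ≥0∞), mul_right_comm _ (unitVol : ℝ≥0∞), ENNReal.coe_ofNat, ← two_rpow_add, ← two_rpow_add, ← two_rpow_add]
    congr 2
    push_cast; ring

/-- The energy part gives ‖P_j f‖₂ ≤ 2^(-js) B, summable over j ≥ m because s > 0, and on a ball L²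
controls L¹. This supplies the local integrability required by the reconstruction from pieces. -/
lemma sum_lpProj_ne_top {ψ : E3 → ℝ} (hψ : IsLPCutoff ψ) {s : ℝ} (hs : 0 < s) {J : Set ℝ} {f : ℝ → E3 → ℝ}
    (hf : MeasurableOnST J f) {m : ℤ} {B : ℝ≥0∞} (hB : B ≠ ⊤)
    (hS : ∀ j : ℤ, m ≤ j → strichartzS ψ J j f ≤ 2 ^ ((j : ℝ) * (1 - s)) * B) :
    ∀ᵐ t ∂volume.restrict J, ∀ l : ℕ, ∫⁻ x in dball l, ∑' n : ℕ, ‖lpProj ψ (n + m) (f t) x‖ₑ ≠ ⊤ := by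
  obtain ⟨C, hC⟩ := tsum_two_rpow hs
  have h1 : ∀ᵐ t ∂volume.restrict J, ∀ n : ℕ, AEMeasurable (lpProj ψ (n + m) (f t)) :=
    ae_all_iff.2 fun n => (hf.lpProj hψ _).ae
  have h2 : ∀ᵐ t ∂volume.restrict J, ∀ n : ℕ, (∫⁻ x, ‖lpProj ψ (n + m) (f t) x‖ₑ ^ 2) ^ (1 / 2 : ℝ) ≤
      2 ^ (-((n + m : ℝ) * s)) * B := by
    refine ae_all_iff.2 fun n => ?_
    filter_upwards [ae_lintegral_sq_le_stNorm J fun t => lpProj ψ (n + m) (f t)] with t ht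
    refine ht.trans ?_
    have h := (energy_le_strichartzS ψ J (n + m) f).trans (hS (n + m) (by omega))
    rw [← neg_neg (((n + m : ℤ) : ℝ))] at h
    refine (le_two_rpow_mul h).trans (le_of_eq ?_)
    rw [← mul_assoc, ← two_rpow_add]; congr 2; push_cast; ring
  filter_upwards [h1, h2] with t ht1 ht2 l
  rw [lintegral_tsum fun n => (ht1 n).enorm.restrict]
  refine ne_top_of_le_ne_top (b := volume (dball l) ^ (1 / 2 : ℝ) * (2 ^ (-(m * s)) * B * C)) ?_ ?_
  · have hv : volume (dball l) ≠ ⊤ := measure_closedBall_lt_top.ne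
    have := two_rpow_ne_top (-(m * s))
    have h3 : volume (dball l) ^ (1 / 2 : ℝ) ≠ ⊤ := ENNReal.rpow_ne_top_of_nonneg (by norm_num) hv
    finiteness
  rw [← hC, ← ENNReal.tsum_mul_left, ← ENNReal.tsum_mul_left]
  refine ENNReal.tsum_le_tsum fun n => ?_
  have h4 := le_sqrt_of_sq_le (sq_lintegral_mul_le (μ := volume.restrict (dball l)) (a := fun _ => 1)
    aemeasurable_const (ht1 n).enorm.restrict)
  simp only [one_mul, one_pow, lintegral_const, Measure.restrict_apply_univ] at h4
  refine h4.trans ?_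
  rw [ENNReal.mul_rpow_of_nonneg _ _ (by norm_num)]
  refine mul_le_mul_right ((ENNReal.rpow_le_rpow (setLIntegral_le_lintegral _ _) (by norm_num)).trans
    ((ht2 n).trans (le_of_eq ?_))) _
  rw [mul_right_comm, ← two_rpow_add]; congr 2; ring

/-- The weighted space-time `L²` norm of a single frequency piece, off the frequency of the weight. -/
lemma lintegral_singular_bracket_lpProj_sq_le {ψ : E3 → ℝ} (hψ : IsLPCutoff ψ) {s κ : ℝ}
    (hκ1 : κ ≤ 2 * s - 1 / 2) (hκ2 : κ ≤ 2 * (1 - s)) : ∃ C : ℝ≥0, ∀ (k j : ℤ) (J : Set ℝ)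
    (f : ℝ → E3 → ℝ) (B : ℝ≥0∞), MeasurableOnST J f → strichartzS ψ J j f ≤ 2 ^ ((j : ℝ) * (1 - s)) * B →
    ∫⁻ t in J, ∫⁻ x, ‖x‖ₑ ^ (-(3 / 2) : ℝ) * bracket k x ^ (-2 : ℝ) * ‖lpProj ψ j (f t) x‖ₑ ^ 2 ≤
      C * (2 ^ ((k : ℝ) * (1 / 2 - 2 * s)) * 2 ^ (-(κ * |(j : ℝ) - k|)) * B ^ 2) := by
  obtain ⟨C₁, hC₁⟩ := lintegral_singular_lpProj_sq_le hψ (show (1 : ℝ) < 3 / 2 by norm_num) (by norm_num)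
  obtain ⟨C₂, hC₂⟩ := lintegral_rpow_bracket
  refine ⟨C₁ + C₂, fun k j J f B hf hS => ?_⟩
  have hSq : strichartzS ψ J j f ^ 2 ≤ 2 ^ (2 * ((j : ℝ) * (1 - s))) * B ^ 2 := by
    calc _ ≤ (2 ^ ((j : ℝ) * (1 - s)) * B) ^ 2 := by gcongr
      _ = _ := by rw [mul_pow, two_rpow_sq]
  -- High frequencies use only the singular power and drop the bracket. Low frequencies are put in
  -- L²_t L^∞_x and the whole weight is integrated.
  rcases le_total k j with hkj | hjk
  · have hkj' : (k : ℝ) ≤ j := by exact_mod_cast hkj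
    calc _ ≤ ∫⁻ t in J, ∫⁻ x, ‖x‖ₑ ^ (-(3 / 2) : ℝ) * ‖lpProj ψ j (f t) x‖ₑ ^ 2 := by
          refine lintegral_mono fun t => lintegral_mono fun x => mul_le_mul_left ?_ _
          exact mul_le_of_le_one_right' (bracket_rpow_le_one k x (by norm_num))
      _ ≤ C₁ * 2 ^ ((j : ℝ) * (3 / 2 - 3)) * (2 ^ (2 * ((j : ℝ) * (1 - s))) * B ^ 2) :=
          (hC₁ j J f hf).trans (by gcongr)
      _ = C₁ * (2 ^ ((j : ℝ) * (3 / 2 - 3) + 2 * ((j : ℝ) * (1 - s))) * B ^ 2) := by rw [two_rpow_add]; ring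
      _ ≤ _ := by
          refine mul_le_mul' (ENNReal.coe_le_coe.2 le_self_add) (mul_le_mul_left ?_ _)
          rw [← two_rpow_add, abs_of_nonneg (by linarith)]
          refine two_rpow_le ?_
          nlinarith [mul_le_mul_of_nonneg_right hκ1 (sub_nonneg.2 hkj')]
  · have hjk' : (j : ℝ) ≤ k := by exact_mod_cast hjk
    have hlin : ∫⁻ t in J, ∫⁻ x, ‖x‖ₑ ^ (-(3 / 2) : ℝ) * bracket k x ^ (-2 : ℝ) * ‖lpProj ψ j (f t) x‖ₑ ^ 2 ≤
        C₂ * 2 ^ (-(3 / 2) * (k : ℝ)) * stNorm 2 ⊤ J univ (fun t => lpProj ψ j (f t)) ^ 2 := by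
      rw [stNorm_two_top_sq, Measure.restrict_univ, ← lintegral_const_mul' _ _
        (ENNReal.mul_ne_top ENNReal.coe_ne_top (two_rpow_ne_top _))]
      refine lintegral_mono fun t => ?_
      calc _ ≤ ∫⁻ x, ‖x‖ₑ ^ (-(3 / 2) : ℝ) * bracket k x ^ (-2 : ℝ) * eLpNorm (lpProj ψ j (f t)) ⊤ volume ^ 2 := by
            refine lintegral_mono_ae ?_
            filter_upwards [ae_le_eLpNormEssSup (f := lpProj ψ j (f t)) (μ := volume)] with x hx
            rw [eLpNorm_exponent_top]
            gcongr
        _ = (∫⁻ x, ‖x‖ₑ ^ (-(3 / 2) : ℝ) * bracket k x ^ (-2 : ℝ)) * eLpNorm (lpProj ψ j (f t)) ⊤ volume ^ 2 := by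
            rw [lintegral_mul_const]; fun_prop
        _ ≤ _ := by gcongr; exact hC₂ k
    calc _ ≤ C₂ * 2 ^ (-(3 / 2) * (k : ℝ)) * (2 ^ (2 * ((j : ℝ) * (1 - s))) * B ^ 2) :=
          hlin.trans (by gcongr; exact (pow_le_pow_left' (stNorm_le_strichartzS ψ J j f) 2).trans hSq)
      _ = C₂ * (2 ^ (-(3 / 2) * (k : ℝ) + 2 * ((j : ℝ) * (1 - s))) * B ^ 2) := by rw [two_rpow_add]; ring
      _ ≤ _ := by
          refine mul_le_mul' (ENNReal.coe_le_coe.2 le_add_self) (mul_le_mul_left ?_ _)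
          rw [← two_rpow_add, abs_of_nonpos (by linarith)]
          refine two_rpow_le ?_
          nlinarith [mul_le_mul_of_nonneg_right hκ2 (sub_nonneg.2 hjk')]

/-- The pieces decay like 2^(-κ|j-k|) with κ > 0 exactly because 1/4 < s < 1. Half of this decay is
spent in the Cauchy-Schwarz inequality that bounds the square of the sum by the sum of squares; the
other half sums the series. -/
lemma lintegral_singular_bracket_sq_le {ψ : E3 → ℝ} (hψ : IsLPCutoff ψ) {s : ℝ} (hs1 : 1 / 4 < s) (hs2 : s < 1) :
    ∃ C : ℝ≥0, ∀ (k : ℤ) (J : Set ℝ) (f : ℝ → E3 → ℝ), MeasurableSet J → MeasurableOnST J f →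
    (∀ t ∈ J, HasFourierFun (f t)) →
    ∫⁻ t in J, ∫⁻ x, ‖x‖ₑ ^ (-(3 / 2) : ℝ) * bracket k x ^ (-2 : ℝ) * ‖f t x‖ₑ ^ 2 ≤
      C * (2 ^ ((k : ℝ) * (1 / 2 - 2 * s)) *
        (⨆ j : ℤ, (2 : ℝ≥0∞) ^ (-(j : ℝ) * (1 - s)) * strichartzS ψ J j f) ^ 2) := by
  obtain ⟨κ, hκ0, hκ1, hκ2⟩ : ∃ κ : ℝ, 0 < κ ∧ κ ≤ 2 * s - 1 / 2 ∧ κ ≤ 2 * (1 - s) :=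
    ⟨min (2 * s - 1 / 2) (2 * (1 - s)), lt_min (by linarith) (by linarith), min_le_left _ _, min_le_right _ _⟩
  obtain ⟨C₁, hC₁⟩ := lintegral_singular_bracket_lpProj_sq_le hψ hκ1 hκ2
  obtain ⟨C₂, hC₂⟩ := tsum_int_le_of_abs (half_pos hκ0)
  refine ⟨C₂ * C₁ * C₂ + 1, fun k J f hJ hf hF => ?_⟩
  set B := ⨆ j : ℤ, (2 : ℝ≥0∞) ^ (-(j : ℝ) * (1 - s)) * strichartzS ψ J j f
  rcases eq_or_ne B ⊤ with hB | hB
  · rw [hB, show ((⊤ : ℝ≥0∞) ^ 2) = ⊤ by simp, ENNReal.mul_top (two_rpow_ne_zero _), ENNReal.mul_top (by simp)]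
    exact le_top
  have hS : ∀ j : ℤ, strichartzS ψ J j f ≤ 2 ^ ((j : ℝ) * (1 - s)) * B := fun j => by
    refine le_two_rpow_mul ?_
    rw [← neg_mul]
    exact le_iSup (fun j : ℤ => (2 : ℝ≥0∞) ^ (-(j : ℝ) * (1 - s)) * strichartzS ψ J j f) j
  have hm : ∀ᵐ t ∂volume.restrict J, ∀ j : ℤ, AEMeasurable (lpProj ψ j (f t)) :=
    ae_all_iff.2 fun j => (hf.lpProj hψ j).ae
  have hmt : ∀ j : ℤ, AEMeasurable (fun t => ∫⁻ x, ‖x‖ₑ ^ (-(3 / 2) : ℝ) * bracket k x ^ (-2 : ℝ) *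
      ‖lpProj ψ j (f t) x‖ₑ ^ 2) (volume.restrict J) := fun j => by
    simpa using (hf.lpProj hψ j).aemeasurable_lintegral univ
      (w := fun x => ‖x‖ₑ ^ (-(3 / 2) : ℝ) * bracket k x ^ (-2 : ℝ)) (by fun_prop) 2
  have h0 := sum_lpProj_ne_top hψ (show 0 < s by linarith) hf (m := 0) hB fun j _ => hS j
  simp only [add_zero] at h0
  calc ∫⁻ t in J, ∫⁻ x, ‖x‖ₑ ^ (-(3 / 2) : ℝ) * bracket k x ^ (-2 : ℝ) * ‖f t x‖ₑ ^ 2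
      ≤ ∫⁻ t in J, ∑' j : ℤ, C₂ * 2 ^ (κ / 2 * |(j : ℝ) - k|) *
        ∫⁻ x, ‖x‖ₑ ^ (-(3 / 2) : ℝ) * bracket k x ^ (-2 : ℝ) * ‖lpProj ψ j (f t) x‖ₑ ^ 2 := by
        refine lintegral_mono_ae ?_
        filter_upwards [h0, hm, ae_restrict_mem hJ] with t ht htm htJ
        obtain ⟨w, hw⟩ := hF t htJ
        have hpt := hw.enorm_le_tsum hψ ht
        calc ∫⁻ x, ‖x‖ₑ ^ (-(3 / 2) : ℝ) * bracket k x ^ (-2 : ℝ) * ‖f t x‖ₑ ^ 2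
            ≤ ∫⁻ x, ∑' j : ℤ, C₂ * 2 ^ (κ / 2 * |(j : ℝ) - k|) *
              (‖x‖ₑ ^ (-(3 / 2) : ℝ) * bracket k x ^ (-2 : ℝ) * ‖lpProj ψ j (f t) x‖ₑ ^ 2) := by
              refine lintegral_mono_ae ?_
              filter_upwards [hpt] with x hx
              have h1 : ‖f t x‖ₑ ^ 2 ≤ C₂ * ∑' j : ℤ, 2 ^ (κ / 2 * |(j : ℝ) - k|) * ‖lpProj ψ j (f t) x‖ₑ ^ 2 := by
                refine (pow_le_pow_left' hx 2).trans ((sq_tsum_le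
                  (b := fun j : ℤ => 2 ^ (-(κ / 2 * |(j : ℝ) - k|)))
                  (c := fun j : ℤ => 2 ^ (κ / 2 * |(j : ℝ) - k|) * ‖lpProj ψ j (f t) x‖ₑ ^ 2)
                  fun j => ?_).trans ?_)
                · rw [← mul_assoc, ← two_rpow_add]; simp
                · gcongr; exact hC₂ k
              refine (mul_le_mul_right h1 _).trans (le_of_eq ?_)
              rw [← ENNReal.tsum_mul_left, ← ENNReal.tsum_mul_left]
              congr 1; ext j; ring
          _ = _ := by
              have hmj : ∀ j : ℤ, AEMeasurable fun x : E3 =>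
                  C₂ * 2 ^ (κ / 2 * |(j : ℝ) - k|) *
                    (‖x‖ₑ ^ (-(3 / 2) : ℝ) * bracket k x ^ (-2 : ℝ) * ‖lpProj ψ j (f t) x‖ₑ ^ 2) :=
                fun j => (AEMeasurable.mul (by fun_prop) ((htm j).enorm.pow_const 2)).const_mul _
              rw [lintegral_tsum hmj]
              congr 1; ext j
              exact lintegral_const_mul' _ _ (ENNReal.mul_ne_top ENNReal.coe_ne_top (two_rpow_ne_top _))
    _ = ∑' j : ℤ, C₂ * 2 ^ (κ / 2 * |(j : ℝ) - k|) *
        ∫⁻ t in J, ∫⁻ x, ‖x‖ₑ ^ (-(3 / 2) : ℝ) * bracket k x ^ (-2 : ℝ) * ‖lpProj ψ j (f t) x‖ₑ ^ 2 := by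
        rw [lintegral_tsum fun j => (hmt j).const_mul _]
        congr 1; ext j
        exact lintegral_const_mul' _ _ (ENNReal.mul_ne_top ENNReal.coe_ne_top (two_rpow_ne_top _))
    _ ≤ ∑' j : ℤ, C₂ * 2 ^ (κ / 2 * |(j : ℝ) - k|) *
        (C₁ * (2 ^ ((k : ℝ) * (1 / 2 - 2 * s)) * 2 ^ (-(κ * |(j : ℝ) - k|)) * B ^ 2)) := by
        gcongr with j; exact hC₁ k j J f B hf (hS j)
    _ = C₂ * C₁ * (2 ^ ((k : ℝ) * (1 / 2 - 2 * s)) * B ^ 2) * ∑' j : ℤ, 2 ^ (-(κ / 2 * |(j : ℝ) - k|)) := by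
        rw [← ENNReal.tsum_mul_left]
        congr 1; ext j
        rw [show -(κ * |(j : ℝ) - k|) = -(κ / 2 * |(j : ℝ) - k|) + -(κ / 2 * |(j : ℝ) - k|) by ring,
          two_rpow_add]
        have h1 : (2 : ℝ≥0∞) ^ (κ / 2 * |(j : ℝ) - k|) * 2 ^ (-(κ / 2 * |(j : ℝ) - k|)) = 1 := by
          rw [← two_rpow_add]; simp
        calc _ = (C₂ * C₁ * (2 ^ ((k : ℝ) * (1 / 2 - 2 * s)) * B ^ 2) * 2 ^ (-(κ / 2 * |(j : ℝ) - k|))) *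
              ((2 : ℝ≥0∞) ^ (κ / 2 * |(j : ℝ) - k|) * 2 ^ (-(κ / 2 * |(j : ℝ) - k|))) := by ring
          _ = _ := by rw [h1, mul_one]
    _ ≤ C₂ * C₁ * (2 ^ ((k : ℝ) * (1 / 2 - 2 * s)) * B ^ 2) * C₂ := by gcongr; exact hC₂ k
    _ = (C₂ * C₁ * C₂) * (2 ^ ((k : ℝ) * (1 / 2 - 2 * s)) * B ^ 2) := by ring
    _ ≤ _ := by push_cast; gcongr; exact le_self_add

lemma lintegral_bracket_sq_le : ∃ C : ℝ≥0, ∀ (k : ℤ) (J : Set ℝ) (F : ℝ → E3 → ℝ), MeasurableOnST J F →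
    ∫⁻ t in J, ∫⁻ x, bracket k x ^ (-2 : ℝ) * ‖F t x‖ₑ ^ 2 ≤
      C * (2 ^ (-(k : ℝ)) * localEnergyNorm k J F ^ 2) := by
  obtain ⟨C, hC⟩ := tsum_two_rpow zero_lt_one
  refine ⟨4 * C, fun k J F hF => ?_⟩
  refine (lintegral_layers_sq_le hF k (c := fun n : ℕ => 2 ^ (2 - 2 * (n : ℝ))) (fun x _ => ?_)
    fun x n hx => bracket_rpow_le_of_notMem (by norm_num) hx).trans ?_
  · refine (bracket_rpow_le_one k x (by norm_num)).trans ?_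
    norm_num
  · rw [← mul_assoc]
    gcongr
    rw [ENNReal.coe_mul, ← hC, ← ENNReal.tsum_mul_left, ← ENNReal.tsum_mul_right]
    refine le_of_eq ?_
    congr 1; ext n
    have h4 : ((4 : ℝ≥0) : ℝ≥0∞) = 2 ^ (2 : ℝ) := by norm_num
    rw [h4, ← two_rpow_add, ← two_rpow_add, ← two_rpow_add]
    congr 1; ring

lemma IsLPCutoff.enorm_scaled_le {ψ : E3 → ℝ} (hψ : IsLPCutoff ψ) (k : ℤ) (x : E3) :
    ‖ψ ((2 : ℝ) ^ k • x)‖ₑ ≤ 9 * bracket k x ^ (-2 : ℝ) := by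
  rcases le_total 2 ‖(2 : ℝ) ^ k • x‖ with h | h
  · rw [hψ.eq_zero _ h]; simp
  · have h1 : ‖ψ ((2 : ℝ) ^ k • x)‖ₑ ≤ 1 := by
      rw [Real.enorm_of_nonneg (hψ.nonneg _)]; simpa using hψ.le_one _
    have h2 : bracket k x ≤ 3 := by
      have h3 : 2 ^ (k : ℝ) * ‖x‖ₑ ≤ 2 := by
        rw [← ofReal_two_zpow, ← ofReal_norm, ← ENNReal.ofReal_mul (by positivity)]
        rw [norm_smul, Real.norm_of_nonneg (by positivity)] at h
        simpa using ENNReal.ofReal_le_ofReal h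
      calc bracket k x ≤ 1 + 2 := by unfold bracket; gcongr
        _ = 3 := by norm_num
    refine h1.trans ?_
    rw [ENNReal.rpow_neg, ← div_eq_mul_inv, ENNReal.le_div_iff_mul_le
      (Or.inl (ENNReal.rpow_pos (zero_lt_one.trans_le (one_le_bracket k x)) (bracket_ne_top k x)).ne')
      (Or.inl (ENNReal.rpow_ne_top_of_nonneg (by norm_num) (bracket_ne_top k x))), one_mul]
    calc bracket k x ^ (2 : ℝ) ≤ 3 ^ (2 : ℝ) := by gcongr
      _ = 9 := by norm_num

/-- `L^{4/3}` bound for the smoothing operator with respect to the `A₁` weight `1 / |x|`. -/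
lemma lintegral_rpow_opI_le {ψ : E3 → ℝ} (hψ : IsLPCutoff ψ) {ε : ℝ} (hε : ε < 1 / 2) : ∃ C : ℝ≥0,
    ∀ (k : ℤ) (F : E3 → ℝ), AEMeasurable F →
    ∫⁻ x, ‖opI ψ ε k F x * ψ ((2 : ℝ) ^ k • x) * (1 / ‖x‖ ^ (3 / 4 : ℝ))‖ₑ ^ (4 / 3 : ℝ) ≤
      C * ∫⁻ y, ‖y‖ₑ ^ (-1 : ℝ) * bracket k y ^ (-2 : ℝ) * ‖F y‖ₑ ^ (4 / 3 : ℝ) := by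
  have hδ : 0 < 1 / 2 - ε := by linarith
  obtain ⟨C₁, hC₁⟩ := hψ.opI_le
  obtain ⟨C₂, hC₂⟩ := lintegral_smoothingKernel hδ
  obtain ⟨C₃, hC₃⟩ := lintegral_smoothingKernel_singular hδ
  refine ⟨9 * C₁ ^ (4 / 3 : ℝ) * C₂ ^ (1 / 3 : ℝ) * C₃, fun k F hF => ?_⟩
  set C₀ : ℝ≥0∞ := 9 * C₁ ^ (4 / 3 : ℝ) * C₂ ^ (1 / 3 : ℝ)
  have hC₀ : C₀ ≠ ⊤ := by
    have h1 : (C₁ : ℝ≥0∞) ^ (4 / 3 : ℝ) ≠ ⊤ := ENNReal.rpow_ne_top_of_nonneg (by norm_num) ENNReal.coe_ne_top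
    have h2 : (C₂ : ℝ≥0∞) ^ (1 / 3 : ℝ) ≠ ⊤ := ENNReal.rpow_ne_top_of_nonneg (by norm_num) ENNReal.coe_ne_top
    finiteness
  have hpt : ∀ x : E3, x ≠ 0 →
      ‖opI ψ ε k F x * ψ ((2 : ℝ) ^ k • x) * (1 / ‖x‖ ^ (3 / 4 : ℝ))‖ₑ ^ (4 / 3 : ℝ) ≤
      C₀ * ∫⁻ y, ‖x‖ₑ ^ (-1 : ℝ) * bracket k x ^ (-2 : ℝ) *
        (smoothingKernel (1 / 2 - ε) k (x - y) * ‖F y‖ₑ ^ (4 / 3 : ℝ)) := by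
    intro x hx
    have hx' : ‖x‖ ^ (3 / 4 : ℝ) ≠ 0 := (Real.rpow_pos_of_pos (norm_pos_iff.2 hx) _).ne'
    have hA : AEMeasurable fun y => smoothingKernel (1 / 2 - ε) k (x - y) := by fun_prop
    have h1 : ‖1 / ‖x‖ ^ (3 / 4 : ℝ)‖ₑ ^ (4 / 3 : ℝ) = ‖x‖ₑ ^ (-1 : ℝ) := by
      rw [one_div, enorm_inv hx', enorm_norm_rpow _ (by norm_num), ← ENNReal.rpow_neg, ← ENNReal.rpow_mul]
      norm_num
    have h2 : ‖ψ ((2 : ℝ) ^ k • x)‖ₑ ^ (4 / 3 : ℝ) ≤ 9 * bracket k x ^ (-2 : ℝ) := by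
      have hle : ‖ψ ((2 : ℝ) ^ k • x)‖ₑ ≤ 1 := by
        rw [Real.enorm_of_nonneg (hψ.nonneg _)]; simpa using hψ.le_one _
      refine le_trans ?_ (hψ.enorm_scaled_le k x)
      simpa using ENNReal.rpow_le_rpow_of_exponent_ge hle (show (1 : ℝ) ≤ 4 / 3 by norm_num)
    have h3 : ‖opI ψ ε k F x‖ₑ ^ (4 / 3 : ℝ) ≤ C₁ ^ (4 / 3 : ℝ) * (C₂ ^ (1 / 3 : ℝ) *
        ∫⁻ y, smoothingKernel (1 / 2 - ε) k (x - y) * ‖F y‖ₑ ^ (4 / 3 : ℝ)) := by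
      refine (ENNReal.rpow_le_rpow (hC₁ ε k F x hF) (by norm_num)).trans ?_
      rw [ENNReal.mul_rpow_of_nonneg _ _ (by norm_num)]
      gcongr
      refine (rpow_lintegral_kernel_mul_le hA hF.enorm).trans ?_
      gcongr
      exact hC₂ k x
    rw [enorm_mul, enorm_mul, ENNReal.mul_rpow_of_nonneg _ _ (by norm_num),
      ENNReal.mul_rpow_of_nonneg _ _ (by norm_num), h1]
    have h4 := lintegral_const_mul'' (‖x‖ₑ ^ (-1 : ℝ) * bracket k x ^ (-2 : ℝ))
      (hA.mul (hF.enorm.pow_const (4 / 3 : ℝ)))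
    simp only [Pi.mul_apply] at h4
    rw [h4]
    calc _ ≤ (C₁ ^ (4 / 3 : ℝ) * (C₂ ^ (1 / 3 : ℝ) *
        ∫⁻ y, smoothingKernel (1 / 2 - ε) k (x - y) * ‖F y‖ₑ ^ (4 / 3 : ℝ))) *
          (9 * bracket k x ^ (-2 : ℝ)) * ‖x‖ₑ ^ (-1 : ℝ) := by gcongr
      _ = _ := by simp only [C₀]; ring
  calc _ ≤ ∫⁻ x, C₀ * ∫⁻ y, ‖x‖ₑ ^ (-1 : ℝ) * bracket k x ^ (-2 : ℝ) *
        (smoothingKernel (1 / 2 - ε) k (x - y) * ‖F y‖ₑ ^ (4 / 3 : ℝ)) := by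
        refine lintegral_mono_ae ?_
        filter_upwards [Measure.ae_ne volume (0 : E3)] with x hx using hpt x hx
    _ = C₀ * ∫⁻ y, ∫⁻ x, ‖x‖ₑ ^ (-1 : ℝ) * bracket k x ^ (-2 : ℝ) *
        (smoothingKernel (1 / 2 - ε) k (x - y) * ‖F y‖ₑ ^ (4 / 3 : ℝ)) := by
        rw [lintegral_const_mul' _ _ hC₀, lintegral_lintegral_swap]
        refine AEMeasurable.mul (by fun_prop) (AEMeasurable.mul ?_ (AEMeasurable.pow_const ?_ _))
        · exact ((measurable_smoothingKernel _ k).comp (by fun_prop : Measurable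
            fun p : E3 × E3 => p.1 - p.2)).aemeasurable
        · exact (hF.comp_quasiMeasurePreserving Measure.quasiMeasurePreserving_snd).enorm
    _ ≤ C₀ * ∫⁻ y, C₃ * (‖y‖ₑ ^ (-1 : ℝ) * bracket k y ^ (-2 : ℝ) * ‖F y‖ₑ ^ (4 / 3 : ℝ)) := by
        refine mul_le_mul_right (lintegral_mono fun y => ?_) _
        calc _ = ∫⁻ x, smoothingKernel (1 / 2 - ε) k (y - x) * (‖x‖ₑ ^ (-1 : ℝ) * bracket k x ^ (-2 : ℝ)) *
                ‖F y‖ₑ ^ (4 / 3 : ℝ) := by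
              congr 1; ext x; rw [smoothingKernel_sub_comm]; ring
          _ = (∫⁻ x, smoothingKernel (1 / 2 - ε) k (y - x) * (‖x‖ₑ ^ (-1 : ℝ) * bracket k x ^ (-2 : ℝ))) *
                ‖F y‖ₑ ^ (4 / 3 : ℝ) :=
              lintegral_mul_const' _ _ (ENNReal.rpow_ne_top_of_nonneg (by norm_num) enorm_ne_top)
          _ ≤ C₃ * (‖y‖ₑ ^ (-1 : ℝ) * bracket k y ^ (-2 : ℝ)) * ‖F y‖ₑ ^ (4 / 3 : ℝ) := by
              gcongr; exact hC₃ k y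
          _ = _ := by ring
    _ = _ := by
        rw [lintegral_const_mul' _ _ ENNReal.coe_ne_top]
        simp only [C₀]
        push_cast
        rw [ENNReal.coe_rpow_of_nonneg _ (by norm_num), ENNReal.coe_rpow_of_nonneg _ (by norm_num)]
        ring

/-- Hölder with exponents 3/2 and 3. All of the singularity goes to f, since |x|^(-1) is the 2/3
power of |x|^(-3/2), and the bracket is shared between both factors. -/
lemma lintegral_lintegral_holder_le {J : Set ℝ} {f g : ℝ → E3 → ℝ} (hf : MeasurableOnST J f)
    (hg : MeasurableOnST J g) (k : ℤ) :
    ∫⁻ t in J, ∫⁻ x, ‖x‖ₑ ^ (-1 : ℝ) * bracket k x ^ (-2 : ℝ) * (‖f t x‖ₑ * ‖g t x‖ₑ) ^ (4 / 3 : ℝ) ≤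
      (∫⁻ t in J, ∫⁻ x, ‖x‖ₑ ^ (-(3 / 2) : ℝ) * bracket k x ^ (-2 : ℝ) * ‖f t x‖ₑ ^ 2) ^ (2 / 3 : ℝ) *
      (∫⁻ t in J, ∫⁻ x, bracket k x ^ (-2 : ℝ) * ‖g t x ^ 2‖ₑ ^ 2) ^ (1 / 3 : ℝ) := by
  have hf' := hf.aemeasurable.enorm
  have hg' := hg.aemeasurable.enorm
  set a : ℝ × E3 → ℝ≥0∞ := fun p => (‖p.2‖ₑ ^ (-(3 / 2) : ℝ) * bracket k p.2 ^ (-2 : ℝ)) ^ (2 / 3 : ℝ) *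
    ‖f p.1 p.2‖ₑ ^ (4 / 3 : ℝ)
  set b : ℝ × E3 → ℝ≥0∞ := fun p => (bracket k p.2 ^ (-2 : ℝ)) ^ (1 / 3 : ℝ) * ‖g p.1 p.2‖ₑ ^ (4 / 3 : ℝ)
  have ha : AEMeasurable a ((volume.restrict J).prod volume) :=
    AEMeasurable.mul (by fun_prop) (hf'.pow_const _)
  have hb : AEMeasurable b ((volume.restrict J).prod volume) :=
    AEMeasurable.mul (by fun_prop) (hg'.pow_const _)
  have h := ENNReal.lintegral_mul_le_Lp_mul_Lq _ (p := 3 / 2) (q := 3)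
    (by rw [Real.holderConjugate_iff]; norm_num) ha hb
  have e1 : ∀ p, (a * b) p = ‖p.2‖ₑ ^ (-1 : ℝ) * bracket k p.2 ^ (-2 : ℝ) *
      (‖f p.1 p.2‖ₑ * ‖g p.1 p.2‖ₑ) ^ (4 / 3 : ℝ) := fun p => by
    simp only [a, b, Pi.mul_apply]
    rw [ENNReal.mul_rpow_of_nonneg _ _ (by norm_num), ENNReal.mul_rpow_of_nonneg _ _ (by norm_num),
      ← ENNReal.rpow_mul, ← ENNReal.rpow_mul, ← ENNReal.rpow_mul,
      show (-(3 / 2) * (2 / 3) : ℝ) = -1 by norm_num,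
      show (-2 : ℝ) = -2 * (2 / 3) + -2 * (1 / 3) by norm_num, bracket_rpow_add]
    ring_nf
  have e2 : ∀ p, a p ^ (3 / 2 : ℝ) = ‖p.2‖ₑ ^ (-(3 / 2) : ℝ) * bracket k p.2 ^ (-2 : ℝ) * ‖f p.1 p.2‖ₑ ^ 2 :=
    fun p => by
    simp only [a]
    rw [ENNReal.mul_rpow_of_nonneg _ _ (by norm_num), ← ENNReal.rpow_mul, ← ENNReal.rpow_mul]
    norm_num
  have e3 : ∀ p, b p ^ (3 : ℝ) = bracket k p.2 ^ (-2 : ℝ) * ‖g p.1 p.2 ^ 2‖ₑ ^ 2 := fun p => by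
    simp only [b]
    have h4 : (‖g p.1 p.2‖ₑ ^ (4 / 3 : ℝ)) ^ (3 : ℝ) = ‖g p.1 p.2‖ₑ ^ (2 * 2) := by
      rw [← ENNReal.rpow_mul, ← ENNReal.rpow_natCast]; norm_num
    rw [ENNReal.mul_rpow_of_nonneg _ _ (by norm_num), ← ENNReal.rpow_mul, enorm_pow, ← pow_mul, h4]
    norm_num
  have m1 := ha.mul hb
  have m2 := ha.pow_const (3 / 2 : ℝ)
  have m3 := hb.pow_const (3 : ℝ)
  rw [lintegral_prod _ m1, lintegral_prod _ m2, lintegral_prod _ m3] at h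
  simp only [e1, e2, e3] at h
  norm_num at h ⊢
  exact h

/-- After I is removed, M and h are bounded and Hölder leaves two weighted norms. The exponents
combine as (2/3)(1/2 - 2s) - 1/3 = -4s/3, the power 4/3 of the claimed factor. -/
lemma trilinear_near_origin {ψ : E3 → ℝ} (hψ : IsLPCutoff ψ) {ε : ℝ} (hε : ε < 1 / 2) {s : ℝ}
    (hs1 : 1 / 4 < s) (hs2 : s < 1) {c : ℝ} (hc : 0 < c)
    (K : ℝ) : ∃ C : ℝ≥0, ∀ k : ℤ, ∀ J : Set ℝ, MeasurableSet J → ∀ M : E3 → ℝ,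
    AEStronglyMeasurable M volume → (∀ x, |M x| ≤ K * Real.exp (-c * ‖x‖)) → ∀ f g h : ℝ → E3 → ℝ,
    MeasurableOnST J f → MeasurableOnST J g → MeasurableOnST J h → (∀ t ∈ J, HasFourierFun (f t)) →
    stNorm (4 / 3) (4 / 3) J univ (fun t x => opI ψ ε k (fun y => M y * f t y * g t y * h t y) x *
      ψ ((2 : ℝ) ^ k • x) * (1 / ‖x‖ ^ (3 / 4 : ℝ))) ≤
    C * ((2 : ℝ≥0∞) ^ (-(k : ℝ) * s) *
      (⨆ j : ℤ, (2 : ℝ≥0∞) ^ (-(j : ℝ) * (1 - s)) * strichartzS ψ J j f) *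
      localEnergyNorm k J (fun t x => g t x ^ 2) ^ (1 / 2 : ℝ) * stNorm ⊤ ⊤ J univ h) := by
  obtain ⟨C₁, hC₁⟩ := lintegral_rpow_opI_le hψ hε
  obtain ⟨C₂, hC₂⟩ := enorm_le_bracket hc K
  obtain ⟨C₃, hC₃⟩ := lintegral_singular_bracket_sq_le hψ hs1 hs2
  obtain ⟨C₄, hC₄⟩ := lintegral_bracket_sq_le
  refine ⟨(C₁ * C₂ ^ (4 / 3 : ℝ) * C₃ ^ (2 / 3 : ℝ) * C₄ ^ (1 / 3 : ℝ)) ^ (3 / 4 : ℝ),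
    fun k J hJ M hMm hM f g h hf hg hh hF => ?_⟩
  set B := ⨆ j : ℤ, (2 : ℝ≥0∞) ^ (-(j : ℝ) * (1 - s)) * strichartzS ψ J j f
  set L := localEnergyNorm k J (fun t x => g t x ^ 2)
  set H := stNorm ⊤ ⊤ J univ h
  have hG : MeasurableOnST J fun t x => g t x ^ 2 := AEStronglyMeasurable.pow hg 2
  have hMf : MeasurableOnST J fun t x => M x * f t x * g t x * h t x :=
    (((MeasurableOnST.of_space hMm J).mul hf).mul hg).mul hh
  set v : E3 → ℝ≥0∞ := fun y => ‖y‖ₑ ^ (-1 : ℝ) * bracket k y ^ (-2 : ℝ)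
  have hv : Measurable v := by fun_prop
  have hUm : AEMeasurable (Function.uncurry fun t y => v y * (‖f t y‖ₑ * ‖g t y‖ₑ) ^ (4 / 3 : ℝ))
      ((volume.restrict J).prod volume) :=
    AEMeasurable.mul (by fun_prop) ((hf.aemeasurable.enorm.mul hg.aemeasurable.enorm).pow_const _)
  have h43 : (4 / 3 : ℝ≥0∞) = ENNReal.ofReal (4 / 3) := by
    rw [ENNReal.ofReal_div_of_pos (by norm_num)]; simp
  rw [h43, ← ENNReal.rpow_le_rpow_iff (show (0 : ℝ) < 4 / 3 by norm_num), stNorm_rpow (by norm_num)]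
  simp only [Measure.restrict_univ]
  calc _ ≤ ∫⁻ t in J, C₁ * ∫⁻ y, v y * ‖M y * f t y * g t y * h t y‖ₑ ^ (4 / 3 : ℝ) := by
        refine lintegral_mono_ae ?_
        filter_upwards [hMf.ae] with t ht using hC₁ k _ ht
    _ = C₁ * ∫⁻ t in J, ∫⁻ y, v y * ‖M y * f t y * g t y * h t y‖ₑ ^ (4 / 3 : ℝ) :=
        lintegral_const_mul' _ _ ENNReal.coe_ne_top
    _ ≤ C₁ * ∫⁻ t in J, ∫⁻ y, v y * (‖f t y‖ₑ * ‖g t y‖ₑ) ^ (4 / 3 : ℝ) * (C₂ * H) ^ (4 / 3 : ℝ) := by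
        refine mul_le_mul_right (lintegral_mono_ae ?_) _
        filter_upwards [ae_ae_le_stNorm_top J h] with t ht
        refine lintegral_mono_ae ?_
        filter_upwards [ht] with y hy
        rw [mul_assoc (v y), ← ENNReal.mul_rpow_of_nonneg _ _ (by norm_num)]
        refine mul_le_mul_right (ENNReal.rpow_le_rpow ?_ (by norm_num)) _
        rw [enorm_mul, enorm_mul, enorm_mul]
        have hMy : ‖M y‖ₑ ≤ C₂ := (hC₂ M hM y).trans
          (mul_le_of_le_one_right' (bracket_rpow_le_one 0 y zero_le_one))
        calc ‖M y‖ₑ * ‖f t y‖ₑ * ‖g t y‖ₑ * ‖h t y‖ₑ ≤ C₂ * ‖f t y‖ₑ * ‖g t y‖ₑ * H := by gcongr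
          _ = _ := by ring
    _ = C₁ * ((∫⁻ t in J, ∫⁻ y, v y * (‖f t y‖ₑ * ‖g t y‖ₑ) ^ (4 / 3 : ℝ)) * (C₂ * H) ^ (4 / 3 : ℝ)) := by
        rw [lintegral_lintegral_mul_const hUm]
    _ ≤ C₁ * (((C₃ * (2 ^ ((k : ℝ) * (1 / 2 - 2 * s)) * B ^ 2)) ^ (2 / 3 : ℝ) *
          (C₄ * (2 ^ (-(k : ℝ)) * L ^ 2)) ^ (1 / 3 : ℝ)) * (C₂ * H) ^ (4 / 3 : ℝ)) := by
        gcongr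
        refine (lintegral_lintegral_holder_le hf hg k).trans ?_
        gcongr
        · exact hC₃ k J f hJ hf hF
        · exact hC₄ k J _ hG
    _ = _ := by
        have hp : ∀ (x : ℝ≥0∞) (a b : ℝ), (x ^ a) ^ b = x ^ (a * b) := fun x a b => (ENNReal.rpow_mul x a b).symm
        rw [ENNReal.coe_rpow_of_nonneg _ (by norm_num)]
        push_cast
        rw [ENNReal.coe_rpow_of_nonneg _ (by norm_num), ENNReal.coe_rpow_of_nonneg _ (by norm_num),
          ENNReal.coe_rpow_of_nonneg _ (by norm_num)]
        rw [← ENNReal.rpow_ofNat B, ← ENNReal.rpow_ofNat L]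
        simp only [ENNReal.mul_rpow_of_nonneg _ _ (show (0 : ℝ) ≤ 4 / 3 by norm_num),
          ENNReal.mul_rpow_of_nonneg _ _ (show (0 : ℝ) ≤ 3 / 4 by norm_num),
          ENNReal.mul_rpow_of_nonneg _ _ (show (0 : ℝ) ≤ 2 / 3 by norm_num),
          ENNReal.mul_rpow_of_nonneg _ _ (show (0 : ℝ) ≤ 1 / 3 by norm_num), hp]
        have h2 : (2 : ℝ≥0∞) ^ (-(k : ℝ) * s * (4 / 3)) =
            2 ^ ((k : ℝ) * (1 / 2 - 2 * s) * (2 / 3)) * 2 ^ (-(k : ℝ) * (1 / 3)) := by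
          rw [← two_rpow_add]; congr 1; ring
        rw [h2]
        norm_num
        ring

/-! ### The cubic high-frequency estimate -/

/-- Expand the square and order each pair of indices, so that one factor always carries the highest
frequency. -/
lemma sq_tsum_le_two_mul (a : ℕ → ℝ≥0∞) :
    (∑' n, a n) ^ 2 ≤ 2 * ∑' n, a n * ∑ i ∈ Finset.range (n + 1), a i := by
  have h : ∀ N, (∑ n ∈ Finset.range N, a n) ^ 2 ≤
      2 * ∑ n ∈ Finset.range N, a n * ∑ i ∈ Finset.range (n + 1), a i := by
    intro N
    induction N with
    | zero => simp
    | succ N ih =>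
      rw [Finset.sum_range_succ, Finset.sum_range_succ _ N, Finset.sum_range_succ _ N, mul_add, add_sq]
      calc (∑ n ∈ Finset.range N, a n) ^ 2 + 2 * (∑ n ∈ Finset.range N, a n) * a N + a N ^ 2
          ≤ 2 * (∑ n ∈ Finset.range N, a n * ∑ i ∈ Finset.range (n + 1), a i) +
            2 * (∑ n ∈ Finset.range N, a n) * a N + 2 * a N ^ 2 := by
            gcongr
            exact le_mul_of_one_le_left' (by norm_num)
        _ = _ := by ring
  refine le_of_tendsto' (ENNReal.Tendsto.pow (n := 2) (ENNReal.tendsto_nat_tsum a)) fun N => (h N).trans ?_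
  gcongr
  exact ENNReal.sum_le_tsum _

lemma sum_two_rpow_le {δ : ℝ} (hδ : 0 < δ) : ∃ C : ℝ≥0, ∀ (m : ℤ) (n : ℕ),
    ∑ i ∈ Finset.range (n + 1), (2 : ℝ≥0∞) ^ (((i : ℝ) + m) * δ) ≤ C * 2 ^ (((n : ℝ) + m) * δ) := by
  obtain ⟨C, hC⟩ := tsum_two_rpow hδ
  refine ⟨C, fun m n => ?_⟩
  rw [← Finset.sum_range_reflect, ← hC, ← ENNReal.tsum_mul_right]
  refine le_trans (Finset.sum_le_sum fun i hi => ?_) (ENNReal.sum_le_tsum (Finset.range (n + 1)))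
  rw [← two_rpow_add]
  refine two_rpow_le (le_of_eq ?_)
  have : i ≤ n := by simpa [Nat.lt_succ_iff] using hi
  rw [show n + 1 - 1 - i = n - i by omega, Nat.cast_sub this]
  ring

/-- Weighted Cauchy-Schwarz: growth at the rate 2^(δi) makes the last term dominate the sum, so
nothing is lost compared with that term alone. -/
lemma lintegral_sq_sum_le {δ : ℝ} (hδ : 0 < δ) : ∃ C : ℝ≥0, ∀ {α : Type} [MeasurableSpace α] (μ : Measure α)
    (N : ℕ → α → ℝ≥0∞) (m : ℤ) (B : ℝ≥0∞), (∀ n, AEMeasurable (N n) μ) →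
    (∀ n : ℕ, ∫⁻ t, N n t ^ 2 ∂μ ≤ (2 ^ (((n : ℝ) + m) * δ) * B) ^ 2) → ∀ n : ℕ,
    ∫⁻ t, (∑ i ∈ Finset.range (n + 1), N i t) ^ 2 ∂μ ≤ C * (2 ^ (((n : ℝ) + m) * δ) * B) ^ 2 := by
  obtain ⟨C, hC⟩ := sum_two_rpow_le hδ
  refine ⟨C * C, fun {α} _ μ N m B hN hB n => ?_⟩
  have hpt : ∀ t, (∑ i ∈ Finset.range (n + 1), N i t) ^ 2 ≤ C * 2 ^ (((n : ℝ) + m) * δ) *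
      ∑ i ∈ Finset.range (n + 1), 2 ^ (-(((i : ℝ) + m) * δ)) * N i t ^ 2 := fun t => by
    rw [← Finset.tsum_subtype]
    refine (sq_tsum_le (b := fun i : {i // i ∈ Finset.range (n + 1)} => 2 ^ ((((i : ℕ) : ℝ) + m) * δ))
      (c := fun i => 2 ^ (-((((i : ℕ) : ℝ) + m) * δ)) * N i t ^ 2) fun i => ?_).trans ?_
    · rw [← mul_assoc, ← two_rpow_add]; simp
    · rw [Finset.tsum_subtype (Finset.range (n + 1)) fun i => (2 : ℝ≥0∞) ^ (((i : ℝ) + m) * δ),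
        Finset.tsum_subtype (Finset.range (n + 1)) fun i => 2 ^ (-(((i : ℝ) + m) * δ)) * N i t ^ 2]
      gcongr
      exact hC m n
  calc _ ≤ ∫⁻ t, C * 2 ^ (((n : ℝ) + m) * δ) *
        ∑ i ∈ Finset.range (n + 1), 2 ^ (-(((i : ℝ) + m) * δ)) * N i t ^ 2 ∂μ := lintegral_mono hpt
    _ = C * 2 ^ (((n : ℝ) + m) * δ) *
        ∑ i ∈ Finset.range (n + 1), 2 ^ (-(((i : ℝ) + m) * δ)) * ∫⁻ t, N i t ^ 2 ∂μ := by
        rw [lintegral_const_mul' _ _ (ENNReal.mul_ne_top ENNReal.coe_ne_top (two_rpow_ne_top _)),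
          lintegral_finsetSum' _ fun i _ => ((hN i).pow_const 2).const_mul _]
        congr 1
        refine Finset.sum_congr rfl fun i _ => lintegral_const_mul' _ _ (two_rpow_ne_top _)
    _ ≤ C * 2 ^ (((n : ℝ) + m) * δ) *
        ∑ i ∈ Finset.range (n + 1), 2 ^ (((i : ℝ) + m) * δ) * B ^ 2 := by
        refine mul_le_mul_right (Finset.sum_le_sum fun i _ => ?_) _
        refine (mul_le_mul_right (hB i) _).trans (le_of_eq ?_)
        rw [mul_pow, two_rpow_sq, ← mul_assoc, ← two_rpow_add]
        congr 2; ring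
    _ = C * 2 ^ (((n : ℝ) + m) * δ) *
        ((∑ i ∈ Finset.range (n + 1), 2 ^ (((i : ℝ) + m) * δ)) * B ^ 2) := by rw [Finset.sum_mul]
    _ ≤ C * 2 ^ (((n : ℝ) + m) * δ) * (C * 2 ^ (((n : ℝ) + m) * δ) * B ^ 2) := by gcongr; exact hC m n
    _ = _ := by push_cast; ring

/-- In the quartic integral frequencies are ordered; sup norms N bound the lower ones and the top
one stays in the weighted L² norm. The integrand is then at most 4 X Y for functions X, Y of time
alone, and Cauchy-Schwarz in time bounds its square root. -/
lemma lintegral_sqrt_singular_le {ψ : E3 → ℝ} (hψ : IsLPCutoff ψ) {θ δ : ℝ} (hθ0 : 0 < θ) (hθ1 : θ < 1 / 2)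
    (hδ : 0 < δ) (hγ : 0 < θ + 1 / 2 - 2 * δ) : ∃ C : ℝ≥0, ∀ (m : ℤ) (J : Set ℝ) (f : ℝ → E3 → ℝ) (B : ℝ≥0∞),
    MeasurableOnST J f → (∀ n : ℕ, strichartzS ψ J (n + m) f ≤ 2 ^ (((n : ℝ) + m) * δ) * B) →
    ∫⁻ t in J, (∫⁻ y, ‖y‖ₑ ^ (-(2 - 2 * θ)) * (∑' n : ℕ, ‖lpProj ψ (n + m) (f t) y‖ₑ) ^ 4) ^ (1 / 2 : ℝ) ≤
      C * (2 ^ (-((θ + 1 / 2 - 2 * δ) * m)) * B ^ 2) := by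
  obtain ⟨C₁, hC₁⟩ := lintegral_singular_lpProj_sq_le hψ (a := 2 - 2 * θ) (by linarith) (by linarith)
  obtain ⟨C₂, hC₂⟩ := tsum_two_rpow hγ
  obtain ⟨C₃, hC₃⟩ := lintegral_sq_sum_le hδ
  refine ⟨2 * (C₁ * C₂) ^ (1 / 2 : ℝ) * (C₃ * C₂) ^ (1 / 2 : ℝ), fun m J f B hf hS => ?_⟩
  set γ := θ + 1 / 2 - 2 * δ with hγd
  set u : ℕ → ℝ → E3 → ℝ≥0∞ := fun n t y => ‖lpProj ψ (n + m) (f t) y‖ₑ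
  set N : ℕ → ℝ → ℝ≥0∞ := fun n t => eLpNorm (lpProj ψ (n + m) (f t)) ⊤ volume
  -- The exponent 1/2 + θ balances the two sums: in both, the term of frequency n + m has time
  -- integral of order 2^(-(n+m)γ) B².
  set X : ℝ → ℝ≥0∞ := fun t => ∑' n : ℕ, 2 ^ (((n : ℝ) + m) * (1 / 2 + θ)) *
    ∫⁻ y, ‖y‖ₑ ^ (-(2 - 2 * θ)) * u n t y ^ 2
  set Y : ℝ → ℝ≥0∞ := fun t => ∑' n : ℕ, 2 ^ (-(((n : ℝ) + m) * (1 / 2 + θ))) *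
    (∑ i ∈ Finset.range (n + 1), N i t) ^ 2
  have hNm : ∀ n, AEMeasurable (N n) (volume.restrict J) := fun n => (hf.lpProj hψ _).aemeasurable_eLpNorm_top
  have hXm : ∀ n : ℕ, AEMeasurable (fun t => ∫⁻ y, ‖y‖ₑ ^ (-(2 - 2 * θ)) * u n t y ^ 2) (volume.restrict J) :=
    fun n => by
    simpa using (hf.lpProj hψ (n + m)).aemeasurable_lintegral univ (w := fun x => ‖x‖ₑ ^ (-(2 - 2 * θ)))
      (by fun_prop) 2
  have hYm : ∀ n : ℕ, AEMeasurable (fun t => (∑ i ∈ Finset.range (n + 1), N i t) ^ 2) (volume.restrict J) :=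
    fun n => (Finset.aemeasurable_fun_sum _ fun i _ => hNm i).pow_const 2
  have hum : ∀ᵐ t ∂volume.restrict J, ∀ n : ℕ, AEMeasurable (lpProj ψ (n + m) (f t)) :=
    ae_all_iff.2 fun n => (hf.lpProj hψ (n + m)).ae
  have hpt : ∀ᵐ t ∂volume.restrict J, ∫⁻ y, ‖y‖ₑ ^ (-(2 - 2 * θ)) * (∑' n : ℕ, u n t y) ^ 4 ≤
      4 * (X t * Y t) := by
    filter_upwards [hum] with t ht
    have hbd : ∀ᵐ y, ∀ n, u n t y ≤ N n t := ae_all_iff.2 fun n => by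
      filter_upwards [ae_le_eLpNormEssSup (f := lpProj ψ (n + m) (f t)) (μ := volume)] with y hy
      simpa only [N, eLpNorm_exponent_top] using hy
    have hterm : ∀ n : ℕ, AEMeasurable fun y => 2 ^ (((n : ℝ) + m) * (1 / 2 + θ)) *
        (‖y‖ₑ ^ (-(2 - 2 * θ)) * u n t y ^ 2) := fun n =>
      (AEMeasurable.mul (by fun_prop) ((ht n).enorm.pow_const 2)).const_mul _
    calc ∫⁻ y, ‖y‖ₑ ^ (-(2 - 2 * θ)) * (∑' n : ℕ, u n t y) ^ 4
        ≤ ∫⁻ y, (∑' n : ℕ, 2 ^ (((n : ℝ) + m) * (1 / 2 + θ)) * (‖y‖ₑ ^ (-(2 - 2 * θ)) * u n t y ^ 2)) *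
            (4 * Y t) := by
          refine lintegral_mono_ae ?_
          filter_upwards [hbd] with y hy
          have h1 : (∑' n, u n t y) ^ 2 ≤ 2 * ∑' n, u n t y * ∑ i ∈ Finset.range (n + 1), N i t := by
            refine (sq_tsum_le_two_mul _).trans ?_
            gcongr with n i
            exact hy i
          have h2 := sq_tsum_le (a := fun n : ℕ => u n t y * ∑ i ∈ Finset.range (n + 1), N i t)
            (b := fun n : ℕ => 2 ^ (((n : ℝ) + m) * (1 / 2 + θ)) * u n t y ^ 2)
            (c := fun n : ℕ => 2 ^ (-(((n : ℝ) + m) * (1 / 2 + θ))) * (∑ i ∈ Finset.range (n + 1), N i t) ^ 2)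
            fun n => by
              rw [mul_mul_mul_comm, ← two_rpow_add, add_neg_cancel, ENNReal.rpow_zero, one_mul, mul_pow]
          calc ‖y‖ₑ ^ (-(2 - 2 * θ)) * (∑' n : ℕ, u n t y) ^ 4
              = ‖y‖ₑ ^ (-(2 - 2 * θ)) * ((∑' n : ℕ, u n t y) ^ 2) ^ 2 := by rw [← pow_mul]
            _ ≤ ‖y‖ₑ ^ (-(2 - 2 * θ)) * (2 * ∑' n, u n t y * ∑ i ∈ Finset.range (n + 1), N i t) ^ 2 := by gcongr
            _ = ‖y‖ₑ ^ (-(2 - 2 * θ)) *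
                (4 * (∑' n, u n t y * ∑ i ∈ Finset.range (n + 1), N i t) ^ 2) := by rw [mul_pow]; norm_num
            _ ≤ ‖y‖ₑ ^ (-(2 - 2 * θ)) *
                (4 * ((∑' n : ℕ, 2 ^ (((n : ℝ) + m) * (1 / 2 + θ)) * u n t y ^ 2) * Y t)) := by gcongr
            _ = (‖y‖ₑ ^ (-(2 - 2 * θ)) * ∑' n : ℕ, 2 ^ (((n : ℝ) + m) * (1 / 2 + θ)) * u n t y ^ 2) *
                (4 * Y t) := by ring
            _ = _ := by
                rw [← ENNReal.tsum_mul_left]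
                congr 2; ext n; ring
      _ = (∫⁻ y, ∑' n : ℕ, 2 ^ (((n : ℝ) + m) * (1 / 2 + θ)) * (‖y‖ₑ ^ (-(2 - 2 * θ)) * u n t y ^ 2)) *
            (4 * Y t) := lintegral_mul_const'' _ (AEMeasurable.tsum hterm)
      _ = X t * (4 * Y t) := by
          rw [lintegral_tsum hterm]
          congr 2; ext n
          exact lintegral_const_mul' _ _ (two_rpow_ne_top _)
      _ = _ := by ring
  have hexp : ∀ n : ℕ, (2 : ℝ≥0∞) ^ (-(γ * m)) * 2 ^ (-(γ * n)) = 2 ^ (-(((n : ℝ) + m) * γ)) := fun n => by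
    rw [← two_rpow_add]; congr 1; ring
  have hX : ∫⁻ t in J, X t ≤ (C₁ * C₂ : ℝ≥0) * (2 ^ (-(γ * m)) * B ^ 2) := by
    calc ∫⁻ t in J, X t = ∑' n : ℕ, 2 ^ (((n : ℝ) + m) * (1 / 2 + θ)) *
          ∫⁻ t in J, ∫⁻ y, ‖y‖ₑ ^ (-(2 - 2 * θ)) * u n t y ^ 2 := by
          rw [lintegral_tsum fun n => (hXm n).const_mul _]
          congr 1; ext n
          exact lintegral_const_mul' _ _ (two_rpow_ne_top _)
      _ ≤ ∑' n : ℕ, C₁ * B ^ 2 * (2 ^ (-(γ * m)) * 2 ^ (-(γ * n))) := by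
          refine ENNReal.tsum_le_tsum fun n => ?_
          calc _ ≤ 2 ^ (((n : ℝ) + m) * (1 / 2 + θ)) * (C₁ * 2 ^ ((((n : ℤ) + m : ℤ) : ℝ) * (2 - 2 * θ - 3)) *
                (2 ^ (((n : ℝ) + m) * δ) * B) ^ 2) := by
                gcongr
                exact (hC₁ (n + m) J f hf).trans (by gcongr; exact hS n)
            _ = C₁ * B ^ 2 * (2 ^ (((n : ℝ) + m) * (1 / 2 + θ)) *
                2 ^ ((((n : ℤ) + m : ℤ) : ℝ) * (2 - 2 * θ - 3)) * 2 ^ (2 * (((n : ℝ) + m) * δ))) := by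
                rw [mul_pow, two_rpow_sq]; ring
            _ = _ := by
                rw [hexp, ← two_rpow_add, ← two_rpow_add]; congr 2; push_cast; rw [hγd]; ring
      _ = _ := by
          rw [ENNReal.tsum_mul_left, ENNReal.tsum_mul_left, hC₂]; push_cast; ring
  have hY : ∫⁻ t in J, Y t ≤ (C₃ * C₂ : ℝ≥0) * (2 ^ (-(γ * m)) * B ^ 2) := by
    have hN2 : ∀ n : ℕ, ∫⁻ t in J, N n t ^ 2 ≤ (2 ^ (((n : ℝ) + m) * δ) * B) ^ 2 := fun n => by
      have := stNorm_two_top_sq J univ fun t => lpProj ψ (n + m) (f t)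
      rw [Measure.restrict_univ] at this
      rw [← this]
      exact pow_le_pow_left' ((stNorm_le_strichartzS ψ J (n + m) f).trans (hS n)) 2
    calc ∫⁻ t in J, Y t = ∑' n : ℕ, 2 ^ (-(((n : ℝ) + m) * (1 / 2 + θ))) *
          ∫⁻ t in J, (∑ i ∈ Finset.range (n + 1), N i t) ^ 2 := by
          rw [lintegral_tsum fun n => (hYm n).const_mul _]
          congr 1; ext n
          exact lintegral_const_mul' _ _ (two_rpow_ne_top _)
      _ ≤ ∑' n : ℕ, C₃ * B ^ 2 * (2 ^ (-(γ * m)) * 2 ^ (-(γ * n))) := by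
          refine ENNReal.tsum_le_tsum fun n => ?_
          calc _ ≤ 2 ^ (-(((n : ℝ) + m) * (1 / 2 + θ))) * (C₃ * (2 ^ (((n : ℝ) + m) * δ) * B) ^ 2) := by
                gcongr
                exact hC₃ _ N m B hNm hN2 n
            _ = C₃ * B ^ 2 * (2 ^ (-(((n : ℝ) + m) * (1 / 2 + θ))) * 2 ^ (2 * (((n : ℝ) + m) * δ))) := by
                rw [mul_pow, two_rpow_sq]; ring
            _ = _ := by rw [hexp, ← two_rpow_add]; congr 2; rw [hγd]; ring
      _ = _ := by
          rw [ENNReal.tsum_mul_left, ENNReal.tsum_mul_left, hC₂]; push_cast; ring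
  have hXm' : AEMeasurable X (volume.restrict J) := AEMeasurable.tsum fun n => (hXm n).const_mul _
  have hYm' : AEMeasurable Y (volume.restrict J) := AEMeasurable.tsum fun n => (hYm n).const_mul _
  have hCS := le_sqrt_of_sq_le (sq_lintegral_mul_le (hXm'.pow_const (1 / 2 : ℝ)) (hYm'.pow_const (1 / 2 : ℝ)))
  simp_rw [sq_sqrt] at hCS
  have h4 : (4 : ℝ≥0∞) ^ (1 / 2 : ℝ) = 2 := by
    rw [← sqrt_sq 2]; norm_num
  calc _ ≤ ∫⁻ t in J, 2 * (X t ^ (1 / 2 : ℝ) * Y t ^ (1 / 2 : ℝ)) := by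
        refine lintegral_mono_ae ?_
        filter_upwards [hpt] with t ht
        refine (ENNReal.rpow_le_rpow ht (by norm_num)).trans (le_of_eq ?_)
        rw [ENNReal.mul_rpow_of_nonneg _ _ (by norm_num), ENNReal.mul_rpow_of_nonneg _ _ (by norm_num), h4]
    _ = 2 * ∫⁻ t in J, X t ^ (1 / 2 : ℝ) * Y t ^ (1 / 2 : ℝ) := lintegral_const_mul' _ _ ENNReal.ofNat_ne_top
    _ ≤ 2 * (((C₁ * C₂ : ℝ≥0) * (2 ^ (-(γ * m)) * B ^ 2)) *
          ((C₃ * C₂ : ℝ≥0) * (2 ^ (-(γ * m)) * B ^ 2))) ^ (1 / 2 : ℝ) := by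
        gcongr; exact hCS.trans (by gcongr)
    _ = _ := by
        rw [show ((C₁ * C₂ : ℝ≥0) * (2 ^ (-(γ * m)) * B ^ 2)) * ((C₃ * C₂ : ℝ≥0) * (2 ^ (-(γ * m)) * B ^ 2)) =
          ((C₁ * C₂ : ℝ≥0) : ℝ≥0∞) * (C₃ * C₂ : ℝ≥0) * (2 ^ (-(γ * m)) * B ^ 2) ^ 2 by ring,
          ENNReal.mul_rpow_of_nonneg _ _ (by norm_num), ENNReal.mul_rpow_of_nonneg _ _ (by norm_num), sqrt_sq,
          ← ENNReal.coe_rpow_of_nonneg _ (by norm_num), ← ENNReal.coe_rpow_of_nonneg _ (by norm_num)]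
        push_cast
        ring

/-- Trading one factor of H for D/|y| leaves |y|^(-θ) times u = |y|^(θ-1) H², and the Stein-Weiss
inequality bounds the result by the L² norm of u. -/
lemma lintegral_sq_opI_cube_le {ψ : E3 → ℝ} (hψ : IsLPCutoff ψ) {ε θ : ℝ} (hθ0 : 0 < θ) (hθ : θ < 1 / 2 - ε)
    (hθ1 : θ ≤ 1 / 2) {c : ℝ} (hc : 0 < c) (K : ℝ) : ∃ C : ℝ≥0, ∀ (k : ℤ) (M : E3 → ℝ),
    AEStronglyMeasurable M volume → (∀ x, |M x| ≤ K * Real.exp (-c * ‖x‖)) → ∀ (F : E3 → ℝ) (H : E3 → ℝ≥0∞)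
    (D : ℝ≥0∞), AEMeasurable F → AEMeasurable H → (∀ᵐ y, ‖F y‖ₑ ≤ H y) → (∀ y, H y ≤ D * ‖y‖ₑ ^ (-1 : ℝ)) →
    ∫⁻ x, ‖opI ψ ε k (fun y => M y * F y ^ 3) x‖ₑ ^ 2 ≤
      (C * 2 ^ ((k : ℝ) * θ) * D) ^ 2 * ∫⁻ y, ‖y‖ₑ ^ (-(2 - 2 * θ)) * H y ^ 4 := by
  obtain ⟨C₁, hC₁⟩ := hψ.opI_le
  obtain ⟨C₂, hC₂⟩ := enorm_le_bracket hc K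
  obtain ⟨C₃, hC₃⟩ := lintegral_sq_smoothingKernel_singular hθ0 hθ hθ1
  refine ⟨C₁ * C₂ * (C₃ + 1), fun k M hMm hM F H D hF hH hFH hHD => ?_⟩
  have hMF : AEMeasurable fun y => M y * F y ^ 3 := hMm.aemeasurable.mul (hF.pow_const 3)
  set u : E3 → ℝ≥0∞ := fun y => ‖y‖ₑ ^ (θ - 1) * H y ^ 2
  have hu : AEMeasurable u := AEMeasurable.mul (by fun_prop) (hH.pow_const 2)
  have hbd : ∀ᵐ y, ‖M y * F y ^ 3‖ₑ ≤ C₂ * D * (‖y‖ₑ ^ (-θ) * u y) := by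
    filter_upwards [hFH, Measure.ae_ne volume (0 : E3)] with y hy hy0
    have hMy : ‖M y‖ₑ ≤ C₂ := (hC₂ M hM y).trans
      (mul_le_of_le_one_right' (bracket_rpow_le_one 0 y zero_le_one))
    have he : ‖y‖ₑ ^ (-1 : ℝ) = ‖y‖ₑ ^ (-θ) * ‖y‖ₑ ^ (θ - 1) := by
      rw [← ENNReal.rpow_add _ _ (by simpa using hy0) enorm_ne_top]; ring_nf
    rw [enorm_mul, enorm_pow]
    calc ‖M y‖ₑ * ‖F y‖ₑ ^ 3 ≤ C₂ * H y ^ 3 := by gcongr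
      _ = C₂ * (H y * H y ^ 2) := by ring
      _ ≤ C₂ * (D * ‖y‖ₑ ^ (-1 : ℝ) * H y ^ 2) := by gcongr; exact hHD y
      _ = _ := by simp only [u]; rw [he]; ring
  calc ∫⁻ x, ‖opI ψ ε k (fun y => M y * F y ^ 3) x‖ₑ ^ 2
      ≤ ∫⁻ x, (C₁ * (C₂ * D) * ∫⁻ y, smoothingKernel (1 / 2 - ε) k (x - y) * (‖y‖ₑ ^ (-θ) * u y)) ^ 2 := by
        refine lintegral_mono fun x => pow_le_pow_left' ((hC₁ ε k _ x hMF).trans ?_) 2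
        have hm : AEMeasurable fun y => smoothingKernel (1 / 2 - ε) k (x - y) * (‖y‖ₑ ^ (-θ) * u y) :=
          AEMeasurable.mul (by fun_prop) (AEMeasurable.mul (by fun_prop) hu)
        rw [mul_assoc, ← lintegral_const_mul'' _ hm]
        refine mul_le_mul_right (lintegral_mono_ae ?_) _
        filter_upwards [hbd] with y hy
        refine (mul_le_mul_right hy _).trans (le_of_eq (by ring))
    _ = (C₁ * (C₂ * D)) ^ 2 *
          ∫⁻ x, (∫⁻ y, smoothingKernel (1 / 2 - ε) k (x - y) * (‖y‖ₑ ^ (-θ) * u y)) ^ 2 := by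
        simp_rw [mul_pow _ (lintegral _ _)]
        refine lintegral_const_mul'' _ (AEMeasurable.pow_const ?_ 2)
        refine AEMeasurable.lintegral_prod_right' (f := fun p : E3 × E3 =>
          smoothingKernel (1 / 2 - ε) k (p.1 - p.2) * (‖p.2‖ₑ ^ (-θ) * u p.2)) ?_
        refine AEMeasurable.mul ?_ (AEMeasurable.mul (by fun_prop) ?_)
        · exact ((measurable_smoothingKernel _ k).comp (by fun_prop : Measurable
            fun p : E3 × E3 => p.1 - p.2)).aemeasurable
        · exact hu.comp_quasiMeasurePreserving Measure.quasiMeasurePreserving_snd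
    _ ≤ (C₁ * (C₂ * D)) ^ 2 * (C₃ * 2 ^ (2 * k * θ) * ∫⁻ y, u y ^ 2) := by gcongr; exact hC₃ k u hu
    _ ≤ (C₁ * (C₂ * D)) ^ 2 * ((C₃ + 1) ^ 2 * 2 ^ (2 * k * θ) * ∫⁻ y, u y ^ 2) := by
        gcongr
        exact (le_self_add (a := (C₃ : ℝ≥0∞)) (b := 1)).trans (le_self_pow₀ le_add_self two_ne_zero)
    _ = _ := by
        have hu2 : ∀ y, u y ^ 2 = ‖y‖ₑ ^ (-(2 - 2 * θ)) * H y ^ 4 := fun y => by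
          simp only [u]
          rw [mul_pow, ← pow_mul, ← ENNReal.rpow_natCast (‖y‖ₑ ^ (θ - 1)), ← ENNReal.rpow_mul]
          congr 2; push_cast; ring
        simp_rw [hu2]
        rw [show 2 * (k : ℝ) * θ = 2 * (k * θ) by ring, ← two_rpow_sq]
        push_cast; ring

/-- Radial Sobolev and the energy part give |P_j f| ≲ 2^(-εj) B/|x|, which sums over j ≥ k - 7 to
the pointwise bound D/|x|. Stein-Weiss in space and the quartic bound in time complete the cubic
estimate. -/
lemma cubic_high_frequency {ψ : E3 → ℝ} (hψ : IsLPCutoff ψ) {ε : ℝ} (hε₀ : 0 < ε) (hε : ε < 1 / 2) {s : ℝ}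
    (hs : s = 1 / 2 + ε) {c : ℝ} (hc : 0 < c)
    (K : ℝ) : ∃ C : ℝ≥0, ∀ k : ℤ, 1 ≤ k → ∀ J : Set ℝ, MeasurableSet J → ∀ M : E3 → ℝ,
    AEStronglyMeasurable M volume → (∀ x, |M x| ≤ K * Real.exp (-c * ‖x‖)) → ∀ f : ℝ → E3 → ℝ,
    MeasurableOnST J f → RadialOn J f → (∀ t ∈ J, HasFourierFun (f t)) →
    stNorm 1 2 J univ (fun t => opI ψ ε k (fun y => M y * (lpProjGe ψ (k - 7) (f t) y) ^ 3)) ≤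
      C * ((2 : ℝ≥0∞) ^ ((k : ℝ) * (1 - s - ε)) * (⨆ (j : ℤ) (_ : k - 7 ≤ j),
        (2 : ℝ≥0∞) ^ (-(j : ℝ) * (1 - s)) * strichartzS ψ J j f) ^ 3) := by
  -- Any positive value strictly between 1/2 - 2ε and 1/2 - ε would do: the lower bound makes the
  -- frequency sum in time converge, the upper one is required by Stein-Weiss.
  set θ := (1 / 2 - ε) * (1 - ε) with hθd
  have hθ0 : 0 < θ := mul_pos (by linarith) (by linarith)
  have hθε : θ < 1 / 2 - ε := by rw [hθd]; nlinarith
  obtain ⟨C₁, hC₁⟩ := hψ.enorm_lpProj_radial_le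
  obtain ⟨C₂, hC₂⟩ := tsum_two_rpow hε₀
  obtain ⟨C₃, hC₃⟩ := lintegral_sq_opI_cube_le hψ hθ0 hθε (by linarith) hc K
  obtain ⟨C₄, hC₄⟩ := lintegral_sqrt_singular_le hψ (δ := 1 - s) hθ0 (by linarith) (by linarith)
    (by rw [hs, hθd]; nlinarith)
  set C₀ : ℝ≥0 := 2 ^ (7 : ℝ)
  refine ⟨C₃ * C₁ * C₂ * C₄ * C₀ + 1, fun k hk J hJ M hMm hM f hf hrad hF => ?_⟩
  set B := ⨆ (j : ℤ) (_ : k - 7 ≤ j), (2 : ℝ≥0∞) ^ (-(j : ℝ) * (1 - s)) * strichartzS ψ J j f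
  -- An infinite B makes the right-hand side infinite, thanks to the + 1 in the constant; finiteness
  -- is needed for the reconstruction from pieces.
  rcases eq_or_ne B ⊤ with hB | hB
  · rw [hB, show ((⊤ : ℝ≥0∞) ^ 3) = ⊤ by simp, ENNReal.mul_top (two_rpow_ne_zero _), ENNReal.mul_top (by simp)]
    exact le_top
  set m := k - 7 with hm
  have hS : ∀ j : ℤ, m ≤ j → strichartzS ψ J j f ≤ 2 ^ ((j : ℝ) * (1 - s)) * B := fun j hj => by
    refine le_two_rpow_mul ?_
    rw [← neg_mul]
    exact le_iSup₂ (f := fun (j : ℤ) (_ : k - 7 ≤ j) =>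
      (2 : ℝ≥0∞) ^ (-(j : ℝ) * (1 - s)) * strichartzS ψ J j f) j hj
  have hSn : ∀ n : ℕ, strichartzS ψ J (n + m) f ≤ 2 ^ (((n : ℝ) + m) * (1 - s)) * B := fun n => by
    have := hS (n + m) (by omega)
    push_cast at this; exact this
  set D : ℝ≥0∞ := C₁ * C₂ * 2 ^ (-(ε * m)) * B
  have hL2 : ∀ᵐ t ∂volume.restrict J, ∀ n : ℕ, (∫⁻ x, ‖lpProj ψ (n + m) (f t) x‖ₑ ^ 2) ^ (1 / 2 : ℝ) ≤
      2 ^ (-((n + m : ℝ) * s)) * B := by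
    refine ae_all_iff.2 fun n => ?_
    filter_upwards [ae_lintegral_sq_le_stNorm J fun t => lpProj ψ (n + m) (f t)] with t ht
    refine ht.trans ?_
    have h := (energy_le_strichartzS ψ J (n + m) f).trans (hS (n + m) (by omega))
    rw [← neg_neg (((n + m : ℤ) : ℝ))] at h
    refine (le_two_rpow_mul h).trans (le_of_eq ?_)
    rw [← mul_assoc, ← two_rpow_add]; congr 2; push_cast; ring
  have hum : ∀ᵐ t ∂volume.restrict J, ∀ n : ℕ, AEMeasurable (lpProj ψ (n + m) (f t)) :=
    ae_all_iff.2 fun n => (hf.lpProj hψ (n + m)).ae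
  rw [stNorm_one_two]
  simp only [Measure.restrict_univ]
  calc _ ≤ ∫⁻ t in J, C₃ * 2 ^ ((k : ℝ) * θ) * D *
        (∫⁻ y, ‖y‖ₑ ^ (-(2 - 2 * θ)) * (∑' n : ℕ, ‖lpProj ψ (n + m) (f t) y‖ₑ) ^ 4) ^ (1 / 2 : ℝ) := by
        refine lintegral_mono_ae ?_
        filter_upwards [hL2, hum, hf.ae, ae_restrict_mem hJ,
          sum_lpProj_ne_top hψ (show 0 < s by linarith) hf hB hS] with t h2 hut hft htJ hfin
        obtain ⟨w, hw⟩ := hF t htJ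
        have hHD : ∀ y, ∑' n : ℕ, ‖lpProj ψ (n + m) (f t) y‖ₑ ≤ D * ‖y‖ₑ ^ (-1 : ℝ) := fun y => by
          calc ∑' n : ℕ, ‖lpProj ψ (n + m) (f t) y‖ₑ
              ≤ ∑' n : ℕ, C₁ * 2 ^ (-(ε * m)) * B * ‖y‖ₑ ^ (-1 : ℝ) * 2 ^ (-(ε * n)) := by
                refine ENNReal.tsum_le_tsum fun n => (hC₁ (f t) w hw (hrad t htJ) (n + m) y).trans ?_
                calc _ ≤ C₁ * (2 ^ ((((n : ℤ) + m : ℤ) : ℝ) / 2) * ‖y‖ₑ ^ (-1 : ℝ)) *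
                      (2 ^ (-((n + m : ℝ) * s)) * B) := by
                      gcongr
                      · exact weight_le_enorm _ y
                      · exact h2 n
                  _ = C₁ * B * ‖y‖ₑ ^ (-1 : ℝ) *
                      (2 ^ ((((n : ℤ) + m : ℤ) : ℝ) / 2) * 2 ^ (-((n + m : ℝ) * s))) := by ring
                  _ = C₁ * B * ‖y‖ₑ ^ (-1 : ℝ) * (2 ^ (-(ε * m)) * 2 ^ (-(ε * n))) := by
                      rw [← two_rpow_add, ← two_rpow_add]; congr 2; push_cast; rw [hs]; ring
                  _ = _ := by ring
            _ = _ := by rw [ENNReal.tsum_mul_left, hC₂]; simp only [D]; ring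
        have hFm : AEMeasurable (lpProjGe ψ m (f t)) :=
          hft.sub (hw.continuous_lpProjLe hψ (m - 1)).aemeasurable
        refine (ENNReal.rpow_le_rpow (hC₃ k M hMm hM _ _ D hFm
          (AEMeasurable.tsum fun n => (hut n).enorm) (hw.enorm_lpProjGe_le hψ m hfin) hHD)
          (by norm_num)).trans (le_of_eq ?_)
        rw [ENNReal.mul_rpow_of_nonneg _ _ (by norm_num), sqrt_sq]
    _ = C₃ * 2 ^ ((k : ℝ) * θ) * D * ∫⁻ t in J,
        (∫⁻ y, ‖y‖ₑ ^ (-(2 - 2 * θ)) * (∑' n : ℕ, ‖lpProj ψ (n + m) (f t) y‖ₑ) ^ 4) ^ (1 / 2 : ℝ) := by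
        refine lintegral_const_mul' _ _ ?_
        have h1 := two_rpow_ne_top ((k : ℝ) * θ)
        have h2 := two_rpow_ne_top (-(ε * m))
        simp only [D]
        finiteness
    _ ≤ C₃ * 2 ^ ((k : ℝ) * θ) * D * (C₄ * (2 ^ (-((θ + 1 / 2 - 2 * (1 - s)) * m)) * B ^ 2)) := by
        gcongr; exact hC₄ m J f B hf hSn
    _ = C₃ * C₁ * C₂ * C₄ * (2 ^ ((k : ℝ) * θ) * 2 ^ (-(ε * m)) *
          2 ^ (-((θ + 1 / 2 - 2 * (1 - s)) * m))) * B ^ 3 := by simp only [D]; ring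
    _ ≤ C₃ * C₁ * C₂ * C₄ * (2 ^ (7 : ℝ) * 2 ^ ((k : ℝ) * (1 - s - ε))) * B ^ 3 := by
        refine mul_le_mul_left (mul_le_mul_right ?_ _) _
        rw [← two_rpow_add, ← two_rpow_add, ← two_rpow_add]
        -- With m = k - 7 the exponent is k(1/2 - 3ε) + 7(3ε/2 + ε²). The first part is below k(1/2
        -- - 2ε) because k > 0, and the second is below 7 because ε < 1/2.
        refine two_rpow_le ?_
        have hk' : (1 : ℝ) ≤ k := by exact_mod_cast hk
        rw [hm, hs, hθd]
        push_cast
        nlinarith [mul_pos hε₀ (show 0 < 1 / 2 - ε by linarith), mul_pos hε₀ (show (0 : ℝ) < k by linarith)]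
    _ = (C₃ * C₁ * C₂ * C₄ * C₀ : ℝ≥0) * (2 ^ ((k : ℝ) * (1 - s - ε)) * B ^ 3) := by
        simp only [C₀]
        push_cast
        rw [ENNReal.coe_rpow_of_nonneg _ (by norm_num), ENNReal.coe_ofNat]
        ring
    _ ≤ _ := mul_le_mul_left (ENNReal.coe_le_coe.2 le_self_add) _

end

theorem theorem5p3
    (ψ : E3 → ℝ) (hψ : IsLPCutoff ψ)
    (ε : ℝ) (hε₀ : 0 < ε) (hε₁ : ε < 1 / 2)
    (s : ℝ) (hs : s = 1 / 2 + ε)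
    (c : ℝ) (hc : 0 < c) (K : ℝ) :
    ∃ C : ℝ≥0, ∀ k₀ : ℤ, 1 ≤ k₀ → ∀ J : Set ℝ, J.OrdConnected →
      ∀ M : E3 → ℝ, AEStronglyMeasurable M volume →
      (∀ x, |M x| ≤ K * Real.exp (-c * ‖x‖)) →
      -- first trilinear estimate
      (∀ f g h : ℝ → E3 → ℝ,
        MeasurableOnST J f → MeasurableOnST J g → MeasurableOnST J h →
        RadialOn J f → RadialOn J g → RadialOn J h →
        stNorm 1 1 J univ (fun t x =>
            opI ψ ε k₀ (fun y => M y * f t y * g t y) x * lpProjLe ψ k₀ (h t) x)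
          + stNorm 1 1 J univ (fun t x => M x * f t x * g t x * lpProjLe ψ k₀ (h t) x)
        ≤ C * ((2 : ℝ≥0∞) ^ ((k₀ : ℝ) / 2) * ENNReal.ofReal |(k₀ : ℝ)|
            * localEnergyNorm k₀ J f * localEnergyNorm k₀ J g * stNorm ∞ 2 J univ h)) ∧
      -- its analogue with the weight `1 / |x|` away from the origin
      (∀ f g : ℝ → E3 → ℝ,
        MeasurableOnST J f → MeasurableOnST J g → RadialOn J f → RadialOn J g →
        stNorm 1 1 J {x : E3 | (2 : ℝ) ^ (1 - k₀) < ‖x‖} (fun t x =>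
            opI ψ ε k₀ (fun y => M y * f t y * g t y) x * (1 / ‖x‖))
          + stNorm 1 1 J {x : E3 | (2 : ℝ) ^ (1 - k₀) < ‖x‖} (fun t x =>
              M x * f t x * g t x * (1 / ‖x‖))
        ≤ C * (ENNReal.ofReal |(k₀ : ℝ)|
            * localEnergyNorm k₀ J f * localEnergyNorm k₀ J g)) ∧
      -- second trilinear estimate
      (∀ f g h : ℝ → E3 → ℝ,
        MeasurableOnST J f → MeasurableOnST J g → MeasurableOnST J h →
        stNorm 1 1 J univ (fun t x => opI ψ ε k₀ (fun y => M y * g t y * h t y) x * f t x)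
        ≤ C * (ENNReal.ofReal |(k₀ : ℝ)| * stNorm 2 2 J univ g * localEnergyNorm k₀ J f
            * ((2 : ℝ≥0∞) ^ (-(k₀ : ℝ) / 2) * stNorm ∞ ∞ J univ h
                + stNorm ∞ ∞ J univ (fun t x => ‖x‖ ^ (1 / 2 : ℝ) * h t x)))) ∧
      -- cubic high-frequency estimate
      (∀ f : ℝ → E3 → ℝ,
        MeasurableOnST J f → RadialOn J f → (∀ t ∈ J, HasFourierFun (f t)) →
        stNorm 1 2 J univ (fun t =>
            opI ψ ε k₀ (fun y => M y * (lpProjGe ψ (k₀ - 7) (f t) y) ^ 3))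
        ≤ C * ((2 : ℝ≥0∞) ^ ((k₀ : ℝ) * (1 - s - ε))
              * (⨆ (j : ℤ) (_ : k₀ - 7 ≤ j),
                  (2 : ℝ≥0∞) ^ (-(j : ℝ) * (1 - s)) * strichartzS ψ J j f) ^ 3
            + (2 : ℝ≥0∞) ^ ((k₀ : ℝ) * (1 - s - ε))
              * (⨆ (j : ℤ) (_ : k₀ - 7 ≤ j),
                  (2 : ℝ≥0∞) ^ (-(j : ℝ) * (1 - s)) * strichartzS ψ J j f) ^ 2
              * supHDotNorm s J f)) ∧
      -- bilinear estimate
      (∀ f g : ℝ → E3 → ℝ, ∀ j : ℤ,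
        MeasurableOnST J f → MeasurableOnST J g → RadialOn J f → RadialOn J g →
        stNorm 2 2 J univ (fun t x => M x * lpProj ψ j (f t) x * g t x)
        ≤ C * (ENNReal.ofReal |(k₀ : ℝ)| * (2 : ℝ≥0∞) ^ (-(j : ℝ)) * strichartzS ψ J j f
            * ((2 : ℝ≥0∞) ^ (-(k₀ : ℝ) / 2) * stNorm ∞ ∞ J univ g + supHDotNorm 1 J g))) ∧
      -- trilinear estimate close to the origin
      (∀ f g h : ℝ → E3 → ℝ,
        MeasurableOnST J f → MeasurableOnST J g → MeasurableOnST J h →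
        (∀ t ∈ J, HasFourierFun (f t)) →
        stNorm (4 / 3) (4 / 3) J univ (fun t x =>
            opI ψ ε k₀ (fun y => M y * f t y * g t y * h t y) x
              * ψ ((2 : ℝ) ^ k₀ • x) * (1 / ‖x‖ ^ (3 / 4 : ℝ)))
        ≤ C * ((2 : ℝ≥0∞) ^ (-(k₀ : ℝ) * s)
            * (⨆ j : ℤ, (2 : ℝ≥0∞) ^ (-(j : ℝ) * (1 - s)) * strichartzS ψ J j f)
            * localEnergyNorm k₀ J (fun t x => g t x ^ 2) ^ (1 / 2 : ℝ)
            * stNorm ∞ ∞ J univ h)) := by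
  obtain ⟨C₁, h₁⟩ := trilinear_low_frequency hψ hε₁ hc K
  obtain ⟨C₂, h₂⟩ := bilinear_exterior hψ hε₁ hc K
  obtain ⟨C₃, h₃⟩ := trilinear_high_frequency hψ hε₁ hc K
  obtain ⟨C₄, h₄⟩ := cubic_high_frequency hψ hε₀ hε₁ hs hc K
  obtain ⟨C₅, h₅⟩ := bilinear_estimate hψ hc K
  obtain ⟨C₆, h₆⟩ := trilinear_near_origin hψ hε₁ (s := s) (by linarith) (by linarith) hc K
  have hC : ∀ C ∈ ({C₁, C₂, C₃, C₄, C₅, C₆} : Set ℝ≥0),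
      (C : ℝ≥0∞) ≤ ((C₁ + C₂ + C₃ + C₄ + C₅ + C₆ : ℝ≥0) : ℝ≥0∞) := by
    intro C hC
    rw [ENNReal.coe_le_coe, ← NNReal.coe_le_coe]
    push_cast
    have := C₁.2; have := C₂.2; have := C₃.2; have := C₄.2; have := C₅.2; have := C₆.2
    rcases hC with rfl | rfl | rfl | rfl | rfl | rfl <;> linarith
  refine ⟨C₁ + C₂ + C₃ + C₄ + C₅ + C₆, fun k₀ hk J hJ M hMm hM => ?_⟩
  have hJm : MeasurableSet J := hJ.measurableSet
  refine ⟨fun f g h hf hg hh _ _ hhr => ?_, fun f g hf hg _ _ => ?_, fun f g h hf hg hh => ?_,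
    fun f hf hfr hF => ?_, fun f g j hf _ _ hgr => ?_, fun f g h hf hg hh hF => ?_⟩
  · exact (h₁ k₀ hk J hJm M hMm hM f g h hf hg hh hhr).trans (mul_le_mul_left (hC _ (by simp)) _)
  · exact (h₂ k₀ hk J M hMm hM f g hf hg).trans (mul_le_mul_left (hC _ (by simp)) _)
  · exact (h₃ k₀ hk J M hMm hM f g h hf hg hh).trans (mul_le_mul_left (hC _ (by simp)) _)
  -- The first of the two terms on the right is already large enough.
  · exact (h₄ k₀ hk J hJm M hMm hM f hf hfr hF).trans (mul_le_mul' (hC _ (by simp)) le_self_add)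
  · exact (h₅ k₀ hk J hJm M hM f g j hf hgr).trans (mul_le_mul_left (hC _ (by simp)) _)
  · exact (h₆ k₀ J hJm M hMm hM f g h hf hg hh hF).trans (mul_le_mul_left (hC _ (by simp)) _)
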